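/- Let $\mathbb T^2=(\mathbb R/2\pi\mathbb Z)^2$, $f(r)=r^3-r$, $F(r)=\frac14(r^2-1)^2$, $\widehat g(k)=\int_{\mathbb T^2} g(x)e^{-ik\cdot x}\,dx$ for $k\in\mathbb Z^2$, $\|g\|_{H^s}^2=(2\pi)^{-2}\sum_{k}(1+|k|^{2s})|\widehat g(k)|^2$, and $E(g)=\int_{\mathbb T^2}\big(\frac{\nu}{2}|\nabla g|^2+F(g)\big)\,dx$ for $\nu>0$. For an integer $N\ge 2$ let $\Pi_N$ be the truncation to the Fourier modes with $\max(|k_1|,|k_2|)\le N$. There is a function $\beta_0:\mathbb R\to(0,\infty)$ such that the following holds. Let $\nu>0$, $s\ge 10$ be real, $u_0\in H^s(\mathbb T^2)$ be real-valued, and let $u$ be the global classical solution of the Cahn–Hilliard equation $$\partial_t u=\Delta(-\nu\Delta u+f(u))\ \text{ on } \mathbb T^2\times(0,\infty),\qquad u(0)=u_0 .$$ Let $0<\tau\le M$ for some $M>0$, let $N\ge 2$ be an integer, let $$S\ge\beta\big(\|u_0\|_{H^2}^2+\nu^{-1}|\log\nu|+\nu^{-1}\log N+\nu\big)\quad\text{for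 some }\beta\ge\beta_0(E(u_0)),$$ and let $u^n$ $(n\ge 0)$ be the iterates of the scheme $$\frac{u^{n+1}-u^n}{\tau}+S\Delta^2(u^{n+1}-u^n)=\frac{e^{-\nu\Delta^2\tau}-1}{\tau}u^n+\frac{1-e^{-\nu\Delta^2\tau}}{\tau\nu\Delta}\Pi_N[f(u^n)],\qquad u^0=\Pi_N u_0,$$ where the operators are Fourier multipliers ($\Delta$ has the symbol $-|k|^2$, and the symbol of the last operator is $0$ at $k=0$). Then, with $t_m=m\tau$, for every $m\ge 1$, $$\|u^m-u(t_m)\|_{L^2(\mathbb T^2)}\le(1+S)\,C_2\,e^{C_1t_m}\left(N^{-s}+\tau+\tau N^{-s+4}\right),$$ where $C_1>0$ depends only on $\nu,u_0$, and $C_2>0$ depends only on $s,\nu,u_0$. -/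

import Mathlib

open scoped Laplacian

noncomputable section

namespace CahnHilliard

instance factTwoPiPos : Fact (0 < 2 * Real.pi) := ⟨Real.two_pi_pos⟩

/-- The torus `𝕋² = (ℝ / 2πℤ)²`; its `volume` is the product measure of total mass `(2π)²`. -/
abbrev Torus : Type := Fin 2 → AddCircle (2 * Real.pi)

/-- The Euclidean plane, the universal cover of the torus. -/
abbrev Plane : Type := EuclideanSpace ℝ (Fin 2)

/-- The `2π`-periodic function on the plane that corresponds to a function on the torus. Spatial
derivatives of `g` are taken on this lift. -/
def lift (g : Torus → ℝ) : Plane → ℝ := fun y => g (fun i => (y i : AddCircle (2 * Real.pi)))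

/-- The character `x ↦ exp (i k·x)`. -/
def character (k : Fin 2 → ℤ) (x : Torus) : ℂ := ∏ i, fourier (k i) (x i)

/-- `ĝ(k) = ∫ g(x) exp (-i k·x) dx`, without a normalising factor. -/
def fourierHat (g : Torus → ℝ) (k : Fin 2 → ℤ) : ℂ := ∫ x, character (-k) x * (g x : ℂ)

/-- `|k|² = k₁² + k₂²`. -/
def normSq (k : Fin 2 → ℤ) : ℝ := ∑ i, (k i : ℝ) ^ 2

/-- `g ∈ H^s(𝕋²)`: `g ∈ L²` and `∑ (1 + |k|^{2s}) |ĝ(k)|² < ∞`. -/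
def MemSobolev (s : ℝ) (g : Torus → ℝ) : Prop :=
  MeasureTheory.MemLp g 2 MeasureTheory.volume ∧
    Summable fun k : Fin 2 → ℤ => (1 + normSq k ^ s) * ‖fourierHat g k‖ ^ 2

/-- `‖g‖²_{H^s} = (2π)⁻² ∑ (1 + |k|^{2s}) |ĝ(k)|²`. -/
def sobolevNormSq (s : ℝ) (g : Torus → ℝ) : ℝ :=
  ((2 * Real.pi) ^ 2)⁻¹ * ∑' k : Fin 2 → ℤ, (1 + normSq k ^ s) * ‖fourierHat g k‖ ^ 2

/-- `‖∇g‖₂² = (2π)⁻² ∑ |k|² |ĝ(k)|²`, the square of the seminorm of `g` in the homogeneous space of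
order one. -/
def gradNormSq (g : Torus → ℝ) : ℝ :=
  ((2 * Real.pi) ^ 2)⁻¹ * ∑' k : Fin 2 → ℤ, normSq k * ‖fourierHat g k‖ ^ 2

/-- The nonlinearity `f(u) = u³ - u`. -/
def f (r : ℝ) : ℝ := r ^ 3 - r

/-- The potential `F(u) = (u² - 1)² / 4`. -/
def F (r : ℝ) : ℝ := (r ^ 2 - 1) ^ 2 / 4

/-- The energy `E(g) = ∫ (ν/2 |∇g|² + F(g)) dx`. -/
def energy (ν : ℝ) (g : Torus → ℝ) : ℝ := ν / 2 * gradNormSq g + ∫ x, F (g x)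

/-- `u` is a global classical solution of `∂ₜu = Δ(-ν Δu + f(u))` on the torus with initial data
`u₀`: it is continuous on `[0,∞) × 𝕋²`, equals `u₀` (almost everywhere) at time zero, has jointly
continuous spatial derivatives up to order four at positive times and satisfies the equation
there. -/
structure IsSolution (ν : ℝ) (u₀ : Torus → ℝ) (u : ℝ → Torus → ℝ) : Prop where
  continuousOn : ContinuousOn (fun p : ℝ × Torus => u p.1 p.2) (Set.Ici 0 ×ˢ Set.univ)
  init : u 0 =ᵐ[MeasureTheory.volume] u₀
  contDiff : ∀ t : ℝ, 0 < t → ContDiff ℝ 4 (lift (u t))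
  continuousOn_deriv : ∀ j : ℕ, j ≤ 4 →
    ContinuousOn (fun p : ℝ × Plane => iteratedFDeriv ℝ j (lift (u p.1)) p.2)
      (Set.Ioi 0 ×ˢ Set.univ)
  equation : ∀ t : ℝ, 0 < t → ∀ y : Plane,
    HasDerivAt (fun r => lift (u r) y)
      (Δ (fun z => -ν * Δ (lift (u t)) z + f (lift (u t) z)) y) t

/-- The Fourier modes `k` with `|k|_∞ ≤ N`. -/
def modes (N : ℕ) : Finset (Fin 2 → ℤ) := Fintype.piFinset fun _ => Finset.Icc (-(N : ℤ)) N

/-- The operator `σ(D) Π_N`, where `Π_N` is the truncation to the modes `|k|_∞ ≤ N` and `σ(D)` is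
the Fourier multiplier with symbol `σ`. For an even real `σ`, as below, the sum is real. -/
def truncMultiplier (N : ℕ) (σ : (Fin 2 → ℤ) → ℝ) (g : Torus → ℝ) : Torus → ℝ := fun x =>
  ((((2 * Real.pi) ^ 2)⁻¹ : ℝ) * ∑ k ∈ modes N, (σ k : ℂ) * fourierHat g k * character k x).re

/-- The truncation `Π_N`. -/
def proj (N : ℕ) (g : Torus → ℝ) : Torus → ℝ := truncMultiplier N (fun _ => 1) g

/-- The symbol `|k|⁴` of `Δ²`. -/
def bilaplaceSymbol (k : Fin 2 → ℤ) : ℝ := normSq k ^ 2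

/-- The symbol of `(exp (-ν Δ² τ) - 1) / τ`. -/
def linSymbol (ν τ : ℝ) (k : Fin 2 → ℤ) : ℝ :=
  (Real.exp (-ν * normSq k ^ 2 * τ) - 1) / τ

/-- The symbol of `(1 - exp (-ν Δ² τ)) / (τ ν Δ)`, where `Δ` has the symbol `-|k|²`. At `k = 0` the
quotient is `0 / 0 = 0`, which is the limit of the symbol as `|k| → 0`. -/
def nonlinSymbol (ν τ : ℝ) (k : Fin 2 → ℤ) : ℝ :=
  (1 - Real.exp (-ν * normSq k ^ 2 * τ)) / (τ * ν * -normSq k)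

/-- `U 0, U 1, …` are the iterates of the stabilized exponential integrator scheme
`(Uⁿ⁺¹ - Uⁿ)/τ + S Δ² (Uⁿ⁺¹ - Uⁿ) = (e^{-νΔ²τ} - 1)/τ Uⁿ + (1 - e^{-νΔ²τ})/(τνΔ) Π_N f(Uⁿ)`,
`U⁰ = Π_N u₀`. All `Uⁿ` have Fourier modes in `|k|_∞ ≤ N` only, so that the operators that act
on them may be written with the truncation. -/
structure IsScheme (ν S τ : ℝ) (N : ℕ) (u₀ : Torus → ℝ) (U : ℕ → Torus → ℝ) : Prop where
  init : U 0 = proj N u₀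
  step : ∀ (n : ℕ) (x : Torus),
    (U (n + 1) x - U n x) / τ
        + S * truncMultiplier N bilaplaceSymbol (fun z => U (n + 1) z - U n z) x
      = truncMultiplier N (linSymbol ν τ) (U n) x
        + truncMultiplier N (nonlinSymbol ν τ) (fun z => f (U n z)) x

end CahnHilliard

end

noncomputable section

namespace CahnHilliard

open scoped ComplexConjugate ENNReal
open MeasureTheory Set

/-! Everything is done mode by mode. With `λ = |k|²`, `v = û(t,k)` and `φ` the coefficient of
`f(u)`, the equation reads `v' = -λ(νλ v + φ)`, and variation of constants gives `|û(t,k)| ≤ |û₀(k)|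
+ sup |φ| / (νλ)`: two derivatives are gained with a constant independent of time
(`norm_fourierHat_le_of_bound`). A bound of the energy bounds `∇f(u) = (3u² - 1)∇u` in `L¹`, hence
`|k| |φ|` (`normSq_mul_fourierHat_f_le`). So `|û| ≤ |û₀| + c|k|⁻³` off the zero mode, which is
summable over `ℤ²`. Weighted summable sequences are closed under convolution, so reinserting the
bound (`iterMaj`) yields majorants of `û`, uniform in time, that are as regular as the data. The
decay of the energy is itself justified with such majorants, first with constants that depend on the
time interval.

The scheme becomes `Ûⁿ⁺¹ = Ûⁿ - p (Ûⁿ + φⁿ/(νλ))` with `p = (1 - e^{-νλ²τ})/(1 + Sτλ²)`, where `φⁿ`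
is the coefficient of `f(Uⁿ)` (`fourierHat_step`). Since `p (S + ν) ≤ ν`, a step with increment `d`
dissipates at least `(S + ν)‖∇d‖²`. The rest of the energy balance consists of `∫ a²d²` and `∫ d⁴`,
and the embedding of `H¹` into `L⁴` bounds these by `S‖∇d‖²` once `S` exceeds an absolute multiple
of `Q = 1 + ν + ‖u₀‖²_{H²}` (`energy_step_le`). The iterates then have bounded energy, and since `0
≤ p ≤ 1` they inherit a summable majorant (`IsScheme.norm_fourierHat_le`), hence a uniform pointwise
bound.

In the error recursion the nonlinear difference carries the weight `pκ`, `κ = 1/(νλ)`. Convexity of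
the square and `p κ² ≤ τ/ν` absorb the two derivatives, so that only the Lipschitz bound of `f` in
`L²` on bounded sets is needed (`norm_error_sq_le`). The local error is of order `τ²`, from freezing
`f(u)` and from the stabilisation `Sτλ² · τ|∂ₜû|`; the modes outside the truncation contribute
`N^{-s}`. A discrete Gronwall inequality finishes the proof (`integral_error_sq_le`). -/

/-! ### Completeness of the characters and Parseval's identity. -/

abbrev Mode : Type := Fin 2 → ℤ

def charMap (k : Mode) : C(Torus, ℂ) where
  toFun := character k
  continuous_toFun := by unfold character; fun_prop

@[fun_prop]
lemma continuous_character (k : Mode) : Continuous (character k) := (charMap k).continuous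

lemma character_neg (k : Mode) (x : Torus) : character (-k) x = conj (character k x) := by
  simp only [character, Pi.neg_apply, fourier_neg, map_prod]

lemma character_add (k l : Mode) (x : Torus) :
    character (k + l) x = character k x * character l x := by
  simp only [character, Pi.add_apply, fourier_add, ← Finset.prod_mul_distrib]

@[simp] lemma character_zero (x : Torus) : character 0 x = 1 := by
  simp [character]

@[simp] lemma norm_character (k : Mode) (x : Torus) : ‖character k x‖ = 1 := by
  simp only [character, fourier_apply, norm_prod, Circle.norm_coe, Finset.prod_const_one]

lemma character_single (z : Torus) (i : Fin 2) :
    character (Pi.single i 1) z = fourier 1 (z i) := by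
  fin_cases i <;> simp [character, Fin.prod_univ_two]

lemma integral_fourier (n : ℤ) :
    ∫ x : AddCircle (2 * Real.pi), fourier n x = if n = 0 then ((2 * Real.pi : ℝ) : ℂ) else 0 := by
  have h0 : (0 : ℝ) < 2 * Real.pi := Real.two_pi_pos
  rw [AddCircle.volume_eq_smul_haarAddCircle, integral_smul_measure, ENNReal.toReal_ofReal h0.le]
  have h := (orthonormal_iff_ite.mp (orthonormal_fourier (T := 2 * Real.pi))) 0 n
  simp only [ContinuousMap.inner_toLp, ← fourier_neg, ← fourier_add] at h
  simp only [neg_zero] at h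
  have h' : ∫ x : AddCircle (2 * Real.pi), fourier n x ∂AddCircle.haarAddCircle
      = if n = 0 then 1 else 0 := by
    simpa [eq_comm] using h
  rw [h']
  split_ifs <;> simp

lemma integral_character (k : Mode) :
    ∫ x : Torus, character k x = if k = 0 then (((2 * Real.pi) ^ 2 : ℝ) : ℂ) else 0 := by
  unfold character
  rw [MeasureTheory.integral_fintype_prod_volume_eq_prod]
  simp only [integral_fourier, Fin.prod_univ_two, funext_iff, Fin.forall_fin_two, Pi.zero_apply]
  by_cases h0 : k 0 = 0 <;> by_cases h1 : k 1 = 0 <;> simp [h0, h1]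
  ring

def charSubalgebra : StarSubalgebra ℂ C(Torus, ℂ) where
  toSubalgebra := Algebra.adjoin ℂ (range charMap)
  star_mem' := by
    change Algebra.adjoin ℂ (range charMap) ≤ star (Algebra.adjoin ℂ (range charMap))
    refine Algebra.adjoin_le ?_
    rintro _ ⟨n, rfl⟩
    refine Algebra.subset_adjoin ⟨-n, ?_⟩
    ext1 x
    exact character_neg n x

lemma charSubalgebra_coe :
    charSubalgebra.toSubalgebra.toSubmodule = Submodule.span ℂ (range charMap) := by
  apply Algebra.adjoin_eq_span_of_subset
  refine .trans (fun x ↦ Submonoid.closure_induction (fun _ ↦ id) ⟨0, ?_⟩ ?_)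
    Submodule.subset_span
  · ext z
    exact character_zero z
  · rintro _ _ _ _ ⟨m, rfl⟩ ⟨n, rfl⟩
    refine ⟨m + n, ?_⟩
    ext z
    exact character_add m n z

lemma charSubalgebra_separatesPoints : charSubalgebra.SeparatesPoints := by
  intro x y hxy
  rw [Ne, funext_iff, not_forall] at hxy
  obtain ⟨i, hi⟩ := hxy
  refine ⟨_, ⟨charMap (Pi.single i 1), Algebra.subset_adjoin ⟨Pi.single i 1, rfl⟩, rfl⟩, ?_⟩
  change character _ x ≠ character _ y
  rw [character_single, character_single, fourier_one, fourier_one]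
  contrapose hi
  replace hi := Circle.coe_injective hi
  exact AddCircle.injective_toCircle Real.two_pi_pos.ne' hi

/-- Stone–Weierstrass: the span of the characters is a star subalgebra that separates points. With
the density of continuous functions in `L²` this makes the normalised characters a Hilbert basis. -/
lemma span_charMap_closure :
    (Submodule.span ℂ (range charMap)).topologicalClosure = ⊤ := by
  rw [← charSubalgebra_coe]
  exact congr_arg (Subalgebra.toSubmodule <| StarSubalgebra.toSubalgebra ·)
    (ContinuousMap.starSubalgebra_topologicalClosure_eq_top_of_separatesPoints _
      charSubalgebra_separatesPoints)

/-- The normalised characters in `L²`. -/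
def charLp (k : Mode) : Lp ℂ 2 (volume : Measure Torus) :=
  ContinuousMap.toLp (E := ℂ) 2 volume ℂ ((((2 * Real.pi)⁻¹ : ℝ) : ℂ) • charMap k)

lemma two_pi_ne : ((2 * Real.pi : ℝ) : ℂ) ≠ 0 := by
  exact_mod_cast Real.two_pi_pos.ne'

lemma orthonormal_charLp : Orthonormal ℂ charLp := by
  rw [orthonormal_iff_ite]
  intro m n
  unfold charLp
  rw [ContinuousMap.inner_toLp]
  have : ∀ x : Torus, ((((2 * Real.pi)⁻¹ : ℝ) : ℂ) • charMap n) x *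
      conj (((((2 * Real.pi)⁻¹ : ℝ) : ℂ) • charMap m) x)
      = (((2 * Real.pi) ^ 2 : ℝ) : ℂ)⁻¹ * character (n + -m) x := by
    intro x
    have h1 : ∀ k, charMap k x = character k x := fun k => rfl
    simp only [ContinuousMap.smul_apply, smul_eq_mul, map_mul, Complex.conj_ofReal, h1,
      character_add, character_neg]
    push_cast
    field_simp
  simp only [this]
  rw [integral_const_mul, integral_character]
  have h2 : (((2 * Real.pi) ^ 2 : ℝ) : ℂ) ≠ 0 := by
    push_cast
    exact pow_ne_zero 2 (by simp)
  by_cases h : m = n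
  · simp only [h, add_neg_cancel, if_true]
    exact inv_mul_cancel₀ h2
  · have : n + -m ≠ 0 := by
      intro h'; apply h; rw [← sub_eq_add_neg, sub_eq_zero] at h'; exact h'.symm
    simp [h, this]

lemma span_charLp_closure : ⊤ ≤ (Submodule.span ℂ (range charLp)).topologicalClosure := by
  have h1 := (ContinuousMap.toLp_denseRange ℂ (volume : Measure Torus) ℂ
    (p := 2) (by norm_num)).topologicalClosure_map_submodule span_charMap_closure
  rw [← h1]
  refine Submodule.topologicalClosure_mono ?_
  rw [Submodule.map_span, Submodule.span_le]
  rintro _ ⟨_, ⟨k, rfl⟩, rfl⟩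
  have : (ContinuousMap.toLp (E := ℂ) 2 (volume : Measure Torus) ℂ) (charMap k)
      = ((2 * Real.pi : ℝ) : ℂ) • charLp k := by
    unfold charLp
    rw [map_smul, smul_smul]
    have : ((2 * Real.pi : ℝ) : ℂ) * (((2 * Real.pi)⁻¹ : ℝ) : ℂ) = 1 := by
      rw [← Complex.ofReal_mul, mul_inv_cancel₀ Real.two_pi_pos.ne']; simp
    rw [this, one_smul]
  change (ContinuousMap.toLp (E := ℂ) 2 (volume : Measure Torus) ℂ) (charMap k) ∈ _
  rw [this]
  exact Submodule.smul_mem _ _ (Submodule.subset_span ⟨k, rfl⟩)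

def charBasis : HilbertBasis Mode ℂ (Lp ℂ 2 (volume : Measure Torus)) :=
  HilbertBasis.mk orthonormal_charLp span_charLp_closure

lemma inner_charLp (g : Torus → ℝ) (hg : MemLp (fun x => (g x : ℂ)) 2 volume) (k : Mode) :
    inner ℂ (charLp k) (hg.toLp) = ((2 * Real.pi : ℝ) : ℂ)⁻¹ * fourierHat g k := by
  rw [MeasureTheory.L2.inner_def, fourierHat, ← integral_const_mul]
  refine integral_congr_ae ?_
  filter_upwards [hg.coeFn_toLp, ContinuousMap.coeFn_toLp (p := 2) (𝕜 := ℂ) (volume : Measure Torus)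
    ((((2 * Real.pi)⁻¹ : ℝ) : ℂ) • charMap k)] with x h1 h2
  rw [h1]
  unfold charLp
  rw [h2]
  have h1 : charMap k x = character k x := rfl
  simp only [RCLike.inner_apply, ContinuousMap.smul_apply, smul_eq_mul, map_mul,
    Complex.conj_ofReal, h1, character_neg]
  push_cast
  ring

theorem parseval_inner {g h : Torus → ℝ} (hg : MemLp g 2 volume) (hh : MemLp h 2 volume) :
    HasSum (fun k => conj (fourierHat g k) * fourierHat h k)
      (((2 * Real.pi) ^ 2 * ∫ x, g x * h x : ℝ) : ℂ) := by
  have hg' : MemLp (fun x => (g x : ℂ)) 2 volume := hg.ofReal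
  have hh' : MemLp (fun x => (h x : ℂ)) 2 volume := hh.ofReal
  have key := charBasis.hasSum_inner_mul_inner hg'.toLp hh'.toLp
  have hb : ∀ k, charBasis k = charLp k := fun k => by simp [charBasis]
  simp only [hb, inner_charLp h hh'] at key
  have h3 : ∀ k, inner ℂ hg'.toLp (charLp k) = ((2 * Real.pi : ℝ) : ℂ)⁻¹ * conj (fourierHat g k) := by
    intro k
    rw [← inner_conj_symm, inner_charLp g hg', map_mul, map_inv₀, Complex.conj_ofReal]
  simp only [h3] at key
  have key2 := key.mul_left (((2 * Real.pi : ℝ) : ℂ) ^ 2)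
  convert! key2 using 1
  · ext k
    have := two_pi_ne
    field_simp
  · rw [MeasureTheory.L2.inner_def]
    have : ∫ x, inner ℂ ((hg'.toLp : Lp ℂ 2 (volume : Measure Torus)) x)
        ((hh'.toLp : Lp ℂ 2 (volume : Measure Torus)) x) = ∫ x, ((g x * h x : ℝ) : ℂ) := by
      refine integral_congr_ae ?_
      filter_upwards [hg'.coeFn_toLp, hh'.coeFn_toLp] with x h1 h2
      rw [h1, h2]
      simp [mul_comm]
    rw [this, integral_complex_ofReal]
    push_cast
    ring

theorem parseval {g : Torus → ℝ} (hg : MemLp g 2 volume) :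
    HasSum (fun k => ‖fourierHat g k‖ ^ 2) ((2 * Real.pi) ^ 2 * ∫ x, g x ^ 2) := by
  have h := parseval_inner hg hg
  have h2 := Complex.hasSum_re h
  convert h2 using 1
  · ext k
    rw [← Complex.normSq_eq_conj_mul_self, Complex.ofReal_re, Complex.normSq_eq_norm_sq]
  · simp [sq]

/-! ### Weighted summable sequences on the lattice and their convolution. -/

/-- `1 + |k|²` -/
def jap (k : Mode) : ℝ := 1 + normSq k

lemma normSq_nonneg (k : Mode) : 0 ≤ normSq k := Finset.sum_nonneg fun _ _ => sq_nonneg _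

lemma one_le_jap (k : Mode) : 1 ≤ jap k := by have := normSq_nonneg k; unfold jap; linarith

lemma jap_pos (k : Mode) : 0 < jap k := lt_of_lt_of_le one_pos (one_le_jap k)

@[simp] lemma normSq_zero : normSq 0 = 0 := by simp [normSq]

lemma normSq_neg (k : Mode) : normSq (-k) = normSq k := by simp [normSq]

lemma one_le_normSq {k : Mode} (hk : k ≠ 0) : 1 ≤ normSq k := by
  obtain ⟨i, hi⟩ := Function.ne_iff.mp hk
  have h1 : (1 : ℝ) ≤ (k i : ℝ) ^ 2 := by
    have : (1 : ℤ) ≤ k i ^ 2 := by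
      have : 0 < k i ^ 2 := by rw [Pi.zero_apply] at hi; positivity
      omega
    exact_mod_cast this
  exact h1.trans (Finset.single_le_sum (f := fun i => (k i : ℝ) ^ 2)
    (fun _ _ => sq_nonneg _) (Finset.mem_univ i))

lemma normSq_pos {k : Mode} (hk : k ≠ 0) : 0 < normSq k := one_pos.trans_le (one_le_normSq hk)

lemma normSq_add_le (k l : Mode) : normSq (k + l) ≤ 2 * normSq k + 2 * normSq l := by
  simp only [normSq, Fin.sum_univ_two, Pi.add_apply, Int.cast_add]
  nlinarith [sq_nonneg ((k 0 : ℝ) - l 0), sq_nonneg ((k 1 : ℝ) - l 1)]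

lemma norm_sq_le_normSq (k : Mode) : ‖k‖ ^ 2 ≤ normSq k := by
  have h : ‖k‖ ≤ Real.sqrt (normSq k) := by
    rw [pi_norm_le_iff_of_nonneg (Real.sqrt_nonneg _)]
    intro i
    refine Real.le_sqrt_of_sq_le ?_
    rw [Int.norm_eq_abs, sq_abs]
    exact Finset.single_le_sum (f := fun i => (k i : ℝ) ^ 2)
      (fun _ _ => sq_nonneg _) (Finset.mem_univ i)
  calc ‖k‖ ^ 2 ≤ Real.sqrt (normSq k) ^ 2 := by gcongr
    _ = normSq k := Real.sq_sqrt (normSq_nonneg k)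

/-- Comparison with the lattice sum of `‖k‖^(-2σ)`. The weight is quadratic in `k`, so the condition
`σ > 1` is decay of order greater than the dimension two. -/
lemma summable_jap_rpow {σ : ℝ} (hσ : 1 < σ) : Summable fun k : Mode => jap k ^ (-σ) := by
  have h := EisensteinSeries.summable_one_div_norm_rpow (k := 2 * σ) (by linarith)
  have h2 : Summable fun k : Mode => if k = 0 then (1 : ℝ) else 0 :=
    summable_of_hasFiniteSupport ((Set.finite_singleton (0 : Mode)).subset fun k hk => by
      by_contra h; exact hk (by simp_all))
  refine Summable.of_nonneg_of_le (fun k => Real.rpow_nonneg (jap_pos k).le _) (fun k => ?_)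
    (h2.add h)
  by_cases hk : k = 0
  · subst hk
    simp only [jap, normSq_zero, add_zero, Real.one_rpow, if_true]
    have : 0 ≤ ‖(0 : Mode)‖ ^ (-(2 * σ)) := Real.rpow_nonneg (norm_nonneg _) _
    linarith
  · simp only [hk, if_false, zero_add]
    have hpos : 0 < ‖k‖ := norm_pos_iff.mpr hk
    have : ‖k‖ ^ (-(2 * σ)) = (‖k‖ ^ 2) ^ (-σ) := by
      rw [← Real.rpow_natCast, ← Real.rpow_mul hpos.le]; congr 1; push_cast; ring
    rw [this]
    refine Real.rpow_le_rpow_of_nonpos (by positivity) ?_ (by linarith)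
    have := norm_sq_le_normSq k
    unfold jap; linarith

/-- Convolution of sequences on the lattice. -/
def conv (A B : Mode → ℝ) (k : Mode) : ℝ := ∑' l, A l * B (k - l)

/-- The change of variables `(k, l) ↦ (l, k - l)`, which turns the double sum of a convolution into
a product of two sums. -/
def pairEquiv : Mode × Mode ≃ Mode × Mode where
  toFun p := (p.2, p.1 - p.2)
  invFun p := (p.1 + p.2, p.1)
  left_inv p := by simp
  right_inv p := by simp

section Conv
variable {A B : Mode → ℝ}

lemma summable_conv_pairs (hA0 : ∀ k, 0 ≤ A k) (hB0 : ∀ k, 0 ≤ B k) (hA : Summable A)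
    (hB : Summable B) : Summable fun p : Mode × Mode => A p.2 * B (p.1 - p.2) := by
  have h := hA.mul_of_nonneg hB hA0 hB0
  exact (pairEquiv.summable_iff (f := fun x : Mode × Mode => A x.1 * B x.2)).mpr h

lemma summable_conv_term (hA0 : ∀ k, 0 ≤ A k) (hB0 : ∀ k, 0 ≤ B k) (hA : Summable A)
    (hB : Summable B) (k : Mode) : Summable fun l => A l * B (k - l) :=
  (summable_conv_pairs hA0 hB0 hA hB).prod_factor k

lemma summable_conv (hA0 : ∀ k, 0 ≤ A k) (hB0 : ∀ k, 0 ≤ B k) (hA : Summable A)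
    (hB : Summable B) : Summable (conv A B) :=
  (summable_conv_pairs hA0 hB0 hA hB).prod

lemma conv_nonneg (hA0 : ∀ k, 0 ≤ A k) (hB0 : ∀ k, 0 ≤ B k) (k : Mode) : 0 ≤ conv A B k :=
  tsum_nonneg fun l => mul_nonneg (hA0 l) (hB0 _)

end Conv

/-- Summability with the weight `(1 + |k|²)^σ`. -/
def WSum (σ : ℝ) (A : Mode → ℝ) : Prop := Summable fun k => jap k ^ σ * A k

lemma jap_le (k l : Mode) : jap k ≤ 4 * max (jap l) (jap (k - l)) := by
  have h := normSq_add_le l (k - l)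
  rw [add_sub_cancel] at h
  have h1 := le_max_left (jap l) (jap (k - l))
  have h2 := le_max_right (jap l) (jap (k - l))
  unfold jap at *
  linarith

lemma jap_rpow_le {σ : ℝ} (hσ : 0 ≤ σ) (k l : Mode) :
    jap k ^ σ ≤ 4 ^ σ * (jap l ^ σ + jap (k - l) ^ σ) := by
  have h0 := Real.rpow_nonneg (jap_pos l).le σ
  have h1 := Real.rpow_nonneg (jap_pos (k - l)).le σ
  calc jap k ^ σ ≤ (4 * max (jap l) (jap (k - l))) ^ σ :=
        Real.rpow_le_rpow (jap_pos k).le (jap_le k l) hσ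
    _ = 4 ^ σ * (max (jap l) (jap (k - l))) ^ σ :=
        Real.mul_rpow (by norm_num) (le_max_of_le_left (jap_pos l).le)
    _ ≤ _ := by
        gcongr
        rcases max_choice (jap l) (jap (k - l)) with h | h <;> rw [h] <;> linarith

lemma jap_rpow_pos (σ : ℝ) (k : Mode) : 0 < jap k ^ σ := Real.rpow_pos_of_pos (jap_pos k) σ

namespace WSum
variable {A B : Mode → ℝ} {σ ρ : ℝ}

lemma mono (hA : WSum σ A) (hA0 : ∀ k, 0 ≤ A k) (h : ρ ≤ σ) : WSum ρ A :=
  Summable.of_nonneg_of_le (fun k => mul_nonneg (jap_rpow_pos ρ k).le (hA0 k))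
    (fun k => mul_le_mul_of_nonneg_right
      (Real.rpow_le_rpow_of_exponent_le (one_le_jap k) h) (hA0 k)) hA

lemma summable (hA : WSum σ A) (hA0 : ∀ k, 0 ≤ A k) (h : 0 ≤ σ) : Summable A := by
  simpa [WSum] using hA.mono hA0 h

lemma _root_.Summable.wsum (hA : Summable A) : WSum 0 A := by simpa [WSum] using hA

lemma add (hA : WSum σ A) (hB : WSum σ B) : WSum σ (fun k => A k + B k) := by
  unfold WSum at *
  simpa only [mul_add] using Summable.add hA hB

lemma const_mul (hA : WSum σ A) (c : ℝ) : WSum σ (fun k => c * A k) := by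
  unfold WSum at *
  refine (Summable.mul_left c hA).congr fun k => by ring

lemma jap_mul (hA : WSum (σ + ρ) A) : WSum σ (fun k => jap k ^ ρ * A k) := by
  unfold WSum at *
  refine hA.congr fun k => ?_
  rw [Real.rpow_add (jap_pos k)]; ring

/-- The weight at `k` is at most `4^σ` times the sum of the weights at `l` and at `k - l`, so it can
be moved onto one of the two factors, while the other is merely summable. This algebra property
makes the nonlinearity harmless for majorants. -/
lemma conv (hσ : 0 ≤ σ) (hA0 : ∀ k, 0 ≤ A k) (hB0 : ∀ k, 0 ≤ B k) (hA : WSum σ A)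
    (hB : WSum σ B) : WSum σ (conv A B) := by
  have hA1 := hA.summable hA0 hσ
  have hB1 := hB.summable hB0 hσ
  have hA0' : ∀ k, 0 ≤ jap k ^ σ * A k := fun k => mul_nonneg (jap_rpow_pos σ k).le (hA0 k)
  have hB0' : ∀ k, 0 ≤ jap k ^ σ * B k := fun k => mul_nonneg (jap_rpow_pos σ k).le (hB0 k)
  have h1 := summable_conv hA0' hB0 hA hB1
  have h2 := summable_conv hA0 hB0' hA1 hB
  refine Summable.of_nonneg_of_le
    (fun k => mul_nonneg (jap_rpow_pos σ k).le (conv_nonneg hA0 hB0 k)) (fun k => ?_)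
    ((h1.add h2).mul_left (4 ^ σ))
  have t0 := summable_conv_term hA0 hB0 hA1 hB1 k
  have t1 := summable_conv_term hA0' hB0 hA hB1 k
  have t2 := summable_conv_term hA0 hB0' hA1 hB k
  unfold CahnHilliard.conv
  rw [← tsum_mul_left, ← t1.tsum_add t2, ← tsum_mul_left]
  refine (t0.mul_left _).tsum_le_tsum (fun l => ?_) ((t1.add t2).mul_left _)
  have := mul_le_mul_of_nonneg_right (jap_rpow_le hσ k l) (mul_nonneg (hA0 l) (hB0 (k - l)))
  linarith

end WSum

lemma summable_sq_of_summable {A : Mode → ℝ} (hA0 : ∀ k, 0 ≤ A k) (hA : Summable A) :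
    Summable fun k => A k ^ 2 := by
  refine Summable.of_nonneg_of_le (fun k => sq_nonneg _) (fun k => ?_) (hA.mul_left (∑' k, A k))
  rw [sq]
  exact mul_le_mul_of_nonneg_right (hA.le_tsum k fun j _ => hA0 j) (hA0 k)

/-! ### Fourier synthesis, inversion, and the coefficients of products. -/

def cT : ℝ := ((2 * Real.pi) ^ 2)⁻¹

lemma cT_pos : 0 < cT := by unfold cT; positivity

lemma cT_mul : cT * (2 * Real.pi) ^ 2 = 1 := inv_mul_cancel₀ (by positivity)

section Continuous
variable {E : Type*} [NormedAddCommGroup E] {g h : Torus → E}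

lemma memLp_of_continuous (hg : Continuous g) (p : ℝ≥0∞) : MemLp g p volume :=
  hg.memLp_of_hasCompactSupport (HasCompactSupport.of_compactSpace g)

lemma integrable_of_continuous (hg : Continuous g) : Integrable g volume :=
  hg.integrable_of_hasCompactSupport (HasCompactSupport.of_compactSpace g)

end Continuous

section Basic
variable {g h : Torus → ℝ}

lemma integrable_character_mul (hg : Integrable g volume) (k : Mode) :
    Integrable (fun x => character k x * (g x : ℂ)) volume :=
  hg.ofReal.bdd_mul (c := 1) (continuous_character k).aestronglyMeasurable
    (Filter.Eventually.of_forall fun x => by simp)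

lemma norm_fourierHat_le (g : Torus → ℝ) (k : Mode) : ‖fourierHat g k‖ ≤ ∫ x, |g x| := by
  refine (norm_integral_le_integral_norm _).trans (le_of_eq ?_)
  simp

lemma fourierHat_neg (g : Torus → ℝ) (k : Mode) :
    fourierHat g (-k) = conj (fourierHat g k) := by
  unfold fourierHat
  rw [← integral_conj]
  simp [character_neg]

lemma fourierHat_sub (hg : Integrable g volume) (hh : Integrable h volume) (k : Mode) :
    fourierHat (fun x => g x - h x) k = fourierHat g k - fourierHat h k := by
  unfold fourierHat
  rw [← integral_sub (integrable_character_mul hg _) (integrable_character_mul hh _)]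
  simp [mul_sub]

lemma fourierHat_add (hg : Integrable g volume) (hh : Integrable h volume) (k : Mode) :
    fourierHat (fun x => g x + h x) k = fourierHat g k + fourierHat h k := by
  unfold fourierHat
  rw [← integral_add (integrable_character_mul hg _) (integrable_character_mul hh _)]
  simp [mul_add]

lemma fourierHat_const_mul (c : ℝ) (g : Torus → ℝ) (k : Mode) :
    fourierHat (fun x => c * g x) k = c * fourierHat g k := by
  unfold fourierHat
  rw [← integral_const_mul]
  congr 1; ext x; push_cast; ring

lemma fourierHat_congr_ae (hgh : g =ᵐ[volume] h) (k : Mode) :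
    fourierHat g k = fourierHat h k := by
  unfold fourierHat
  refine integral_congr_ae ?_
  filter_upwards [hgh] with x hx
  rw [hx]

end Basic

def synthC (w : Mode → ℂ) (x : Torus) : ℂ := (cT : ℂ) * ∑' k, w k * character k x

/-- The real function with the Fourier coefficients `w`. -/
def synth (w : Mode → ℂ) (x : Torus) : ℝ := (synthC w x).re

def Herm (w : Mode → ℂ) : Prop := ∀ k, w (-k) = conj (w k)

section Synth
variable {w : Mode → ℂ}

lemma herm_fourierHat (g : Torus → ℝ) : Herm (fourierHat g) := fourierHat_neg g

lemma ofReal_synth (hw : Herm w) (x : Torus) : ((synth w x : ℝ) : ℂ) = synthC w x := by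
  unfold synth
  rw [← Complex.conj_eq_iff_re, synthC, map_mul, Complex.conj_ofReal, Complex.conj_tsum]
  congr 1
  rw [← (Equiv.neg Mode).tsum_eq]
  refine tsum_congr fun k => ?_
  simp only [Equiv.neg_apply, map_mul, hw k, character_neg, Complex.conj_conj]

lemma continuous_synthC (hw : Summable fun k => ‖w k‖) : Continuous (synthC w) := by
  unfold synthC
  refine continuous_const.mul (continuous_tsum (fun k => by fun_prop) hw fun k x => ?_)
  simp

lemma continuous_synth (hw : Summable fun k => ‖w k‖) : Continuous (synth w) :=
  Complex.continuous_re.comp (continuous_synthC hw)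

lemma integral_character_mul_synthC {h : Torus → ℂ} (hh : Continuous h)
    (hw : Summable fun k => ‖w k‖) :
    ∫ x, synthC w x * h x = cT * ∑' k, w k * ∫ x, character k x * h x := by
  obtain ⟨M, hM⟩ := (isCompact_univ (X := Torus)).exists_bound_of_continuousOn hh.continuousOn
  have h1 : ∀ x, synthC w x * h x = (cT : ℂ) * ∑' k, w k * (character k x * h x) := by
    intro x
    unfold synthC
    rw [mul_assoc, ← tsum_mul_right]
    simp only [mul_assoc]
  simp only [h1]
  rw [integral_const_mul]
  congr 1
  have h2 : ∀ k, ∫ x, w k * (character k x * h x) = w k * ∫ x, character k x * h x :=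
    fun k => integral_const_mul _ _
  simp only [← h2]
  refine (integral_tsum_of_summable_integral_norm (fun k => ?_) ?_).symm
  · exact integrable_of_continuous (by fun_prop)
  · refine Summable.of_nonneg_of_le (fun k => integral_nonneg fun x => norm_nonneg _) (fun k => ?_)
      (hw.mul_right (M * (volume : Measure Torus).real univ))
    calc ∫ x, ‖w k * (character k x * h x)‖ ≤ ∫ x : Torus, ‖w k‖ * M := by
          refine integral_mono (integrable_of_continuous (by fun_prop)) (integrable_const _) ?_
          intro x
          simp only [norm_mul, norm_character, one_mul]
          exact mul_le_mul_of_nonneg_left (hM x (mem_univ x)) (norm_nonneg _)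
      _ = _ := by rw [integral_const, smul_eq_mul]; ring

lemma fourierHat_synth (hw : Herm w) (hs : Summable fun k => ‖w k‖) (k : Mode) :
    fourierHat (synth w) k = w k := by
  unfold fourierHat
  simp only [ofReal_synth hw, mul_comm (character (-k) _)]
  rw [integral_character_mul_synthC (continuous_character _) hs]
  simp only [← character_add, integral_character]
  rw [tsum_eq_single k]
  · simp only [add_neg_cancel, if_true]
    rw [mul_comm (w k), ← mul_assoc, ← Complex.ofReal_mul, cT_mul]; simp
  · intro l hl
    have : l + -k ≠ 0 := by rwa [← sub_eq_add_neg, sub_ne_zero]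
    simp [this]

end Synth

section Inversion
variable {g h : Torus → ℝ}

lemma integral_sq_eq (hg : Continuous g) :
    ∫ x, g x ^ 2 = cT * ∑' k, ‖fourierHat g k‖ ^ 2 := by
  rw [(parseval (memLp_of_continuous hg 2)).tsum_eq, ← mul_assoc, cT_mul, one_mul]

/-- The difference of both sides is continuous and has vanishing Fourier coefficients; by Parseval
its square integrates to zero, so it vanishes everywhere. -/
theorem eq_synth (hg : Continuous g) (hs : Summable fun k => ‖fourierHat g k‖) :
    g = synth (fourierHat g) := by
  have hc := continuous_synth hs
  have h0 : ∫ x, (g x - synth (fourierHat g) x) ^ 2 = 0 := by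
    rw [integral_sq_eq (g := fun x => g x - synth (fourierHat g) x) (hg.sub hc)]
    have : ∀ k, fourierHat (fun x => g x - synth (fourierHat g) x) k = 0 := fun k => by
      rw [fourierHat_sub (integrable_of_continuous hg) (integrable_of_continuous hc),
        fourierHat_synth (herm_fourierHat g) hs, sub_self]
    simp [this]
  have hcont : Continuous fun x => (g x - synth (fourierHat g) x) ^ 2 := (hg.sub hc).pow 2
  have h1 := (integral_eq_zero_iff_of_nonneg (μ := (volume : Measure Torus)) (fun x => sq_nonneg _)
    (integrable_of_continuous hcont)).mp h0
  have h2 := (hcont.ae_eq_iff_eq volume continuous_zero).mp h1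
  ext x
  have hx := congrFun h2 x
  simp only [Pi.zero_apply, ne_eq, OfNat.ofNat_ne_zero, not_false_eq_true, pow_eq_zero_iff] at hx
  linarith

lemma coe_eq_synthC (hg : Continuous g) (hs : Summable fun k => ‖fourierHat g k‖) (x : Torus) :
    (g x : ℂ) = synthC (fourierHat g) x := by
  rw [← ofReal_synth (herm_fourierHat g), ← eq_synth hg hs]

lemma abs_le_of_majorant (hg : Continuous g) {A : Mode → ℝ} (hA : Summable A)
    (hgA : ∀ k, ‖fourierHat g k‖ ≤ A k) (x : Torus) : |g x| ≤ cT * ∑' k, A k := by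
  have hs : Summable fun k => ‖fourierHat g k‖ :=
    hA.of_nonneg_of_le (fun k => norm_nonneg _) hgA
  rw [← Real.norm_eq_abs, ← Complex.norm_real, coe_eq_synthC hg hs, synthC, norm_mul,
    Complex.norm_real, Real.norm_of_nonneg cT_pos.le]
  refine mul_le_mul_of_nonneg_left ?_ cT_pos.le
  have h1 : ∀ k, ‖fourierHat g k * character k x‖ ≤ A k := fun k => by simpa using hgA k
  exact tsum_of_norm_bounded hA.hasSum h1

lemma fourierHat_mul (hg : Continuous g) (hh : Continuous h)
    (hs : Summable fun k => ‖fourierHat g k‖) (k : Mode) :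
    fourierHat (fun x => g x * h x) k = cT * ∑' l, fourierHat g l * fourierHat h (k - l) := by
  have : fourierHat (fun x => g x * h x) k
      = ∫ x, synthC (fourierHat g) x * (character (-k) x * (h x : ℂ)) := by
    unfold fourierHat
    congr 1; ext x
    rw [Complex.ofReal_mul, coe_eq_synthC hg hs]
    unfold fourierHat
    ring
  rw [this, integral_character_mul_synthC (by fun_prop) hs]
  congr 1
  refine tsum_congr fun l => ?_
  congr 1
  unfold fourierHat
  congr 1; ext x
  rw [neg_sub, sub_eq_add_neg, character_add]; ring

/-- Products are estimated through nonnegative majorants only: all later regularity statements are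
about sequences, not about Sobolev norms of functions. -/
lemma norm_fourierHat_mul_le (hg : Continuous g) (hh : Continuous h) {A B : Mode → ℝ}
    (hA : Summable A) (hB : Summable B) (hgA : ∀ k, ‖fourierHat g k‖ ≤ A k)
    (hhB : ∀ k, ‖fourierHat h k‖ ≤ B k) (k : Mode) :
    ‖fourierHat (fun x => g x * h x) k‖ ≤ cT * conv A B k := by
  have hA0 : ∀ k, 0 ≤ A k := fun k => (norm_nonneg _).trans (hgA k)
  have hB0 : ∀ k, 0 ≤ B k := fun k => (norm_nonneg _).trans (hhB k)
  have hs : Summable fun k => ‖fourierHat g k‖ :=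
    hA.of_nonneg_of_le (fun k => norm_nonneg _) hgA
  rw [fourierHat_mul hg hh hs, norm_mul, Complex.norm_real, Real.norm_of_nonneg cT_pos.le]
  refine mul_le_mul_of_nonneg_left ?_ cT_pos.le
  refine tsum_of_norm_bounded (summable_conv_term hA0 hB0 hA hB k).hasSum fun l => ?_
  rw [norm_mul]
  exact mul_le_mul (hgA l) (hhB _) (norm_nonneg _) (hA0 l)

end Inversion

/-! ### Truncated Fourier multipliers. -/

section Truncation
variable {N : ℕ} {σ : Mode → ℝ} {g : Torus → ℝ}

lemma neg_mem_modes {k : Mode} : -k ∈ modes N ↔ k ∈ modes N := by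
  simp only [modes, Fintype.mem_piFinset, Finset.mem_Icc, Pi.neg_apply]
  refine forall_congr' fun i => ?_
  constructor <;> intro h <;> constructor <;> linarith [h.1, h.2]

def truncCoef (N : ℕ) (σ : Mode → ℝ) (g : Torus → ℝ) (k : Mode) : ℂ :=
  if k ∈ modes N then (σ k : ℂ) * fourierHat g k else 0

lemma herm_truncCoef (hσ : ∀ k, σ (-k) = σ k) : Herm (truncCoef N σ g) := fun k => by
  unfold truncCoef
  simp only [neg_mem_modes, hσ, fourierHat_neg]
  split_ifs <;> simp

lemma summable_truncCoef : Summable fun k => ‖truncCoef N σ g k‖ :=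
  summable_of_ne_finset_zero (s := modes N) fun k hk => by simp [truncCoef, hk]

lemma truncMultiplier_eq_synth : truncMultiplier N σ g = synth (truncCoef N σ g) := by
  ext x
  unfold truncMultiplier synth synthC cT
  congr 2
  rw [tsum_eq_sum (s := modes N) fun k hk => by simp [truncCoef, hk]]
  refine Finset.sum_congr rfl fun k hk => ?_
  simp [truncCoef, hk]

lemma continuous_truncMultiplier : Continuous (truncMultiplier N σ g) := by
  rw [truncMultiplier_eq_synth]; exact continuous_synth summable_truncCoef

lemma fourierHat_truncMultiplier (hσ : ∀ k, σ (-k) = σ k) (k : Mode) :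
    fourierHat (truncMultiplier N σ g) k = if k ∈ modes N then (σ k : ℂ) * fourierHat g k else 0 := by
  rw [truncMultiplier_eq_synth, fourierHat_synth (herm_truncCoef hσ) summable_truncCoef]; rfl

end Truncation

/-! ### Partial derivatives on the torus through the periodic lift. -/

/-- The covering map of the torus by the plane. -/
def cover (y : Plane) : Torus := fun i => (y i : AddCircle (2 * Real.pi))

/-- The representative of a point of the torus in the fundamental square. -/
def rep (x : Torus) : Plane :=
  WithLp.toLp 2 fun i => ((AddCircle.equivIco (2 * Real.pi) 0 (x i)).1 : ℝ)

def unitVec (j : Fin 2) : Plane := EuclideanSpace.single j 1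

@[simp] lemma cover_rep (x : Torus) : cover (rep x) = x := by
  ext i
  exact AddCircle.coe_equivIco

lemma cover_add (y z : Plane) : cover (y + z) = cover y + cover z := by
  ext i; simp [cover]

lemma cover_sub (y z : Plane) : cover (y - z) = cover y - cover z := by
  ext i; simp [cover]

lemma norm_rep_le (x : Torus) : ‖rep x‖ ≤ 4 * Real.pi := by
  have h : ∀ i, ‖rep x i‖ ^ 2 ≤ (2 * Real.pi) ^ 2 := fun i => by
    have := (AddCircle.equivIco (2 * Real.pi) 0 (x i)).2
    rw [Real.norm_eq_abs, sq_abs]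
    simp only [rep]
    nlinarith [this.1, this.2]
  rw [EuclideanSpace.norm_eq]
  refine Real.sqrt_le_iff.mpr ⟨by positivity, ?_⟩
  rw [Fin.sum_univ_two]
  have := Real.pi_pos
  nlinarith [h 0, h 1]

lemma isOpenQuotientMap_cover : IsOpenQuotientMap cover := by
  have h1 : IsOpenQuotientMap (Pi.map fun (_ : Fin 2) (y : ℝ) => (y : AddCircle (2 * Real.pi))) :=
    IsOpenQuotientMap.piMap fun _ => QuotientAddGroup.isOpenQuotientMap_mk
  have h2 := (EuclideanSpace.equiv (Fin 2) ℝ).toHomeomorph.isOpenQuotientMap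
  exact h1.comp h2

section Derivative
variable {g h : Torus → ℝ}

lemma lift_eq (g : Torus → ℝ) : lift g = g ∘ cover := rfl

lemma lift_rep (g : Torus → ℝ) (x : Torus) : lift g (rep x) = g x := by
  rw [lift_eq, Function.comp_apply, cover_rep]

lemma continuous_of_lift (hg : Continuous (lift g)) : Continuous g :=
  isOpenQuotientMap_cover.isQuotientMap.continuous_iff.mpr hg

/-- The partial derivative of a function on the torus. -/
def pd (j : Fin 2) (g : Torus → ℝ) (x : Torus) : ℝ := fderiv ℝ (lift g) (rep x) (unitVec j)

/-- Periodicity of the lift: this makes `pd` independent of the representative `rep` chosen in its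
definition. -/
lemma fderiv_lift_congr (g : Torus → ℝ) {y z : Plane} (h : cover y = cover z) :
    fderiv ℝ (lift g) y = fderiv ℝ (lift g) z := by
  have h1 : (fun w => lift g (w + (y - z))) = lift g := by
    ext w
    simp only [lift_eq, Function.comp_apply, cover_add, cover_sub, h, sub_self, add_zero]
  have h2 := fderiv_comp_add_right (𝕜 := ℝ) (f := lift g) (x := z) (y - z)
  rw [h1] at h2
  rw [h2]; congr 1; abel

lemma lift_pd (j : Fin 2) (g : Torus → ℝ) :
    lift (pd j g) = fun y => fderiv ℝ (lift g) y (unitVec j) := by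
  ext y
  simp only [lift_eq, Function.comp_apply, pd]
  rw [← lift_eq, fderiv_lift_congr g (cover_rep (cover y))]

lemma contDiff_lift_pd {n : ℕ} (j : Fin 2) (hg : ContDiff ℝ (n + 1 : ℕ) (lift g)) :
    ContDiff ℝ n (lift (pd j g)) := by
  rw [lift_pd]
  exact (hg.fderiv_right (m := n) (by norm_cast)).clm_apply contDiff_const

lemma continuous_pd (j : Fin 2) (hg : ContDiff ℝ 1 (lift g)) : Continuous (pd j g) :=
  continuous_of_lift (contDiff_lift_pd (n := 0) j (by simpa using hg)).continuous

lemma hasDerivAt_translate (j : Fin 2) (hg : ContDiff ℝ 1 (lift g)) (x : Torus) (t : ℝ) :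
    HasDerivAt (fun r : ℝ => g (x + cover (r • unitVec j))) (pd j g (x + cover (t • unitVec j))) t := by
  have h1 : HasDerivAt (fun r : ℝ => rep x + r • unitVec j) (unitVec j) t := by
    simpa using ((hasDerivAt_id t).smul_const (unitVec j)).const_add (rep x)
  have h2 := ((hg.differentiable (by norm_num)) (rep x + t • unitVec j)).hasFDerivAt
  have h3 := h2.comp_hasDerivAt t h1
  have e1 : ∀ r : ℝ, cover (rep x + r • unitVec j) = x + cover (r • unitVec j) := fun r => by
    rw [cover_add, cover_rep]
  have e2 := congrFun (lift_pd j g) (rep x + t • unitVec j)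
  rw [lift_eq, Function.comp_apply, e1] at e2
  rw [e2]
  refine h3.congr_of_eventuallyEq (Filter.Eventually.of_forall fun r => ?_)
  simp only [lift_eq, Function.comp_apply, e1]

lemma character_add_right (k : Mode) (x y : Torus) :
    character k (x + y) = character k x * character k y := by
  simp only [character, ← Finset.prod_mul_distrib, Pi.add_apply]
  refine Finset.prod_congr rfl fun i _ => ?_
  simp [fourier_apply, AddCircle.toCircle_add]

lemma character_cover_smul (k : Mode) (j : Fin 2) (t : ℝ) :
    character k (cover (t • unitVec j)) = Complex.exp (Complex.I * k j * t) := by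
  have h := Real.two_pi_pos.ne'
  have hpi : (Real.pi : ℂ) ≠ 0 := by exact_mod_cast Real.pi_ne_zero
  unfold character cover unitVec
  fin_cases j <;> simp [Fin.prod_univ_two] <;> congr 1 <;> field_simp

lemma fourierHat_translate (g : Torus → ℝ) (k : Mode) (z : Torus) :
    fourierHat (fun x => g (x + z)) k = character k z * fourierHat g k := by
  unfold fourierHat
  rw [← integral_const_mul, ← integral_add_right_eq_self (μ := (volume : Measure Torus))
    (fun x => character k z * (character (-k) x * (g x : ℂ))) z]
  congr 1; ext x
  have h : character k z * character (-k) z = 1 := by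
    rw [← character_add, add_neg_cancel, character_zero]
  rw [character_add_right]
  linear_combination (-(character (-k) x * (g (x + z) : ℂ))) * h

/-- Translation by `z` multiplies the coefficient by `character k z`. Differentiating along a
coordinate direction at zero, once under the integral and once in the exponential, gives both sides.
-/
theorem fourierHat_pd (j : Fin 2) (hg : ContDiff ℝ 1 (lift g)) (k : Mode) :
    fourierHat (pd j g) k = Complex.I * k j * fourierHat g k := by
  have hgc := continuous_of_lift hg.continuous
  have hpc := continuous_pd j hg
  obtain ⟨C, hC⟩ := (isCompact_univ (X := Torus)).exists_bound_of_continuousOn hpc.continuousOn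
  have h1 : HasDerivAt (fun t : ℝ => fourierHat (fun x => g (x + cover (t • unitVec j))) k)
      (fourierHat (fun x => pd j g (x + cover ((0 : ℝ) • unitVec j))) k) 0 := by
    unfold fourierHat
    refine (hasDerivAt_integral_of_dominated_loc_of_deriv_le (bound := fun _ => C)
      (F' := fun t x => character (-k) x * (pd j g (x + cover (t • unitVec j)) : ℂ))
      Filter.univ_mem ?_ ?_ ?_ ?_ ?_ ?_).2
    · exact Filter.Eventually.of_forall fun t =>
        (show Continuous _ by fun_prop).aestronglyMeasurable
    · exact integrable_of_continuous (by fun_prop)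
    · exact (show Continuous _ by fun_prop).aestronglyMeasurable
    · refine Filter.Eventually.of_forall fun x t _ => ?_
      simpa using hC _ (mem_univ _)
    · exact integrable_const _
    · refine Filter.Eventually.of_forall fun x t _ => ?_
      exact (hasDerivAt_translate j hg x t).ofReal_comp.const_mul _
  have e0 : cover ((0 : ℝ) • unitVec j) = 0 := by ext i; simp [cover]
  simp only [e0, add_zero, fourierHat_translate, character_cover_smul] at h1
  have h2 : HasDerivAt (fun t : ℝ => Complex.exp (Complex.I * k j * t) * fourierHat g k)
      (Complex.I * k j * fourierHat g k) 0 := by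
    have h3 : HasDerivAt (fun t : ℝ => Complex.I * k j * (t : ℂ)) (Complex.I * k j) 0 := by
      simpa using (Complex.ofRealCLM.hasDerivAt (x := 0)).const_mul (Complex.I * k j)
    simpa using h3.cexp.mul_const (fourierHat g k)
  exact h1.unique h2

lemma gradNormSq_eq (g : Torus → ℝ) :
    gradNormSq g = cT * ∑' k, normSq k * ‖fourierHat g k‖ ^ 2 := rfl

lemma hasSum_pd_sq (j : Fin 2) (hg : ContDiff ℝ 1 (lift g)) :
    HasSum (fun k : Mode => (k j : ℝ) ^ 2 * ‖fourierHat g k‖ ^ 2)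
      ((2 * Real.pi) ^ 2 * ∫ x, pd j g x ^ 2) := by
  refine (parseval (memLp_of_continuous (continuous_pd j hg) 2)).congr_fun ?_
  intro k
  simp [fourierHat_pd j hg, mul_pow]

lemma hasSum_grad (hg : ContDiff ℝ 1 (lift g)) :
    HasSum (fun k : Mode => normSq k * ‖fourierHat g k‖ ^ 2)
      ((2 * Real.pi) ^ 2 * ∑ j, ∫ x, pd j g x ^ 2) := by
  rw [Finset.mul_sum]
  refine (hasSum_sum fun j _ => hasSum_pd_sq j hg).congr_fun fun k => ?_
  simp only [normSq, Finset.sum_mul]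

lemma gradNormSq_eq_integral (hg : ContDiff ℝ 1 (lift g)) :
    gradNormSq g = ∑ j, ∫ x, pd j g x ^ 2 := by
  rw [gradNormSq_eq, (hasSum_grad hg).tsum_eq, ← mul_assoc, cT_mul, one_mul]

lemma gradNormSq_nonneg (g : Torus → ℝ) : 0 ≤ gradNormSq g :=
  mul_nonneg cT_pos.le (tsum_nonneg fun k => mul_nonneg (normSq_nonneg k) (sq_nonneg _))

lemma pd_comp {G G' : ℝ → ℝ} (hG : ∀ r, HasDerivAt G (G' r) r) (j : Fin 2)
    (hg : ContDiff ℝ 1 (lift g)) (x : Torus) :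
    pd j (fun z => G (g z)) x = G' (g x) * pd j g x := by
  unfold pd
  have h1 := ((hg.differentiable (by norm_num)) (rep x)).hasFDerivAt
  have h2 := (hG (lift g (rep x))).comp_hasFDerivAt (rep x) h1
  have h3 : lift (fun z => G (g z)) = G ∘ lift g := rfl
  rw [h3, h2.fderiv, lift_rep]
  simp

lemma hasDerivAt_f (r : ℝ) : HasDerivAt f (3 * r ^ 2 - 1) r := by
  unfold f
  have := (hasDerivAt_pow 3 r).sub (hasDerivAt_id r)
  convert! this using 1

lemma hasDerivAt_F (r : ℝ) : HasDerivAt F (f r) r := by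
  unfold F f
  have := ((((hasDerivAt_pow 2 r).sub_const 1).pow 2).div_const 4)
  convert! this using 1
  simp; ring

@[fun_prop] lemma contDiff_f {n : ℕ∞} : ContDiff ℝ n f := by unfold f; fun_prop

@[fun_prop] lemma continuous_f : Continuous f := by unfold f; fun_prop

@[fun_prop] lemma continuous_F : Continuous F := by unfold F; fun_prop

lemma F_nonneg (r : ℝ) : 0 ≤ F r := by unfold F; positivity

lemma volume_torus : (volume : Measure Torus).real univ = (2 * Real.pi) ^ 2 := by
  simp only [Measure.real, volume_pi, Measure.pi_univ, AddCircle.measure_univ, Fin.prod_univ_two]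
  rw [ENNReal.toReal_mul, ENNReal.toReal_ofReal Real.two_pi_pos.le]; ring

lemma integral_cauchy_schwarz {a b : Torus → ℝ} (ha : Continuous a) (hb : Continuous b) :
    (∫ x, a x * b x) ^ 2 ≤ (∫ x, a x ^ 2) * ∫ x, b x ^ 2 := by
  have h : ∀ t : ℝ, 0 ≤ (∫ x, a x ^ 2) * (t * t) + (2 * ∫ x, a x * b x) * t + ∫ x, b x ^ 2 := by
    intro t
    have h1 : 0 ≤ ∫ x, (a x * t + b x) ^ 2 := integral_nonneg fun x => sq_nonneg _
    have h2 : ∫ x, (a x * t + b x) ^ 2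
        = ∫ x, (a x ^ 2 * (t * t) + (a x * b x) * (2 * t) + b x ^ 2) := by
      congr 1; ext x; ring
    rw [h2, integral_add (integrable_of_continuous (by fun_prop))
      (integrable_of_continuous (by fun_prop)), integral_add (integrable_of_continuous (by fun_prop))
      (integrable_of_continuous (by fun_prop)), integral_mul_const, integral_mul_const] at h1
    linarith
  have := discrim_le_zero h
  unfold discrim at this
  linarith

/-- A Fourier coefficient of `∂ⱼ f(g) = (3g² - 1)∂ⱼg` is at most its `L¹` norm, and Cauchy–Schwarz
splits this into quantities that the energy controls. The resulting decay `1/|k|` of the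
coefficients of `f(g)` starts the bootstrap. -/
theorem normSq_mul_fourierHat_f_le (hg : ContDiff ℝ 1 (lift g)) (k : Mode) :
    normSq k * ‖fourierHat (fun x => f (g x)) k‖ ^ 2
      ≤ (72 * (∫ x, F (g x)) + 8 * (2 * Real.pi) ^ 2) * gradNormSq g := by
  have hgc := continuous_of_lift hg.continuous
  have hfg : ContDiff ℝ 1 (lift fun x => f (g x)) :=
    (contDiff_f (n := 1)).comp hg
  have h1 : ∀ j : Fin 2, (k j : ℝ) ^ 2 * ‖fourierHat (fun x => f (g x)) k‖ ^ 2
      ≤ (∫ x, (3 * g x ^ 2 - 1) ^ 2) * ∫ x, pd j g x ^ 2 := by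
    intro j
    have hpc := continuous_pd j hg
    have e1 : (k j : ℝ) ^ 2 * ‖fourierHat (fun x => f (g x)) k‖ ^ 2
        = ‖fourierHat (pd j fun x => f (g x)) k‖ ^ 2 := by
      simp [fourierHat_pd j hfg, mul_pow]
    rw [e1]
    have e2 := norm_fourierHat_le (pd j fun x => f (g x)) k
    have e3 : ∀ x, |pd j (fun x => f (g x)) x| = |3 * g x ^ 2 - 1| * |pd j g x| := fun x => by
      rw [pd_comp hasDerivAt_f j hg, abs_mul]
    simp only [e3] at e2
    calc _ ≤ (∫ x, |3 * g x ^ 2 - 1| * |pd j g x|) ^ 2 := by gcongr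
      _ ≤ (∫ x, |3 * g x ^ 2 - 1| ^ 2) * ∫ x, |pd j g x| ^ 2 :=
        integral_cauchy_schwarz (by fun_prop) (by fun_prop)
      _ = _ := by simp only [sq_abs]
  have h2 : ∫ x, (3 * g x ^ 2 - 1) ^ 2 ≤ 72 * (∫ x, F (g x)) + 8 * (2 * Real.pi) ^ 2 := by
    have : ∫ x, (3 * g x ^ 2 - 1) ^ 2 ≤ ∫ x, (72 * F (g x) + 8) := by
      refine integral_mono (integrable_of_continuous (by fun_prop))
        (integrable_of_continuous (by fun_prop)) fun x => ?_
      simp only [F]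
      -- Write `3r² - 1 = 3(r² - 1) + 2`; then the square is at most `18(r² - 1)² + 8 = 72 F(r) +
      -- 8`.
      nlinarith [sq_nonneg (3 * (g x ^ 2 - 1) - 2)]
    rwa [integral_add (integrable_of_continuous (by fun_prop)) (integrable_const _),
      integral_const_mul, integral_const, volume_torus, smul_eq_mul, mul_comm _ (8 : ℝ)] at this
  calc _ = ∑ j, (k j : ℝ) ^ 2 * ‖fourierHat (fun x => f (g x)) k‖ ^ 2 := by
        rw [normSq, Finset.sum_mul]
    _ ≤ ∑ j, (∫ x, (3 * g x ^ 2 - 1) ^ 2) * ∫ x, pd j g x ^ 2 := Finset.sum_le_sum fun j _ => h1 j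
    _ = (∫ x, (3 * g x ^ 2 - 1) ^ 2) * gradNormSq g := by
        rw [← Finset.mul_sum, gradNormSq_eq_integral hg]
    _ ≤ _ := mul_le_mul_of_nonneg_right h2 (gradNormSq_nonneg g)

end Derivative

/-! ### The Laplacian and the chemical potential. -/

/-- The Laplacian of a function on the torus. -/
def lap (g : Torus → ℝ) (x : Torus) : ℝ := ∑ j, pd j (pd j g) x

section Laplacian
variable {g h : Torus → ℝ}

/-- Links iterated `pd` with `iteratedFDeriv`: it identifies `lap` with the Laplacian of the lift,
and it turns the continuity assumed of a solution's derivatives into bounds of iterated `pd`. -/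
lemma lift_pd_of_iterated {n : ℕ} {G : Plane → ℝ} (hG : ContDiff ℝ (n + 1 : ℕ) G)
    {m : Fin n → Plane} (hh : lift h = fun y => iteratedFDeriv ℝ n G y m) (j : Fin 2) :
    lift (pd j h) = fun y => iteratedFDeriv ℝ (n + 1) G y (Fin.cons (unitVec j) m) := by
  rw [lift_pd, hh]
  ext y
  rw [iteratedFDeriv_succ_apply_left]
  have h1 : DifferentiableAt ℝ (iteratedFDeriv ℝ n G) y :=
    (hG.differentiable_iteratedFDeriv (m := n) (by norm_cast; omega)) y
  have h2 := ((ContinuousMultilinearMap.apply ℝ (fun _ : Fin n => Plane) ℝ m).hasFDerivAt.comp y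
    h1.hasFDerivAt)
  change fderiv ℝ ((ContinuousMultilinearMap.apply ℝ (fun _ : Fin n => Plane) ℝ m) ∘
    (iteratedFDeriv ℝ n G)) y (unitVec j) = _
  rw [h2.fderiv]
  simp

lemma lift_lap (hg : ContDiff ℝ 2 (lift g)) : lift (lap g) = Δ (lift g) := by
  rw [InnerProductSpace.laplacian_eq_iteratedFDeriv_orthonormalBasis (lift g)
    (EuclideanSpace.basisFun (Fin 2) ℝ)]
  ext y
  change ∑ j, lift (pd j (pd j g)) y = _
  refine Finset.sum_congr rfl fun j _ => ?_
  have h0 : lift g = fun y => iteratedFDeriv ℝ 0 (lift g) y ![] := by ext y; simp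
  have h1 := lift_pd_of_iterated (hg.of_le (by norm_num)) h0 j
  rw [lift_pd_of_iterated (by exact_mod_cast hg) h1 j]
  simp only [EuclideanSpace.basisFun_apply]
  congr 1

lemma fourierHat_lap (hg : ContDiff ℝ 2 (lift g)) (k : Mode) :
    fourierHat (lap g) k = -normSq k * fourierHat g k := by
  have h1 : ContDiff ℝ 1 (lift g) := hg.of_le (by norm_num)
  have h2 : ∀ j, ContDiff ℝ 1 (lift (pd j g)) := fun j =>
    contDiff_lift_pd (n := 1) j (by exact_mod_cast hg)
  have h3 : ∀ j, Continuous (pd j (pd j g)) := fun j => continuous_pd j (h2 j)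
  have h4 : lap g = fun x => pd 0 (pd 0 g) x + pd 1 (pd 1 g) x := by
    ext x; simp [lap, Fin.sum_univ_two]
  rw [h4, fourierHat_add (integrable_of_continuous (h3 0)) (integrable_of_continuous (h3 1)),
    fourierHat_pd _ (h2 _), fourierHat_pd _ (h2 _), fourierHat_pd _ h1, fourierHat_pd _ h1]
  simp only [normSq, Fin.sum_univ_two]
  push_cast
  linear_combination ((k 0 : ℂ) ^ 2 + (k 1 : ℂ) ^ 2) * fourierHat g k * Complex.I_sq

lemma continuous_lap (hg : ContDiff ℝ 2 (lift g)) : Continuous (lap g) := by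
  unfold lap
  exact continuous_finsetSum _ fun j _ => continuous_pd j
    (contDiff_lift_pd (n := 1) j (by exact_mod_cast hg))

lemma contDiff_lift_lap {n : ℕ} (hg : ContDiff ℝ (n + 2 : ℕ) (lift g)) :
    ContDiff ℝ n (lift (lap g)) := by
  have : lift (lap g) = fun y => ∑ j, lift (pd j (pd j g)) y := rfl
  rw [this]
  exact ContDiff.sum fun j _ => contDiff_lift_pd j (contDiff_lift_pd j hg)

lemma pd_add (hg : ContDiff ℝ 1 (lift g)) (hh : ContDiff ℝ 1 (lift h)) (j : Fin 2) :
    pd j (fun x => g x + h x) = fun x => pd j g x + pd j h x := by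
  ext x
  unfold pd
  have : lift (fun x => g x + h x) = lift g + lift h := rfl
  rw [this, fderiv_add (hg.differentiable (by norm_num) _) (hh.differentiable (by norm_num) _)]
  rfl

lemma pd_const_mul (c : ℝ) (hg : ContDiff ℝ 1 (lift g)) (j : Fin 2) :
    pd j (fun x => c * g x) = fun x => c * pd j g x := by
  ext x
  exact (pd_comp (G := fun r => c * r) (G' := fun _ => c)
    (fun r => by simpa using (hasDerivAt_id r).const_mul c) j hg x)

lemma pd_mul (hg : ContDiff ℝ 1 (lift g)) (hh : ContDiff ℝ 1 (lift h)) (j : Fin 2) :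
    pd j (fun x => g x * h x) = fun x => g x * pd j h x + h x * pd j g x := by
  ext x
  unfold pd
  have : lift (fun x => g x * h x) = lift g * lift h := rfl
  rw [this, fderiv_mul (hg.differentiable (by norm_num) _) (hh.differentiable (by norm_num) _)]
  simp [lift_rep]

end Laplacian

/-- The chemical potential `-ν Δ g + f(g)`. -/
def potential (ν : ℝ) (g : Torus → ℝ) (x : Torus) : ℝ := -ν * lap g x + f (g x)

section Potential
variable {g : Torus → ℝ} {ν : ℝ}

lemma contDiff_lift_potential (hg : ContDiff ℝ 4 (lift g)) :
    ContDiff ℝ 2 (lift (potential ν g)) := by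
  have h1 : ContDiff ℝ 2 (lift (lap g)) := contDiff_lift_lap (n := 2) (by exact_mod_cast hg)
  have h2 : ContDiff ℝ 2 (fun y => f (lift g y)) :=
    (contDiff_f (n := 2)).comp (hg.of_le (by norm_num))
  exact (contDiff_const.mul h1).add h2

lemma fourierHat_lap_potential (hg : ContDiff ℝ 4 (lift g)) (k : Mode) :
    fourierHat (lap (potential ν g)) k
      = -normSq k * (ν * normSq k * fourierHat g k + fourierHat (fun x => f (g x)) k) := by
  have hg2 : ContDiff ℝ 2 (lift g) := hg.of_le (by norm_num)
  have hgc : Continuous g := continuous_of_lift hg.continuous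
  rw [fourierHat_lap (contDiff_lift_potential hg)]
  congr 1
  unfold potential
  have hl := continuous_lap hg2
  rw [fourierHat_add (integrable_of_continuous (by fun_prop))
    (integrable_of_continuous (by fun_prop)), fourierHat_const_mul, fourierHat_lap hg2]
  push_cast
  ring

/-- Written out in terms of partial derivatives of `g` of order at most four, so that `∂ₜu` can be
bounded uniformly on compact sets of positive times. -/
lemma pd_pd_potential (hg : ContDiff ℝ 4 (lift g)) (j : Fin 2) (x : Torus) :
    pd j (pd j (potential ν g)) x
      = -ν * (pd j (pd j (pd 0 (pd 0 g))) x + pd j (pd j (pd 1 (pd 1 g))) x)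
        + ((3 * g x ^ 2 - 1) * pd j (pd j g) x + pd j g x * (6 * g x * pd j g x)) := by
  have hg3 : ∀ i, ContDiff ℝ 3 (lift (pd i g)) := fun i =>
    contDiff_lift_pd (n := 3) i (by exact_mod_cast hg)
  have hg2 : ∀ i, ContDiff ℝ 2 (lift (pd i (pd i g))) := fun i =>
    contDiff_lift_pd (n := 2) i (by exact_mod_cast hg3 i)
  have hg1 : ∀ i, ContDiff ℝ 1 (lift (pd j (pd i (pd i g)))) := fun i =>
    contDiff_lift_pd (n := 1) j (by exact_mod_cast hg2 i)
  have a1 : ∀ i, ContDiff ℝ 1 (lift (pd i (pd i g))) := fun i => (hg2 i).of_le (by norm_num)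
  have b1 : ContDiff ℝ 1 (lift (pd j g)) := (hg3 j).of_le (by norm_num)
  have c1 : ContDiff ℝ 1 (lift g) := hg.of_le (by norm_num)
  have d1 : ContDiff ℝ 1 (lift fun x => f (g x)) := (contDiff_f (n := 1)).comp c1
  have e1 : ContDiff ℝ 1 (lift fun x => 3 * g x ^ 2 - 1) := by
    have : ContDiff ℝ 1 fun y => 3 * lift g y ^ 2 - 1 := by fun_prop
    exact this
  have q : potential ν g
      = fun x => -ν * (pd 0 (pd 0 g) x + pd 1 (pd 1 g) x) + f (g x) := by
    ext x; simp [potential, lap, Fin.sum_univ_two]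
  have s1 : ContDiff ℝ 1 (lift fun x => pd 0 (pd 0 g) x + pd 1 (pd 1 g) x) := (a1 0).add (a1 1)
  have s2 : ContDiff ℝ 1 (lift fun x => -ν * (pd 0 (pd 0 g) x + pd 1 (pd 1 g) x)) :=
    contDiff_const.mul s1
  have t1 : ContDiff ℝ 1 (lift fun x => pd j (pd 0 (pd 0 g)) x + pd j (pd 1 (pd 1 g)) x) :=
    (hg1 0).add (hg1 1)
  have t2 : ContDiff ℝ 1 (lift fun x => -ν * (pd j (pd 0 (pd 0 g)) x + pd j (pd 1 (pd 1 g)) x)) :=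
    contDiff_const.mul t1
  have p1 : pd j (fun x => f (g x)) = fun x => (3 * g x ^ 2 - 1) * pd j g x := by
    ext x; rw [pd_comp hasDerivAt_f j c1]
  have t3 : ContDiff ℝ 1 (lift fun x => (3 * g x ^ 2 - 1) * pd j g x) := e1.mul b1
  have p2 : pd j (fun x => 3 * g x ^ 2 - 1) = fun x => 6 * g x * pd j g x := by
    ext x
    rw [pd_comp (G := fun r => 3 * r ^ 2 - 1) (G' := fun r => 6 * r) (fun r => ?_) j c1]
    have := ((hasDerivAt_pow 2 r).const_mul 3).sub_const 1
    convert! this using 1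
    simp; ring
  rw [q, pd_add s2 d1, pd_const_mul _ s1, pd_add (a1 0) (a1 1), p1, pd_add t2 t3,
    pd_const_mul _ t1, pd_add (hg1 0) (hg1 1), pd_mul e1 b1, p2]

end Potential

namespace IsSolution
variable {ν : ℝ} {u₀ : Torus → ℝ} {u : ℝ → Torus → ℝ} (hu : IsSolution ν u₀ u)
include hu

lemma hasDerivAt {t : ℝ} (ht : 0 < t) (x : Torus) :
    HasDerivAt (fun r => u r x) (lap (potential ν (u t)) x) t := by
  have hC := hu.contDiff t ht
  have h := hu.equation t ht (rep x)
  have h1 : (fun z => -ν * Δ (lift (u t)) z + f (lift (u t) z)) = lift (potential ν (u t)) := by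
    rw [← lift_lap (hC.of_le (by norm_num))]; rfl
  rw [h1, ← lift_lap (contDiff_lift_potential hC), lift_rep] at h
  simpa only [lift_rep] using h

/-- By periodicity only the values at `rep x` matter, and these points lie in a fixed compact ball.
-/
lemma exists_bound_iteratedFDeriv {a b : ℝ} (ha : 0 < a) {n : ℕ} (hn : n ≤ 4) :
    ∃ C, ∀ t ∈ Icc a b, ∀ x, ‖iteratedFDeriv ℝ n (lift (u t)) (rep x)‖ ≤ C := by
  have hK : IsCompact (Icc a b ×ˢ Metric.closedBall (0 : Plane) (4 * Real.pi)) :=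
    isCompact_Icc.prod (isCompact_closedBall _ _)
  obtain ⟨C, hC⟩ := hK.exists_bound_of_continuousOn
    ((hu.continuousOn_deriv n hn).mono fun p hp => ⟨ha.trans_le hp.1.1, mem_univ _⟩)
  exact ⟨C, fun t ht x => hC (t, rep x) ⟨ht, by simpa using norm_rep_le x⟩⟩

end IsSolution

/-- `h` is a partial derivative of order `n` of the function with the lift `G`. -/
def IsPartial (n : ℕ) (G : Plane → ℝ) (h : Torus → ℝ) : Prop :=
  ∃ m : Fin n → Plane, (∀ i, ‖m i‖ ≤ 1) ∧ lift h = fun y => iteratedFDeriv ℝ n G y m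

namespace IsPartial
variable {n : ℕ} {G : Plane → ℝ} {h : Torus → ℝ}

lemma pd (hh : IsPartial n G h) (hG : ContDiff ℝ (n + 1 : ℕ) G) (j : Fin 2) :
    IsPartial (n + 1) G (pd j h) := by
  obtain ⟨m, hm, hl⟩ := hh
  refine ⟨Fin.cons (unitVec j) m, fun i => ?_, lift_pd_of_iterated hG hl j⟩
  refine Fin.cases ?_ (fun i => ?_) i
  · simp [unitVec]
  · simpa using hm i

lemma abs_le (hh : IsPartial n G h) (x : Torus) : |h x| ≤ ‖iteratedFDeriv ℝ n G (rep x)‖ := by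
  obtain ⟨m, hm, hl⟩ := hh
  rw [← lift_rep h x, hl, ← Real.norm_eq_abs]
  exact ContinuousMultilinearMap.unit_le_opNorm _
    ((pi_norm_le_iff_of_nonneg zero_le_one).mpr hm)

lemma self (g : Torus → ℝ) : IsPartial 0 (lift g) g := ⟨![], fun i => i.elim0, by ext y; simp⟩

end IsPartial

/-! ### Variation of constants, mode by mode. -/

/-- The variation of constants formula for a mode of the equation. -/
lemma duhamel {v φ : ℝ → ℂ} {a b ν lam : ℝ} (hab : a ≤ b) (hv : ContinuousOn v (Icc a b))
    (hφ : ContinuousOn φ (Icc a b))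
    (hd : ∀ t ∈ Ioo a b, HasDerivAt v (-lam * (ν * lam * v t + φ t)) t) :
    ∫ t in a..b, Complex.exp (-(ν * lam ^ 2 : ℝ) * (b - t)) * (-lam * φ t)
      = v b - Complex.exp (-(ν * lam ^ 2 : ℝ) * (b - a)) * v a := by
  set α : ℝ := ν * lam ^ 2 with hα
  have hE : ContinuousOn (fun t : ℝ => Complex.exp (-α * (b - t))) (Icc a b) := by fun_prop
  rw [intervalIntegral.integral_eq_sub_of_hasDerivAt_of_le
    (f := fun t => Complex.exp (-α * (b - t)) * v t) hab (hE.mul hv) ?_ ?_]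
  · simp
  · intro t ht
    have e1 : HasDerivAt (fun t : ℝ => Complex.exp (-α * (b - t)))
        (Complex.exp (-α * (b - t)) * α) t := by
      have : HasDerivAt (fun t : ℝ => (-α * (b - t) : ℂ)) α t := by
        simpa using ((Complex.ofRealCLM.hasDerivAt (x := t)).const_sub (b : ℂ)).const_mul (-α : ℂ)
      exact this.cexp
    refine (e1.mul (hd t ht)).congr_deriv ?_
    rw [hα]; push_cast; ring
  · refine ContinuousOn.intervalIntegrable ?_
    rw [uIcc_of_le hab]
    fun_prop

/-- For `lam = 0` both sides vanish, the right one because division by zero gives zero; the zero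
mode thus needs no separate formula. -/
lemma integral_kernel {ν lam : ℝ} (hν : 0 < ν) (hl : 0 ≤ lam) (a b : ℝ) :
    ∫ t in a..b, lam * Real.exp (-(ν * lam ^ 2) * (b - t))
      = (1 - Real.exp (-(ν * lam ^ 2) * (b - a))) / (ν * lam) := by
  rcases hl.eq_or_lt with h0 | h0
  · simp [← h0]
  · rw [intervalIntegral.integral_eq_sub_of_hasDerivAt
      (f := fun t => Real.exp (-(ν * lam ^ 2) * (b - t)) / (ν * lam))]
    · simp; ring
    · intro t _
      have : HasDerivAt (fun t : ℝ => -(ν * lam ^ 2) * (b - t)) (ν * lam ^ 2) t := by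
        simpa using ((hasDerivAt_id t).const_sub b).const_mul (-(ν * lam ^ 2))
      refine (this.exp.div_const (ν * lam)).congr_deriv ?_
      field_simp
    · exact Continuous.intervalIntegrable (by fun_prop) _ _

/-- The variation of constants formula, as an estimate, for a mode of the equation. -/
lemma norm_duhamel_le {v φ : ℝ → ℂ} {a b ν lam P : ℝ} {φ₀ : ℂ} (hν : 0 < ν) (hl : 0 ≤ lam)
    (hab : a ≤ b) (hv : ContinuousOn v (Icc a b)) (hφ : ContinuousOn φ (Icc a b))
    (hd : ∀ t ∈ Ioo a b, HasDerivAt v (-lam * (ν * lam * v t + φ t)) t)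
    (hP : ∀ t ∈ Ioc a b, ‖φ t - φ₀‖ ≤ P) :
    ‖v b - Real.exp (-ν * lam ^ 2 * (b - a)) * v a
      + ((1 - Real.exp (-ν * lam ^ 2 * (b - a))) / (ν * lam) : ℝ) * φ₀‖
      ≤ (1 - Real.exp (-ν * lam ^ 2 * (b - a))) / (ν * lam) * P := by
  have h1 := duhamel hab hv hφ hd
  have h2 := integral_kernel hν hl a b
  set α : ℝ := ν * lam ^ 2 with hα
  have hexp : ∀ t : ℝ, Complex.exp (-α * (b - t)) = (Real.exp (-α * (b - t)) : ℝ) := fun t => by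
    push_cast; rfl
  have h2 : ∫ t in a..b, lam * Real.exp (-α * (b - t))
      = (1 - Real.exp (-α * (b - a))) / (ν * lam) := by
    rcases hl.eq_or_lt with h0 | h0
    · simp [← h0]
    · have hαp : 0 < α := by positivity
      rw [intervalIntegral.integral_eq_sub_of_hasDerivAt
        (f := fun t => Real.exp (-α * (b - t)) / (ν * lam))]
      · simp; ring
      · intro t _
        have : HasDerivAt (fun t : ℝ => -α * (b - t)) α t := by
          simpa using ((hasDerivAt_id t).const_sub b).const_mul (-α)
        refine (this.exp.div_const (ν * lam)).congr_deriv ?_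
        rw [hα]; field_simp
      · exact Continuous.intervalIntegrable (by fun_prop) _ _
  have hint : IntervalIntegrable (fun t : ℝ => (lam * Real.exp (-α * (b - t)) : ℝ)) volume a b :=
    Continuous.intervalIntegrable (by fun_prop) _ _
  -- The term with the frozen value `φ₀` is itself the integral of the kernel against a constant, so
  -- it merges with Duhamel's integral.
  have h3 : v b - Complex.exp (-α * (b - a)) * v a
      + ((1 - Real.exp (-α * (b - a))) / (ν * lam) : ℝ) * φ₀
      = ∫ t in a..b, Complex.exp (-α * (b - t)) * (-lam * (φ t - φ₀)) := by
    rw [← h1, ← h2, ← intervalIntegral.integral_ofReal, ← intervalIntegral.integral_mul_const,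
      ← intervalIntegral.integral_add]
    · congr 1; ext t; rw [hexp]; push_cast; ring
    · refine ContinuousOn.intervalIntegrable ?_
      rw [uIcc_of_le hab]; fun_prop
    · exact Continuous.intervalIntegrable (by fun_prop) _ _
  have h4 : -ν * lam ^ 2 * (b - a) = -α * (b - a) := by rw [hα]; ring
  rw [h4, ← hexp a, h3, ← h2, ← intervalIntegral.integral_mul_const]
  refine intervalIntegral.norm_integral_le_of_norm_le hab ?_ (hint.mul_const P)
  refine Filter.Eventually.of_forall fun t ht => ?_
  rw [hexp, norm_mul, Complex.norm_real, Real.norm_of_nonneg (Real.exp_pos _).le, norm_mul,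
    norm_neg, Complex.norm_real, Real.norm_of_nonneg hl]
  have := hP t ht
  calc _ = lam * Real.exp (-α * (b - t)) * ‖φ t - φ₀‖ := by ring
    _ ≤ _ := by gcongr

namespace IsSolution
variable {ν : ℝ} {u₀ : Torus → ℝ} {u : ℝ → Torus → ℝ} (hu : IsSolution ν u₀ u)
include hu

lemma exists_bound_deriv {a b : ℝ} (ha : 0 < a) :
    ∃ C, ∀ t ∈ Icc a b, ∀ x, |lap (potential ν (u t)) x| ≤ C := by
  obtain ⟨C0, h0⟩ := hu.exists_bound_iteratedFDeriv (b := b) ha (n := 0) (by norm_num)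
  obtain ⟨C1, h1⟩ := hu.exists_bound_iteratedFDeriv (b := b) ha (n := 1) (by norm_num)
  obtain ⟨C2, h2⟩ := hu.exists_bound_iteratedFDeriv (b := b) ha (n := 2) (by norm_num)
  obtain ⟨C4, h4⟩ := hu.exists_bound_iteratedFDeriv (b := b) ha (n := 4) (by norm_num)
  have key : ∀ t ∈ Icc a b, ∀ x, ∀ j, |pd j (pd j (potential ν (u t))) x|
      ≤ |ν| * (C4 + C4) + ((3 * C0 ^ 2 + 1) * C2 + C1 * (6 * C0 * C1)) := by
    intro t ht x j
    have hC := hu.contDiff t (ha.trans_le ht.1)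
    have i0 := IsPartial.self (u t)
    have i1 : ∀ i, IsPartial 1 (lift (u t)) (pd i (u t)) := fun i =>
      i0.pd (hC.of_le (by norm_num)) i
    have i2 : ∀ i, IsPartial 2 (lift (u t)) (pd i (pd i (u t))) := fun i =>
      (i1 i).pd (hC.of_le (by norm_num)) i
    have i3 : ∀ i, IsPartial 3 (lift (u t)) (pd j (pd i (pd i (u t)))) := fun i =>
      (i2 i).pd (hC.of_le (by norm_num)) j
    have i4 : ∀ i, IsPartial 4 (lift (u t)) (pd j (pd j (pd i (pd i (u t))))) := fun i =>
      (i3 i).pd (by exact_mod_cast hC) j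
    have b0 := (i0.abs_le x).trans (h0 t ht x)
    have b1 := ((i1 j).abs_le x).trans (h1 t ht x)
    have b2 := ((i2 j).abs_le x).trans (h2 t ht x)
    have b4 := fun i => ((i4 i).abs_le x).trans (h4 t ht x)
    have hC0 := (abs_nonneg _).trans b0
    have hC1 := (abs_nonneg _).trans b1
    rw [pd_pd_potential hC]
    have q : |3 * u t x ^ 2 - 1| ≤ 3 * C0 ^ 2 + 1 := by
      rw [abs_le]
      have : u t x ^ 2 ≤ C0 ^ 2 := sq_le_sq' (abs_le.mp b0).1 (abs_le.mp b0).2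
      constructor <;> nlinarith [sq_nonneg (u t x)]
    refine (abs_add_le _ _).trans (add_le_add ?_ ((abs_add_le _ _).trans (add_le_add ?_ ?_)))
    · rw [abs_mul, abs_neg]
      exact mul_le_mul_of_nonneg_left ((abs_add_le _ _).trans (add_le_add (b4 0) (b4 1)))
        (abs_nonneg _)
    · rw [abs_mul]; gcongr
    · rw [abs_mul, abs_mul, abs_mul, abs_of_pos (by norm_num : (0 : ℝ) < 6)]; gcongr
  refine ⟨∑ _j : Fin 2, (|ν| * (C4 + C4) + ((3 * C0 ^ 2 + 1) * C2 + C1 * (6 * C0 * C1))),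
    fun t ht x => ?_⟩
  unfold lap
  refine (Finset.abs_sum_le_sum_abs _ _).trans (Finset.sum_le_sum fun j _ => key t ht x j)

/-- Clamping the time at zero gives a function continuous on all of `ℝ × 𝕋²`, to which results on
parametric integrals apply directly. -/
lemma continuous_ext : Continuous fun p : ℝ × Torus => u (max p.1 0) p.2 := by
  refine hu.continuousOn.comp_continuous (f := fun p : ℝ × Torus => (max p.1 0, p.2))
    (by fun_prop) fun p => ⟨le_max_right p.1 0, mem_univ _⟩

lemma continuous_slice {t : ℝ} (ht : 0 ≤ t) : Continuous (u t) := by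
  have := hu.continuous_ext.comp (Continuous.prodMk_right t)
  simpa [Function.comp_def, max_eq_left ht] using this

lemma exists_bound (T : ℝ) : ∃ R, 0 ≤ R ∧ ∀ t ∈ Icc 0 T, ∀ x, |u t x| ≤ R := by
  obtain ⟨C, hC⟩ := (isCompact_Icc.prod (isCompact_univ (X := Torus))).exists_bound_of_continuousOn
    (s := Icc 0 T ×ˢ univ) (hu.continuousOn.mono fun p hp => ⟨hp.1.1, mem_univ _⟩)
  exact ⟨max C 0, le_max_right _ _, fun t ht x => (hC (t, x) ⟨ht, mem_univ _⟩).trans (le_max_left _ _)⟩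

lemma continuousOn_integral {χ : Torus → ℂ} (hχ : Continuous χ) {Φ : ℝ → ℝ} (hΦ : Continuous Φ) :
    ContinuousOn (fun t => ∫ x, χ x * (Φ (u t x) : ℂ)) (Ici 0) := by
  have h : Continuous fun t => ∫ x in univ, χ x * (Φ (u (max t 0) x) : ℂ) := by
    refine continuous_parametric_integral_of_continuous ?_ isCompact_univ
    exact (hχ.comp continuous_snd).mul
      (Complex.continuous_ofReal.comp (hΦ.comp hu.continuous_ext))
  simp only [Measure.restrict_univ] at h
  refine h.continuousOn.congr fun t ht => ?_
  simp only [max_eq_left (mem_Ici.mp ht)]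

/-- Differentiation under the integral; the domination comes from the bound of `∂ₜu` on `[t/2, 2t]`,
which stays away from the initial time. Only `Φ = id` and `Φ = F` are needed. -/
lemma hasDerivAt_integral {χ : Torus → ℂ} (hχ : Continuous χ) {Φ Φ' : ℝ → ℝ}
    (hΦ : ∀ r, HasDerivAt Φ (Φ' r) r) (hΦ' : Continuous Φ') {t : ℝ} (ht : 0 < t) :
    HasDerivAt (fun t => ∫ x, χ x * (Φ (u t x) : ℂ))
      (∫ x, χ x * ((Φ' (u t x) * lap (potential ν (u t)) x : ℝ) : ℂ)) t := by
  have hΦc : Continuous Φ := continuous_iff_continuousAt.mpr fun r => (hΦ r).continuousAt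
  obtain ⟨C, hC⟩ := hu.exists_bound_deriv (a := t / 2) (b := 2 * t) (by linarith)
  obtain ⟨R, hR0, hR⟩ := hu.exists_bound (2 * t)
  obtain ⟨M, hM⟩ := (isCompact_Icc (a := -R) (b := R)).exists_bound_of_continuousOn hΦ'.continuousOn
  obtain ⟨K, hK⟩ := (isCompact_univ (X := Torus)).exists_bound_of_continuousOn hχ.continuousOn
  have hw : Continuous (lap (potential ν (u t))) :=
    continuous_lap (contDiff_lift_potential (hu.contDiff t ht))
  have hut := hu.continuous_slice ht.le
  have hnear : Icc (t / 2) (2 * t) ∈ nhds t := Icc_mem_nhds (by linarith) (by linarith)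
  refine (hasDerivAt_integral_of_dominated_loc_of_deriv_le (bound := fun _ => K * (M * C))
      (F' := fun s x => χ x * ((Φ' (u s x) * lap (potential ν (u s)) x : ℝ) : ℂ))
      hnear ?_ ?_ ?_ ?_ ?_ ?_).2
  · filter_upwards [hnear] with s hs
    have := hu.continuous_slice (t := s) (by linarith [hs.1])
    exact (show Continuous _ by fun_prop).aestronglyMeasurable
  · exact integrable_of_continuous (by fun_prop)
  · exact (show Continuous _ by fun_prop).aestronglyMeasurable
  · refine Filter.Eventually.of_forall fun x s hs => ?_
    have h1 := hC s hs x
    have h2 := hR s ⟨by linarith [hs.1], hs.2⟩ x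
    have h3 := hM (u s x) (abs_le.mp h2)
    have h4 := hK x (mem_univ x)
    rw [norm_mul, Complex.norm_real, norm_mul]
    exact mul_le_mul h4 (mul_le_mul h3 h1 (abs_nonneg _) ((norm_nonneg _).trans h3))
      (mul_nonneg (norm_nonneg _) (norm_nonneg _)) ((norm_nonneg _).trans h4)
  · exact integrable_const _
  · refine Filter.Eventually.of_forall fun x s hs => ?_
    have h1 := hu.hasDerivAt (t := s) (by linarith [hs.1]) x
    exact (((hΦ (u s x)).comp s h1).ofReal_comp).const_mul (χ x)

lemma continuousOn_fourierHat (k : Mode) : ContinuousOn (fun t => fourierHat (u t) k) (Ici 0) :=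
  hu.continuousOn_integral (continuous_character (-k)) (Φ := id) continuous_id

lemma continuousOn_fourierHat_f (k : Mode) :
    ContinuousOn (fun t => fourierHat (fun x => f (u t x)) k) (Ici 0) :=
  hu.continuousOn_integral (continuous_character (-k)) continuous_f

lemma hasDerivAt_fourierHat (k : Mode) {t : ℝ} (ht : 0 < t) :
    HasDerivAt (fun t => fourierHat (u t) k) (-(normSq k : ℝ) * (ν * (normSq k : ℝ) *
      fourierHat (u t) k + fourierHat (fun x => f (u t x)) k)) t := by
  rw [← fourierHat_lap_potential (hu.contDiff t ht)]
  have := hu.hasDerivAt_integral (continuous_character (-k)) (Φ := id) (Φ' := fun _ => 1)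
    (fun r => hasDerivAt_id r) continuous_const ht
  simpa [fourierHat] using this

lemma fourierHat_init (k : Mode) : fourierHat (u 0) k = fourierHat u₀ k :=
  fourierHat_congr_ae hu.init k

lemma norm_duhamel (hν : 0 < ν) {a b : ℝ} (ha : 0 ≤ a) (hab : a ≤ b) (k : Mode) {φ₀ : ℂ} {P : ℝ}
    (hP : ∀ t ∈ Ioc a b, ‖fourierHat (fun x => f (u t x)) k - φ₀‖ ≤ P) :
    ‖fourierHat (u b) k - Real.exp (-ν * normSq k ^ 2 * (b - a)) * fourierHat (u a) k
      + ((1 - Real.exp (-ν * normSq k ^ 2 * (b - a))) / (ν * normSq k) : ℝ) * φ₀‖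
      ≤ (1 - Real.exp (-ν * normSq k ^ 2 * (b - a))) / (ν * normSq k) * P := by
  have hsub : Icc a b ⊆ Ici 0 := fun t ht => ha.trans ht.1
  exact norm_duhamel_le (v := fun t => fourierHat (u t) k) hν (normSq_nonneg k) hab
    ((hu.continuousOn_fourierHat k).mono hsub)
    ((hu.continuousOn_fourierHat_f k).mono hsub)
    (fun t ht => hu.hasDerivAt_fourierHat k (ha.trans_lt ht.1)) hP

/-- Duhamel with frozen value zero: the kernel has mass at most `1/(νλ)` for every length of the
interval, hence no growth in time. At `k = 0` the last term is zero by convention, in accordance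
with the conservation of mass. -/
lemma norm_fourierHat_le_of_bound (hν : 0 < ν) {T : ℝ} (k : Mode) {P : ℝ}
    (hP0 : 0 ≤ P) (hP : ∀ t ∈ Ioc 0 T, ‖fourierHat (fun x => f (u t x)) k‖ ≤ P) {t : ℝ} (ht : t ∈ Icc 0 T) :
    ‖fourierHat (u t) k‖ ≤ ‖fourierHat u₀ k‖ + P / (ν * normSq k) := by
  have h := hu.norm_duhamel hν le_rfl ht.1 k (φ₀ := 0) (P := P) fun s hs => by
    simpa using hP s ⟨hs.1, hs.2.trans ht.2⟩
  rw [mul_zero, add_zero, hu.fourierHat_init, sub_zero] at h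
  set e := Real.exp (-ν * normSq k ^ 2 * t) with he
  have he0 : 0 < e := Real.exp_pos _
  have he1 : e ≤ 1 := by
    rw [he, Real.exp_le_one_iff]
    have := mul_nonneg (mul_nonneg hν.le (sq_nonneg (normSq k))) ht.1
    linarith
  have h2 : ‖fourierHat (u t) k‖ ≤ ‖(e : ℂ) * fourierHat u₀ k‖ + (1 - e) / (ν * normSq k) * P := by
    have := norm_sub_norm_le (fourierHat (u t) k) ((e : ℂ) * fourierHat u₀ k)
    linarith
  rw [norm_mul, Complex.norm_real, Real.norm_of_nonneg he0.le] at h2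
  have h3 : e * ‖fourierHat u₀ k‖ ≤ ‖fourierHat u₀ k‖ :=
    mul_le_of_le_one_left (norm_nonneg _) he1
  have h4 : (1 - e) / (ν * normSq k) * P ≤ P / (ν * normSq k) := by
    rw [div_mul_eq_mul_div]
    refine div_le_div_of_nonneg_right ?_ (mul_nonneg hν.le (normSq_nonneg k))
    nlinarith
  linarith

end IsSolution

/-! ### A gradient bound that reaches down to the initial time. -/

lemma intervalIntegral_cauchy_schwarz {e p : ℝ → ℝ} {a b : ℝ} (hab : a ≤ b)
    (he : ContinuousOn e (Icc a b)) (hp : ContinuousOn p (Icc a b)) (he0 : ∀ t, 0 ≤ e t) :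
    (∫ t in a..b, e t * p t) ^ 2 ≤ (∫ t in a..b, e t) * ∫ t in a..b, e t * p t ^ 2 := by
  have hI : ∀ {q : ℝ → ℝ}, ContinuousOn q (Icc a b) → IntervalIntegrable q volume a b := by
    intro q hq
    refine ContinuousOn.intervalIntegrable ?_
    rwa [uIcc_of_le hab]
  have h : ∀ s : ℝ, 0 ≤ (∫ t in a..b, e t) * (s * s) + (2 * ∫ t in a..b, e t * p t) * s
      + ∫ t in a..b, e t * p t ^ 2 := by
    intro s
    have h1 : 0 ≤ ∫ t in a..b, e t * (s + p t) ^ 2 :=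
      intervalIntegral.integral_nonneg hab fun t _ => mul_nonneg (he0 t) (sq_nonneg _)
    have h2 : ∫ t in a..b, e t * (s + p t) ^ 2
        = ∫ t in a..b, (e t * (s * s) + (e t * p t) * (2 * s) + e t * p t ^ 2) := by
      congr 1; ext t; ring
    rw [h2, intervalIntegral.integral_add (hI (by fun_prop)) (hI (by fun_prop)),
      intervalIntegral.integral_add (hI (by fun_prop)) (hI (by fun_prop)),
      intervalIntegral.integral_mul_const, intervalIntegral.integral_mul_const] at h1
    linarith
  have := discrim_le_zero h
  unfold discrim at this
  linarith

/-- With `x = λ√(νr)` this is `x e^{-x²} ≤ 1`. It trades the factor `λ` for an integrable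
singularity in time that is the same for all modes. -/
lemma kernel_le {ν lam r : ℝ} (hν : 0 < ν) (hr : 0 < r) :
    lam * Real.exp (-(ν * lam ^ 2) * r) ≤ ν ^ (-(1 / 2) : ℝ) * r ^ (-(1 / 2) : ℝ) := by
  rw [← Real.mul_rpow hν.le hr.le, Real.rpow_neg (by positivity), ← Real.sqrt_eq_rpow]
  have hs : 0 < Real.sqrt (ν * r) := Real.sqrt_pos.mpr (by positivity)
  rw [← one_div, le_div_iff₀ hs]
  set x := lam * Real.sqrt (ν * r) with hx
  have hx2 : ν * lam ^ 2 * r = x ^ 2 := by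
    rw [hx, mul_pow, Real.sq_sqrt (by positivity)]; ring
  have h1 : x ≤ Real.exp (x ^ 2) := by
    have := Real.add_one_le_exp (x ^ 2)
    nlinarith [sq_nonneg (x - 1), sq_nonneg x]
  have h2 : lam * Real.exp (-(ν * lam ^ 2) * r) * Real.sqrt (ν * r) = x * Real.exp (-x ^ 2) := by
    rw [← hx2, hx, neg_mul]; ring
  rw [h2, Real.exp_neg]
  exact mul_inv_le_one_of_le₀ h1 (Real.exp_pos _).le

lemma integral_sub_rpow (b : ℝ) :
    ∫ t in (0 : ℝ)..b, (b - t) ^ (-(1 / 2) : ℝ) = 2 * b ^ (1 / 2 : ℝ) := by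
  rw [intervalIntegral.integral_comp_sub_left (fun t => t ^ (-(1 / 2) : ℝ)) b,
    integral_rpow (Or.inl (by norm_num))]
  norm_num
  ring

lemma intervalIntegrable_sub_rpow (b : ℝ) :
    IntervalIntegrable (fun t => (b - t) ^ (-(1 / 2) : ℝ)) volume 0 b := by
  have := (intervalIntegral.intervalIntegrable_rpow' (r := (-(1 / 2) : ℝ)) (by norm_num)
    (a := b) (b := 0)).comp_sub_left b
  simpa using this

/-- A mode of the solution, estimated by a weakly singular integral. -/
lemma weighted_mode_le {v φ : ℝ → ℂ} {b ν lam : ℝ} (hν : 0 < ν) (hl : 0 ≤ lam)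
    (hb : 0 ≤ b) (hv : ContinuousOn v (Icc 0 b)) (hφ : ContinuousOn φ (Icc 0 b))
    (hd : ∀ t ∈ Ioo 0 b, HasDerivAt v (-lam * (ν * lam * v t + φ t)) t) :
    lam * ‖v b‖ ^ 2 ≤ 2 * (lam * ‖v 0‖ ^ 2)
      + 2 / ν * ∫ t in (0 : ℝ)..b, lam * Real.exp (-(ν * lam ^ 2) * (b - t)) * ‖φ t‖ ^ 2 := by
  have h1 := duhamel hb hv hφ hd
  have h2 := integral_kernel hν hl 0 b
  have hφn : ContinuousOn (fun t => ‖φ t‖) (Icc 0 b) := hφ.norm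
  have h3 := intervalIntegral_cauchy_schwarz hb
    (e := fun t => lam * Real.exp (-(ν * lam ^ 2) * (b - t))) (p := fun t => ‖φ t‖)
    (by fun_prop) hφn fun t => mul_nonneg hl (Real.exp_pos _).le
  have hexp : ∀ t : ℝ, Complex.exp (-(ν * lam ^ 2 : ℝ) * (b - t))
      = (Real.exp (-(ν * lam ^ 2) * (b - t)) : ℝ) := fun t => by push_cast; rfl
  set I := ∫ t in (0 : ℝ)..b, lam * Real.exp (-(ν * lam ^ 2) * (b - t)) * ‖φ t‖ with hI
  set J := ∫ t in (0 : ℝ)..b, lam * Real.exp (-(ν * lam ^ 2) * (b - t)) * ‖φ t‖ ^ 2 with hJ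
  have hJ0 : 0 ≤ J := intervalIntegral.integral_nonneg hb fun t _ =>
    mul_nonneg (mul_nonneg hl (Real.exp_pos _).le) (sq_nonneg _)
  have h4 : ‖v b‖ ≤ ‖v 0‖ + I := by
    have e0 : v b = (v b - Complex.exp (-(ν * lam ^ 2 : ℝ) * (b - (0 : ℝ))) * v 0)
        + Complex.exp (-(ν * lam ^ 2 : ℝ) * (b - (0 : ℝ))) * v 0 := by ring
    rw [e0]
    have e1 : ‖Complex.exp (-(ν * lam ^ 2 : ℝ) * (b - (0 : ℝ))) * v 0‖ ≤ ‖v 0‖ := by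
      rw [hexp, norm_mul, Complex.norm_real, Real.norm_of_nonneg (Real.exp_pos _).le]
      refine mul_le_of_le_one_left (norm_nonneg _) ?_
      rw [Real.exp_le_one_iff]
      have := mul_nonneg (mul_nonneg hν.le (sq_nonneg lam)) hb
      linarith
    have e2 : ‖v b - Complex.exp (-(ν * lam ^ 2 : ℝ) * (b - (0 : ℝ))) * v 0‖ ≤ I := by
      rw [← h1]
      refine intervalIntegral.norm_integral_le_of_norm_le hb
        (Filter.Eventually.of_forall fun t _ => ?_) ?_
      · rw [hexp, norm_mul, Complex.norm_real, Real.norm_of_nonneg (Real.exp_pos _).le, norm_mul,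
          norm_neg, Complex.norm_real, Real.norm_of_nonneg hl]
        exact le_of_eq (by ring)
      · refine ContinuousOn.intervalIntegrable ?_
        rw [uIcc_of_le hb]; fun_prop
    linarith [norm_add_le (v b - Complex.exp (-(ν * lam ^ 2 : ℝ) * (b - (0 : ℝ))) * v 0)
      (Complex.exp (-(ν * lam ^ 2 : ℝ) * (b - (0 : ℝ))) * v 0)]
  -- The kernel has mass at most `1/(νλ)`, so the prefactor `λ` is consumed by one of the two
  -- factors from Cauchy–Schwarz.
  have h5 : lam * I ^ 2 ≤ 1 / ν * J := by
    rw [h2] at h3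
    have h6 : lam * ((1 - Real.exp (-(ν * lam ^ 2) * (b - 0))) / (ν * lam)) ≤ 1 / ν := by
      rcases hl.eq_or_lt with h0 | h0
      · rw [← h0, zero_mul]; positivity
      · have : lam * ((1 - Real.exp (-(ν * lam ^ 2) * (b - 0))) / (ν * lam))
            = (1 - Real.exp (-(ν * lam ^ 2) * (b - 0))) / ν := by field_simp
        rw [this]
        refine div_le_div_of_nonneg_right ?_ hν.le
        linarith [Real.exp_pos (-(ν * lam ^ 2) * (b - 0))]
    calc lam * I ^ 2 ≤ lam * ((1 - Real.exp (-(ν * lam ^ 2) * (b - 0))) / (ν * lam) * J) :=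
          mul_le_mul_of_nonneg_left h3 hl
      _ = (lam * ((1 - Real.exp (-(ν * lam ^ 2) * (b - 0))) / (ν * lam))) * J := by ring
      _ ≤ _ := mul_le_mul_of_nonneg_right h6 hJ0
  have h7 : ‖v b‖ ^ 2 ≤ 2 * ‖v 0‖ ^ 2 + 2 * I ^ 2 := by
    have : ‖v b‖ ^ 2 ≤ (‖v 0‖ + I) ^ 2 := by gcongr
    nlinarith [sq_nonneg (‖v 0‖ - I)]
  calc lam * ‖v b‖ ^ 2 ≤ lam * (2 * ‖v 0‖ ^ 2 + 2 * I ^ 2) := mul_le_mul_of_nonneg_left h7 hl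
    _ = 2 * (lam * ‖v 0‖ ^ 2) + 2 * (lam * I ^ 2) := by ring
    _ ≤ 2 * (lam * ‖v 0‖ ^ 2) + 2 * (1 / ν * J) := by linarith
    _ = _ := by ring

namespace IsSolution
variable {ν : ℝ} {u₀ : Torus → ℝ} {u : ℝ → Torus → ℝ} (hu : IsSolution ν u₀ u)
include hu

/-- Continuity up to time zero bounds `u`, hence `f(u)` in `L²`. Unlike the bounds of derivatives
this holds down to `t = 0`, where the gradient bound must be proved. -/
lemma exists_sum_fourierHat_f_le (T : ℝ) : ∃ L, 0 ≤ L ∧ ∀ t ∈ Icc 0 T, ∀ K : Finset Mode,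
    ∑ k ∈ K, ‖fourierHat (fun x => f (u t x)) k‖ ^ 2 ≤ L := by
  obtain ⟨R, hR0, hR⟩ := hu.exists_bound T
  obtain ⟨M, hM⟩ := (isCompact_Icc (a := -R) (b := R)).exists_bound_of_continuousOn
    continuous_f.continuousOn
  refine ⟨(2 * Real.pi) ^ 2 * ((2 * Real.pi) ^ 2 * M ^ 2), by positivity, fun t ht K => ?_⟩
  have hc := hu.continuous_slice ht.1
  have h := parseval (memLp_of_continuous (g := fun x => f (u t x)) (by fun_prop) 2)
  refine (sum_le_hasSum K (fun k _ => sq_nonneg _) h).trans ?_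
  gcongr
  calc ∫ x, f (u t x) ^ 2 ≤ ∫ _x : Torus, M ^ 2 := by
        refine integral_mono (integrable_of_continuous (by fun_prop)) (integrable_const _) fun x => ?_
        have := hM (u t x) (abs_le.mp (hR t ht x))
        simp only
        rw [← sq_abs]
        exact pow_le_pow_left₀ (abs_nonneg _) this 2
    _ = _ := by rw [integral_const, volume_torus, smul_eq_mul]

/-- The gradient of the solution is square integrable, locally uniformly in time. -/
theorem exists_gradNormSq_le (hν : 0 < ν)
    (h0 : Summable fun k => normSq k * ‖fourierHat u₀ k‖ ^ 2) (T : ℝ) :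
    ∃ B, ∀ t ∈ Icc 0 T, gradNormSq (u t) ≤ B := by
  obtain ⟨L, hL0, hL⟩ := hu.exists_sum_fourierHat_f_le T
  set c : ℝ := 2 / ν * (ν ^ (-(1 / 2) : ℝ) * L) with hc
  have hc0 : 0 ≤ c := by positivity
  refine ⟨cT * (2 * (∑' k, normSq k * ‖fourierHat u₀ k‖ ^ 2) + c * (2 * T ^ (1 / 2 : ℝ))),
    fun t ht => mul_le_mul_of_nonneg_left ?_ cT_pos.le⟩
  have hT : (0 : ℝ) ≤ T := ht.1.trans ht.2
  have hterm : ∀ k, 0 ≤ normSq k * ‖fourierHat u₀ k‖ ^ 2 := fun k =>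
    mul_nonneg (normSq_nonneg k) (sq_nonneg _)
  have hpos : 0 ≤ 2 * (∑' k, normSq k * ‖fourierHat u₀ k‖ ^ 2) + c * (2 * T ^ (1 / 2 : ℝ)) := by
    have : 0 ≤ ∑' k, normSq k * ‖fourierHat u₀ k‖ ^ 2 := tsum_nonneg hterm
    positivity
  refine tsum_le_of_sum_le' hpos fun K => ?_
  have hsub : Icc 0 t ⊆ Ici 0 := fun s hs => hs.1
  have h1 : ∀ k, normSq k * ‖fourierHat (u t) k‖ ^ 2 ≤ 2 * (normSq k * ‖fourierHat u₀ k‖ ^ 2)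
      + 2 / ν * ∫ s in (0 : ℝ)..t, normSq k * Real.exp (-(ν * normSq k ^ 2) * (t - s))
        * ‖fourierHat (fun x => f (u s x)) k‖ ^ 2 := by
    intro k
    have := weighted_mode_le (v := fun t => fourierHat (u t) k) hν (normSq_nonneg k) ht.1
      ((hu.continuousOn_fourierHat k).mono hsub) ((hu.continuousOn_fourierHat_f k).mono hsub)
      fun s hs => hu.hasDerivAt_fourierHat k hs.1
    simpa only [hu.fourierHat_init] using this
  have hII : ∀ k, IntervalIntegrable (fun s => normSq k * Real.exp (-(ν * normSq k ^ 2) * (t - s))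
        * ‖fourierHat (fun x => f (u s x)) k‖ ^ 2) volume 0 t := by
    intro k
    refine ContinuousOn.intervalIntegrable ?_
    rw [uIcc_of_le ht.1]
    have := ((hu.continuousOn_fourierHat_f k).mono hsub)
    fun_prop
  -- The sum is moved inside the integral, where `kernel_le` is uniform in `k` and Parseval bounds
  -- the rest; `(t - s)^(-1/2)` remains to be integrated.
  have h2 : ∑ k ∈ K, ∫ s in (0 : ℝ)..t, normSq k * Real.exp (-(ν * normSq k ^ 2) * (t - s))
        * ‖fourierHat (fun x => f (u s x)) k‖ ^ 2
      ≤ ν ^ (-(1 / 2) : ℝ) * L * (2 * T ^ (1 / 2 : ℝ)) := by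
    rw [← intervalIntegral.integral_finsetSum fun k _ => hII k]
    calc _ ≤ ∫ s in (0 : ℝ)..t, ν ^ (-(1 / 2) : ℝ) * L * (t - s) ^ (-(1 / 2) : ℝ) := by
          refine intervalIntegral.integral_mono_on_of_le_Ioo ht.1
            (by simpa only [Finset.sum_fn] using IntervalIntegrable.sum K fun k _ => hII k)
            ((intervalIntegrable_sub_rpow t).const_mul _) fun s hs => ?_
          have hts : 0 < t - s := sub_pos.mpr hs.2
          calc _ ≤ ∑ k ∈ K, (ν ^ (-(1 / 2) : ℝ) * (t - s) ^ (-(1 / 2) : ℝ))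
                * ‖fourierHat (fun x => f (u s x)) k‖ ^ 2 :=
                Finset.sum_le_sum fun k _ =>
                  mul_le_mul_of_nonneg_right (kernel_le hν hts) (sq_nonneg _)
            _ = (ν ^ (-(1 / 2) : ℝ) * (t - s) ^ (-(1 / 2) : ℝ))
                * ∑ k ∈ K, ‖fourierHat (fun x => f (u s x)) k‖ ^ 2 := by rw [Finset.mul_sum]
            _ ≤ (ν ^ (-(1 / 2) : ℝ) * (t - s) ^ (-(1 / 2) : ℝ)) * L := by
                have := hL s ⟨hs.1.le, hs.2.le.trans ht.2⟩ K
                gcongr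
            _ = _ := by ring
      _ = ν ^ (-(1 / 2) : ℝ) * L * (2 * t ^ (1 / 2 : ℝ)) := by
          rw [intervalIntegral.integral_const_mul, integral_sub_rpow]
      _ ≤ _ := by
          have := Real.rpow_le_rpow ht.1 ht.2 (by norm_num : (0 : ℝ) ≤ 1 / 2)
          gcongr
  calc _ ≤ ∑ k ∈ K, (2 * (normSq k * ‖fourierHat u₀ k‖ ^ 2)
      + 2 / ν * ∫ s in (0 : ℝ)..t, normSq k * Real.exp (-(ν * normSq k ^ 2) * (t - s))
        * ‖fourierHat (fun x => f (u s x)) k‖ ^ 2) := Finset.sum_le_sum fun k _ => h1 k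
    _ = 2 * (∑ k ∈ K, normSq k * ‖fourierHat u₀ k‖ ^ 2)
      + 2 / ν * ∑ k ∈ K, ∫ s in (0 : ℝ)..t, normSq k * Real.exp (-(ν * normSq k ^ 2) * (t - s))
        * ‖fourierHat (fun x => f (u s x)) k‖ ^ 2 := by
        rw [Finset.sum_add_distrib, Finset.mul_sum, Finset.mul_sum]
    _ ≤ 2 * (∑' k, normSq k * ‖fourierHat u₀ k‖ ^ 2)
      + 2 / ν * (ν ^ (-(1 / 2) : ℝ) * L * (2 * T ^ (1 / 2 : ℝ))) := by
        have := h0.sum_le_tsum K fun k _ => hterm k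
        gcongr
    _ = _ := by rw [hc]; ring

end IsSolution

/-! ### Iterated majorants and the propagation of regularity. -/

/-- A majorant of the Fourier coefficients of `f ∘ g`, from a majorant of those of `g`. -/
def fMaj (A : Mode → ℝ) (k : Mode) : ℝ := cT * conv A (fun l => cT * conv A A l) k + A k

section FMaj
variable {A : Mode → ℝ} {σ : ℝ}

lemma fMaj_nonneg (hA0 : ∀ k, 0 ≤ A k) (k : Mode) : 0 ≤ fMaj A k :=
  add_nonneg (mul_nonneg cT_pos.le (conv_nonneg hA0
    (fun l => mul_nonneg cT_pos.le (conv_nonneg hA0 hA0 l)) k)) (hA0 k)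

lemma WSum.fMaj (hσ : 0 ≤ σ) (hA0 : ∀ k, 0 ≤ A k) (hA : WSum σ A) : WSum σ (fMaj A) :=
  ((WSum.conv hσ hA0 (fun l => mul_nonneg cT_pos.le (conv_nonneg hA0 hA0 l)) hA
    ((WSum.conv hσ hA0 hA0 hA hA).const_mul cT)).const_mul cT).add hA

lemma norm_fourierHat_f_le {g : Torus → ℝ} (hg : Continuous g) (hA : Summable A)
    (hgA : ∀ k, ‖fourierHat g k‖ ≤ A k) (k : Mode) :
    ‖fourierHat (fun x => f (g x)) k‖ ≤ fMaj A k := by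
  have hA0 : ∀ k, 0 ≤ A k := fun k => (norm_nonneg _).trans (hgA k)
  have e : (fun x => f (g x)) = fun x => g x * (g x * g x) - g x := by
    ext x; simp only [f]; ring
  rw [e, fourierHat_sub (integrable_of_continuous (by fun_prop)) (integrable_of_continuous hg)]
  refine (norm_sub_le _ _).trans (add_le_add ?_ (hgA k))
  exact norm_fourierHat_mul_le hg (hg.mul hg) hA ((summable_conv hA0 hA0 hA hA).mul_left cT) hgA
    (norm_fourierHat_mul_le hg hg hA hA hgA hgA) k

end FMaj

lemma jap_le_two_mul {k : Mode} (hk : k ≠ 0) : jap k ≤ 2 * normSq k := by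
  have := one_le_normSq hk; unfold jap; linarith

/-- Division by `ν |k|²` gains two derivatives. -/
lemma WSum.div_normSq {A : Mode → ℝ} {σ ν : ℝ} (hν : 0 < ν) (hA0 : ∀ k, 0 ≤ A k)
    (hA : WSum σ A) : WSum (σ + 1) fun k => A k / (ν * normSq k) := by
  refine Summable.of_nonneg_of_le (fun k => mul_nonneg (jap_rpow_pos _ k).le
    (div_nonneg (hA0 k) (mul_nonneg hν.le (normSq_nonneg k)))) (fun k => ?_) (hA.mul_left (2 / ν))
  have h0 : 0 ≤ jap k ^ σ * A k := mul_nonneg (jap_rpow_pos _ k).le (hA0 k)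
  by_cases hk : k = 0
  · have : A k / (ν * normSq k) = 0 := by simp [hk]
    beta_reduce
    rw [this, mul_zero]; positivity
  · have hl := normSq_pos hk
    beta_reduce
    rw [Real.rpow_add (jap_pos k), Real.rpow_one]
    calc jap k ^ σ * jap k * (A k / (ν * normSq k))
        = (jap k ^ σ * A k) * (jap k / (ν * normSq k)) := by ring
      _ ≤ (jap k ^ σ * A k) * (2 / ν) := by
          refine mul_le_mul_of_nonneg_left ?_ h0
          rw [div_le_div_iff₀ (by positivity) hν]
          nlinarith [jap_le_two_mul hk]
      _ = _ := by ring

/-- The majorants of the Fourier coefficients of a solution with the initial coefficients bounded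
by `a`, obtained by iterating the variation of constants formula. -/
def iterMaj (ν D : ℝ) (a : Mode → ℝ) : ℕ → Mode → ℝ
  | 0, k => a k + Real.sqrt (D / normSq k) / (ν * normSq k)
  | n + 1, k => a k + fMaj (iterMaj ν D a n) k / (ν * normSq k)

section IterMaj
variable {ν D : ℝ} {a : Mode → ℝ}

lemma iterMaj_nonneg (hν : 0 < ν) (ha : ∀ k, 0 ≤ a k) (n : ℕ) (k : Mode) :
    0 ≤ iterMaj ν D a n k := by
  induction n generalizing k with
  | zero => exact add_nonneg (ha k) (div_nonneg (Real.sqrt_nonneg _)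
      (mul_nonneg hν.le (normSq_nonneg k)))
  | succ n ih => exact add_nonneg (ha k) (div_nonneg (fMaj_nonneg ih k)
      (mul_nonneg hν.le (normSq_nonneg k)))

/-- The starting majorant adds a multiple of `|k|⁻³` to the data: one power from the gradient of
`f(u)`, two from Duhamel. The exponent three exceeds the dimension. -/
lemma summable_iterMaj_zero (hν : 0 < ν) (hD : 0 ≤ D) (ha : Summable a) :
    Summable (iterMaj ν D a 0) := by
  refine ha.add ?_
  have h := summable_jap_rpow (σ := 3 / 2) (by norm_num)
  refine Summable.of_nonneg_of_le (fun k => div_nonneg (Real.sqrt_nonneg _)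
      (mul_nonneg hν.le (normSq_nonneg k))) (fun k => ?_)
      (h.mul_left (Real.sqrt D / ν * 2 ^ (3 / 2 : ℝ)))
  by_cases hk : k = 0
  · have : Real.sqrt (D / normSq k) / (ν * normSq k) = 0 := by simp [hk]
    rw [this]
    have := jap_rpow_pos (-(3 / 2)) k
    positivity
  · have hl := normSq_pos hk
    have e1 : Real.sqrt (D / normSq k) / (ν * normSq k)
        = Real.sqrt D / ν * normSq k ^ (-(3 / 2) : ℝ) := by
      rw [Real.sqrt_div hD, Real.rpow_neg hl.le,
        show (3 / 2 : ℝ) = 1 / 2 + 1 by norm_num, Real.rpow_add hl, ← Real.sqrt_eq_rpow,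
        Real.rpow_one]
      have := Real.sqrt_pos.mpr hl
      field_simp
    have e2 : normSq k ^ (-(3 / 2) : ℝ) ≤ 2 ^ (3 / 2 : ℝ) * jap k ^ (-(3 / 2) : ℝ) := by
      have h2 := Real.rpow_le_rpow_of_nonpos (jap_pos k) (jap_le_two_mul hk)
        (by norm_num : (-(3 / 2) : ℝ) ≤ 0)
      rw [Real.mul_rpow (by norm_num) hl.le] at h2
      have h3 : (2 : ℝ) ^ (3 / 2 : ℝ) * 2 ^ (-(3 / 2) : ℝ) = 1 := by
        rw [← Real.rpow_add (by norm_num)]; norm_num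
      calc normSq k ^ (-(3 / 2) : ℝ)
          = 2 ^ (3 / 2 : ℝ) * (2 ^ (-(3 / 2) : ℝ) * normSq k ^ (-(3 / 2) : ℝ)) := by
            rw [← mul_assoc, h3, one_mul]
        _ ≤ _ := by gcongr
    rw [e1, mul_assoc]
    gcongr

/-- `fMaj` preserves the weight and the division by `ν|k|²` raises its exponent by one, until the
regularity `ρ` of the data is reached. -/
lemma wsum_iterMaj (hν : 0 < ν) (hD : 0 ≤ D) (ha0 : ∀ k, 0 ≤ a k) {ρ : ℝ} (hρ : 0 ≤ ρ)
    (ha : WSum ρ a) (n : ℕ) : WSum (min n ρ) (iterMaj ν D a n) := by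
  induction n with
  | zero =>
    rw [Nat.cast_zero, min_eq_left hρ]
    exact (summable_iterMaj_zero hν hD (ha.summable ha0 hρ)).wsum
  | succ n ih =>
    have h0 := iterMaj_nonneg (D := D) hν ha0 n
    have h1 := (WSum.fMaj (le_min (Nat.cast_nonneg n) hρ) h0 ih).div_normSq hν (fMaj_nonneg h0)
    refine (ha.mono ha0 (min_le_right _ _)).add (h1.mono (fun k => div_nonneg (fMaj_nonneg h0 k)
      (mul_nonneg hν.le (normSq_nonneg k))) ?_)
    push_cast
    rcases min_cases (n : ℝ) ρ with h | h
    · rw [h.1]; exact min_le_left _ _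
    · rw [h.1]; exact (min_le_right _ _).trans (by linarith)

end IterMaj

section Sobolev
variable {s : ℝ} {g : Torus → ℝ}

lemma MemSobolev.summable_jap (hs : 0 ≤ s) (hg : MemSobolev s g) :
    Summable fun k => jap k ^ s * ‖fourierHat g k‖ ^ 2 := by
  refine Summable.of_nonneg_of_le (fun k => mul_nonneg (jap_rpow_pos _ k).le (sq_nonneg _))
    (fun k => ?_) (hg.2.mul_left (2 ^ s))
  rw [← mul_assoc]
  refine mul_le_mul_of_nonneg_right ?_ (sq_nonneg _)
  have h1 : jap k ≤ 2 * max 1 (normSq k) := by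
    have h1 := le_max_left 1 (normSq k)
    have h2 := le_max_right 1 (normSq k)
    unfold jap; linarith
  calc jap k ^ s ≤ (2 * max 1 (normSq k)) ^ s := Real.rpow_le_rpow (jap_pos k).le h1 hs
    _ = 2 ^ s * (max 1 (normSq k)) ^ s :=
        Real.mul_rpow (by norm_num) (le_max_of_le_left zero_le_one)
    _ ≤ 2 ^ s * (1 + normSq k ^ s) := by
        gcongr
        have := Real.rpow_nonneg (normSq_nonneg k) s
        rcases max_choice 1 (normSq k) with h | h <;> rw [h]
        · rw [Real.one_rpow]; linarith
        · linarith

/-- Split the weight as `jap^(s/2) · jap⁻¹` and use `xy ≤ x² + y²`; the sum of `jap⁻²` converges.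
The passage from square sums to sums costs one power of the weight. -/
lemma wsum_of_summable_sq {a : Mode → ℝ} (ha0 : ∀ k, 0 ≤ a k)
    (ha : Summable fun k => jap k ^ s * a k ^ 2) : WSum ((s - 2) / 2) a := by
  refine Summable.of_nonneg_of_le (fun k => mul_nonneg (jap_rpow_pos _ k).le (ha0 k))
    (fun k => ?_) (ha.add (summable_jap_rpow (σ := 2) (by norm_num)))
  have e0 : jap k ^ ((s - 2) / 2) = jap k ^ (s / 2) * jap k ^ (-1 : ℝ) := by
    rw [← Real.rpow_add (jap_pos k)]; congr 1; ring
  have e1 : jap k ^ s = jap k ^ (s / 2) * jap k ^ (s / 2) := by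
    rw [← Real.rpow_add (jap_pos k)]; congr 1; ring
  have e2 : jap k ^ (-2 : ℝ) = jap k ^ (-1 : ℝ) * jap k ^ (-1 : ℝ) := by
    rw [← Real.rpow_add (jap_pos k)]; congr 1; ring
  rw [e0, e1, e2]
  have p := jap_rpow_pos (s / 2) k
  have q := jap_rpow_pos (-1) k
  nlinarith [sq_nonneg (jap k ^ (s / 2) * a k - jap k ^ (-1 : ℝ)),
    mul_nonneg (mul_nonneg p.le (ha0 k)) q.le]

lemma WSum.summable_sq {a : Mode → ℝ} (ha0 : ∀ k, 0 ≤ a k) (ha : WSum (s / 2) a) :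
    Summable fun k => jap k ^ s * a k ^ 2 := by
  refine (summable_sq_of_summable (fun k => mul_nonneg (jap_rpow_pos _ k).le (ha0 k)) ha).congr
    fun k => ?_
  have e1 : jap k ^ s = jap k ^ (s / 2) * jap k ^ (s / 2) := by
    rw [← Real.rpow_add (jap_pos k)]; congr 1; ring
  rw [e1]; ring

/-- One extra Duhamel step recovers the power lost in `wsum_of_summable_sq`, as `(s - 2)/2 + 1 =
s/2`, and the data term is square summable by assumption. So the full `H^s` regularity survives,
which gives the rate `N^{-s}` without loss. -/
lemma summable_jap_iterMaj {ν D : ℝ} {a : Mode → ℝ} (hν : 0 < ν) (hD : 0 ≤ D)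
    (ha0 : ∀ k, 0 ≤ a k) (hs : 2 ≤ s) (ha : Summable fun k => jap k ^ s * a k ^ 2) {n : ℕ}
    (hn : (s - 2) / 2 ≤ n) : Summable fun k => jap k ^ s * iterMaj ν D a (n + 1) k ^ 2 := by
  have hρ : 0 ≤ (s - 2) / 2 := by linarith
  have h0 := iterMaj_nonneg (D := D) hν ha0 n
  have h1 := wsum_iterMaj (n := n) hν hD ha0 hρ (wsum_of_summable_sq ha0 ha)
  rw [min_eq_right hn] at h1
  have h2 := (WSum.fMaj hρ h0 h1).div_normSq hν (fMaj_nonneg h0)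
  have h2' : ∀ k, 0 ≤ fMaj (iterMaj ν D a n) k / (ν * normSq k) := fun k =>
    div_nonneg (fMaj_nonneg h0 k) (mul_nonneg hν.le (normSq_nonneg k))
  rw [show (s - 2) / 2 + 1 = s / 2 by ring] at h2
  have h3 := h2.summable_sq h2'
  refine Summable.of_nonneg_of_le (fun k => mul_nonneg (jap_rpow_pos _ k).le (sq_nonneg _))
    (fun k => ?_) ((ha.add h3).mul_left 2)
  have p := jap_rpow_pos s k
  simp only [iterMaj]
  nlinarith [mul_nonneg p.le (sq_nonneg (a k - fMaj (iterMaj ν D a n) k / (ν * normSq k)))]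

end Sobolev

/-- The constant in the bound of `|k|² |ĝ(k)|²`, `g = f(u)`, for states of energy at most `e`. -/
def fluxConst (ν e : ℝ) : ℝ := (72 * e + 8 * (2 * Real.pi) ^ 2) * (2 * e / ν)

lemma normSq_mul_fourierHat_f_le_of_energy {ν e : ℝ} (hν : 0 < ν) {g : Torus → ℝ}
    (hg : ContDiff ℝ 1 (lift g)) (he : energy ν g ≤ e) (k : Mode) :
    normSq k * ‖fourierHat (fun x => f (g x)) k‖ ^ 2 ≤ fluxConst ν e := by
  refine (normSq_mul_fourierHat_f_le hg k).trans ?_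
  have h1 := gradNormSq_nonneg g
  have h2 : 0 ≤ ∫ x, F (g x) := integral_nonneg fun x => F_nonneg _
  unfold energy at he
  have h3 : 0 ≤ ν / 2 * gradNormSq g := by positivity
  unfold fluxConst
  refine mul_le_mul (by linarith) ?_ h1 (by nlinarith [sq_nonneg (2 * Real.pi)])
  rw [le_div_iff₀ hν]
  linarith

namespace IsSolution
variable {ν : ℝ} {u₀ : Torus → ℝ} {u : ℝ → Torus → ℝ} (hu : IsSolution ν u₀ u)
include hu

/-- A bound of the energy on a time interval provides the majorants there. -/
theorem norm_fourierHat_le_iterMaj (hν : 0 < ν) (ha : Summable fun k => ‖fourierHat u₀ k‖)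
    {D T : ℝ} (hD : 0 ≤ D)
    (hT : ∀ t ∈ Ioc 0 T, ∀ k, normSq k * ‖fourierHat (fun x => f (u t x)) k‖ ^ 2 ≤ D)
    (n : ℕ) {t : ℝ} (ht : t ∈ Icc 0 T) (k : Mode) :
    ‖fourierHat (u t) k‖ ≤ iterMaj ν D (fun k => ‖fourierHat u₀ k‖) n k := by
  have ha0 : ∀ k, 0 ≤ ‖fourierHat u₀ k‖ := fun k => norm_nonneg _
  induction n generalizing t k with
  | zero =>
    by_cases hk : k = 0
    · obtain ⟨L, hL0, hL⟩ := hu.exists_sum_fourierHat_f_le T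
      -- Any finite bound of the zero coefficient of `f(u)` will do, since it is then divided by `ν
      -- · 0`.
      have := hu.norm_fourierHat_le_of_bound hν k (P := Real.sqrt L) (Real.sqrt_nonneg _)
        (fun s hs => by
          have := hL s ⟨hs.1.le, hs.2⟩ {k}
          rw [Finset.sum_singleton] at this
          exact Real.le_sqrt_of_sq_le this) ht
      simpa [hk, iterMaj] using this
    · refine hu.norm_fourierHat_le_of_bound hν k (Real.sqrt_nonneg _) (fun s hs => ?_) ht
      refine Real.le_sqrt_of_sq_le ?_
      rw [le_div_iff₀ (normSq_pos hk), mul_comm]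
      exact hT s hs k
  | succ n ih =>
    have h0 := iterMaj_nonneg (D := D) hν ha0 n
    refine hu.norm_fourierHat_le_of_bound hν k (fMaj_nonneg h0 k) (fun s hs => ?_) ht
    have h1 := wsum_iterMaj (n := n) hν hD ha0 le_rfl ha.wsum
    exact norm_fourierHat_f_le (hu.continuous_slice hs.1.le)
      (h1.summable h0 (le_min (Nat.cast_nonneg n) le_rfl)) (ih ⟨hs.1.le, hs.2⟩) k

end IsSolution

/-! ### Decay of the energy and majorants uniform in time. -/

/-- A majorant of the Fourier coefficients of the time derivative of a solution. -/
def rateMaj (ν : ℝ) (A : Mode → ℝ) (k : Mode) : ℝ := jap k * (ν * (jap k * A k) + fMaj A k)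

section RateMaj
variable {ν σ : ℝ} {A : Mode → ℝ}

lemma rateMaj_nonneg (hν : 0 < ν) (hA0 : ∀ k, 0 ≤ A k) (k : Mode) : 0 ≤ rateMaj ν A k :=
  mul_nonneg (jap_pos k).le (add_nonneg (mul_nonneg hν.le (mul_nonneg (jap_pos k).le (hA0 k)))
    (fMaj_nonneg hA0 k))

lemma WSum.jap_mul_one {σ : ℝ} {A : Mode → ℝ} (hA : WSum (σ + 1) A) :
    WSum σ fun k => jap k * A k := by
  simpa only [Real.rpow_one] using hA.jap_mul (ρ := 1)

lemma WSum.rateMaj (hσ : 0 ≤ σ) (hA0 : ∀ k, 0 ≤ A k) (hA : WSum (σ + 2) A) :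
    WSum σ (rateMaj ν A) := by
  rw [show σ + 2 = σ + 1 + 1 by ring] at hA
  have h1 : WSum (σ + 1) fun k => jap k * A k := WSum.jap_mul_one hA
  have h2 : WSum (σ + 1) (CahnHilliard.fMaj A) := WSum.fMaj (by linarith) hA0 (hA.mono hA0 (by linarith))
  exact WSum.jap_mul_one ((h1.const_mul ν).add h2)

lemma norm_rate_le (hν : 0 < ν) {v φ : ℂ} {k : Mode} (hv : ‖v‖ ≤ A k) (hφ : ‖φ‖ ≤ fMaj A k) :
    ‖-(normSq k : ℂ) * (ν * (normSq k : ℝ) * v + φ)‖ ≤ rateMaj ν A k := by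
  have hl := normSq_nonneg k
  have hj : normSq k ≤ jap k := by unfold jap; linarith
  rw [norm_mul, norm_neg, Complex.norm_real, Real.norm_of_nonneg hl]
  unfold rateMaj
  refine mul_le_mul hj ((norm_add_le _ _).trans (add_le_add ?_ hφ)) (norm_nonneg _) (jap_pos k).le
  rw [norm_mul, norm_mul, Complex.norm_real, Complex.norm_real, Real.norm_of_nonneg hν.le,
    Real.norm_of_nonneg hl, mul_assoc]
  have := norm_nonneg v
  have := jap_pos k
  gcongr

end RateMaj

namespace IsSolution
variable {ν : ℝ} {u₀ : Torus → ℝ} {u : ℝ → Torus → ℝ} (hu : IsSolution ν u₀ u)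
include hu

lemma energy_init : energy ν (u 0) = energy ν u₀ := by
  unfold energy gradNormSq
  simp only [hu.fourierHat_init]
  congr 1
  refine integral_congr_ae ?_
  filter_upwards [hu.init] with x hx
  rw [hx]

lemma hasDerivAt_integral_F {t : ℝ} (ht : 0 < t) :
    HasDerivAt (fun t => ∫ x, F (u t x)) (∫ x, f (u t x) * lap (potential ν (u t)) x) t := by
  have h := hu.hasDerivAt_integral (χ := fun _ => 1) continuous_const hasDerivAt_F continuous_f ht
  have h2 := Complex.reCLM.hasFDerivAt.comp_hasDerivAt t h
  simp only [one_mul, integral_complex_ofReal] at h2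
  simpa [Function.comp_def] using h2

lemma continuousOn_integral_F : ContinuousOn (fun t => ∫ x, F (u t x)) (Ici 0) := by
  have h := hu.continuousOn_integral (χ := fun _ => 1) continuous_const continuous_F
  have h2 := Complex.continuous_re.comp_continuousOn h
  simp only [one_mul, integral_complex_ofReal] at h2
  simpa [Function.comp_def] using h2

/-- The energy decreases, given majorants of the Fourier coefficients. -/
theorem energy_le_of_majorant (hν : 0 < ν) {T : ℝ} {A : Mode → ℝ} (hA : WSum 4 A)
    (hA0 : ∀ k, 0 ≤ A k) (hT : ∀ t ∈ Icc 0 T, ∀ k, ‖fourierHat (u t) k‖ ≤ A k)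
    {t : ℝ} (ht : t ∈ Icc 0 T) : energy ν (u t) ≤ energy ν u₀ := by
  have hAs : Summable A := hA.summable hA0 (by norm_num)
  have hB0 := rateMaj_nonneg (ν := ν) hν hA0
  have hB : WSum 2 (rateMaj ν A) := WSum.rateMaj (by norm_num) hA0 (by norm_num; exact hA)
  have hJA : Summable fun k => jap k * A k :=
    (WSum.jap_mul_one (σ := 0) (hA.mono hA0 (by norm_num))).summable
      (fun k => mul_nonneg (jap_pos k).le (hA0 k)) le_rfl
  have hJB : Summable fun k => jap k * rateMaj ν A k :=
    (WSum.jap_mul_one (σ := 0) (hB.mono hB0 (by norm_num))).summable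
      (fun k => mul_nonneg (jap_pos k).le (hB0 k)) le_rfl
  have hAle : ∀ k, A k ≤ ∑' l, A l := fun k => hAs.le_tsum k fun l _ => hA0 l
  have hlj : ∀ k, normSq k ≤ jap k := fun k => by unfold jap; linarith
  have hterm : ∀ s ∈ Icc 0 T, ∀ k, ‖normSq k * ‖fourierHat (u s) k‖ ^ 2‖
      ≤ (∑' l, A l) * (jap k * A k) := by
    intro s hs k
    have h1 := hT s hs k
    have h2 := norm_nonneg (fourierHat (u s) k)
    rw [Real.norm_of_nonneg (mul_nonneg (normSq_nonneg k) (sq_nonneg _)), sq]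
    calc normSq k * (‖fourierHat (u s) k‖ * ‖fourierHat (u s) k‖)
        ≤ jap k * ((∑' l, A l) * A k) :=
          mul_le_mul (hlj k) (mul_le_mul (h1.trans (hAle k)) h1 h2 (h2.trans (h1.trans (hAle k))))
            (mul_nonneg h2 h2) (jap_pos k).le
      _ = _ := by ring
  -- Continuity on the closed interval is what connects the energy at positive times with that of
  -- the data.
  have hcont : ContinuousOn (fun s => energy ν (u s)) (Icc 0 T) := by
    have h1 : ContinuousOn (fun s => ∑' k, normSq k * ‖fourierHat (u s) k‖ ^ 2) (Icc 0 T) := by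
      refine continuousOn_tsum (fun k => ?_) (hJA.mul_left (∑' l, A l)) fun k s hs => hterm s hs k
      have := (hu.continuousOn_fourierHat k).mono (fun s (hs : s ∈ Icc 0 T) => hs.1)
      fun_prop
    have h2 := hu.continuousOn_integral_F.mono (fun s (hs : s ∈ Icc 0 T) => hs.1)
    unfold energy gradNormSq
    fun_prop
  have hderiv : ∀ s ∈ Ioo 0 T, ∃ d, d ≤ 0 ∧ HasDerivAt (fun s => energy ν (u s)) d s := by
    intro s hs
    set r : ℝ → Mode → ℂ := fun s k => -(normSq k : ℂ) * (ν * (normSq k : ℝ) *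
      fourierHat (u s) k + fourierHat (fun x => f (u s x)) k) with hr
    have hrle : ∀ s ∈ Ioo 0 T, ∀ k, ‖r s k‖ ≤ rateMaj ν A k := fun s hs k =>
      norm_rate_le hν (hT s ⟨hs.1.le, hs.2.le⟩ k) (norm_fourierHat_f_le
        (hu.continuous_slice hs.1.le) hAs (hT s ⟨hs.1.le, hs.2.le⟩) k)
    have h1 : HasDerivAt (fun s => ∑' k, normSq k * ‖fourierHat (u s) k‖ ^ 2)
        (∑' k, normSq k * (2 * inner ℝ (fourierHat (u s) k) (r s k))) s := by
      refine hasDerivAt_tsum_of_isPreconnected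
        (g := fun k s => normSq k * ‖fourierHat (u s) k‖ ^ 2)
        (g' := fun k s => normSq k * (2 * inner ℝ (fourierHat (u s) k) (r s k)))
        (hJB.mul_left (2 * ∑' l, A l)) isOpen_Ioo isPreconnected_Ioo (fun k s hs => ?_)
        (fun k s hs => ?_) hs ?_ hs
      · exact ((hu.hasDerivAt_fourierHat k hs.1).norm_sq).const_mul _
      · have a1 := (hT s ⟨hs.1.le, hs.2.le⟩ k).trans (hAle k)
        have a2 := hrle s hs k
        have a3 := abs_real_inner_le_norm (fourierHat (u s) k) (r s k)
        rw [norm_mul, norm_mul, Real.norm_of_nonneg (normSq_nonneg k), Real.norm_eq_abs 2,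
          Real.norm_eq_abs, abs_of_pos (by norm_num : (0 : ℝ) < 2)]
        have a4 : |inner ℝ (fourierHat (u s) k) (r s k)| ≤ (∑' l, A l) * rateMaj ν A k :=
          a3.trans (mul_le_mul a1 a2 (norm_nonneg _) ((norm_nonneg _).trans a1))
        calc normSq k * (2 * |inner ℝ (fourierHat (u s) k) (r s k)|)
            ≤ jap k * (2 * ((∑' l, A l) * rateMaj ν A k)) :=
              mul_le_mul (hlj k) (by linarith) (by positivity) (jap_pos k).le
          _ = _ := by ring
      · exact Summable.of_norm_bounded (hJA.mul_left (∑' l, A l))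
          fun k => hterm s ⟨hs.1.le, hs.2.le⟩ k
    have hsum1 : Summable fun k => normSq k * (2 * inner ℝ (fourierHat (u s) k) (r s k)) := by
      refine Summable.of_norm_bounded (hJB.mul_left (2 * ∑' l, A l)) fun k => ?_
      have a1 := (hT s ⟨hs.1.le, hs.2.le⟩ k).trans (hAle k)
      have a2 := hrle s hs k
      have a3 := abs_real_inner_le_norm (fourierHat (u s) k) (r s k)
      rw [norm_mul, norm_mul, Real.norm_of_nonneg (normSq_nonneg k), Real.norm_eq_abs 2,
        Real.norm_eq_abs, abs_of_pos (by norm_num : (0 : ℝ) < 2)]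
      have a4 : |inner ℝ (fourierHat (u s) k) (r s k)| ≤ (∑' l, A l) * rateMaj ν A k :=
        a3.trans (mul_le_mul a1 a2 (norm_nonneg _) ((norm_nonneg _).trans a1))
      calc normSq k * (2 * |inner ℝ (fourierHat (u s) k) (r s k)|)
          ≤ jap k * (2 * ((∑' l, A l) * rateMaj ν A k)) :=
            mul_le_mul (hlj k) (by linarith) (by positivity) (jap_pos k).le
        _ = _ := by ring
    have h2 := hu.hasDerivAt_integral_F hs.1
    have hC := hu.contDiff s hs.1
    have hus := hu.continuous_slice hs.1.le
    have hw := continuous_lap (contDiff_lift_potential (ν := ν) hC)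
    have h3 := Complex.hasSum_re (parseval_inner
      (memLp_of_continuous (g := fun x => f (u s x)) (by fun_prop) 2)
      (memLp_of_continuous hw 2))
    simp only [fourierHat_lap_potential hC, Complex.ofReal_re] at h3
    refine ⟨_, ?_, ((h1.const_mul cT).const_mul (ν / 2)).add h2⟩
    have h4 : ∫ x, f (u s x) * lap (potential ν (u s)) x
        = cT * ∑' k, (conj (fourierHat (fun x => f (u s x)) k) * r s k).re := by
      rw [h3.tsum_eq, ← mul_assoc, cT_mul, one_mul]
    rw [h4, ← mul_assoc, mul_comm (ν / 2) cT, mul_assoc, ← tsum_mul_left, ← mul_add,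
      ← (hsum1.mul_left (ν / 2)).tsum_add h3.summable]
    refine mul_nonpos_of_nonneg_of_nonpos cT_pos.le (tsum_nonpos fun k => ?_)
    set v := fourierHat (u s) k
    set φ := fourierHat (fun x => f (u s x)) k
    -- With `z = ν|k|²v + φ` the time derivative of the mode is `-|k|² z`, and both contributions
    -- combine to the real part of `z̄ · (-|k|² z)`.
    have h5 : ν / 2 * (normSq k * (2 * inner ℝ v (r s k))) + (conj φ * r s k).re
        = -normSq k * Complex.normSq (ν * (normSq k : ℝ) * v + φ) := by
      rw [Complex.inner, hr]
      simp only [Complex.normSq_apply, Complex.mul_re, Complex.mul_im, Complex.neg_re,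
        Complex.neg_im, Complex.add_re, Complex.add_im, Complex.ofReal_re, Complex.ofReal_im,
        Complex.conj_re, Complex.conj_im]
      ring
    rw [h5]
    have := mul_nonneg (normSq_nonneg k) (Complex.normSq_nonneg (ν * (normSq k : ℝ) * v + φ))
    linarith
  have hanti : AntitoneOn (fun s => energy ν (u s)) (Icc 0 T) := by
    refine antitoneOn_of_deriv_nonpos (convex_Icc 0 T) hcont ?_ ?_
    · rw [interior_Icc]
      intro s hs
      obtain ⟨d, -, hd⟩ := hderiv s hs
      exact hd.differentiableAt.differentiableWithinAt
    · rw [interior_Icc]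
      intro s hs
      obtain ⟨d, hd0, hd⟩ := hderiv s hs
      rwa [hd.deriv]
  rw [← hu.energy_init]
  exact hanti ⟨le_rfl, ht.1.trans ht.2⟩ ht ht.1

end IsSolution

lemma energy_nonneg {ν : ℝ} (hν : 0 < ν) (g : Torus → ℝ) : 0 ≤ energy ν g := by
  have h1 := gradNormSq_nonneg g
  have h2 : 0 ≤ ∫ x, F (g x) := integral_nonneg fun x => F_nonneg _
  unfold energy; positivity

lemma fluxConst_nonneg {ν e : ℝ} (hν : 0 < ν) (he : 0 ≤ e) : 0 ≤ fluxConst ν e := by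
  unfold fluxConst; positivity

/-- Here `(10 - 2)/2 = 4`. The error analysis uses all of it: two powers pay for `∂ₜu` and two for
the factor `|k|⁴` of the stabilisation. -/
lemma MemSobolev.wsum {u₀ : Torus → ℝ} (h : MemSobolev 10 u₀) :
    WSum 4 fun k => ‖fourierHat u₀ k‖ := by
  have := wsum_of_summable_sq (fun k => norm_nonneg _) (h.summable_jap (by norm_num))
  norm_num at this
  exact this

namespace IsSolution
variable {ν : ℝ} {u₀ : Torus → ℝ} {u : ℝ → Torus → ℝ} (hu : IsSolution ν u₀ u)
include hu

theorem energy_le (hν : 0 < ν) (h0 : MemSobolev 10 u₀) {t : ℝ} (ht : 0 ≤ t) :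
    energy ν (u t) ≤ energy ν u₀ := by
  have hw := h0.wsum
  have ha0 : ∀ k, 0 ≤ ‖fourierHat u₀ k‖ := fun k => norm_nonneg _
  have hgrad : Summable fun k => normSq k * ‖fourierHat u₀ k‖ ^ 2 := by
    refine Summable.of_nonneg_of_le (fun k => mul_nonneg (normSq_nonneg k) (sq_nonneg _))
      (fun k => mul_le_mul_of_nonneg_right ?_ (sq_nonneg _)) (h0.summable_jap (by norm_num))
    have h1 := Real.rpow_le_rpow_of_exponent_le (one_le_jap k) (by norm_num : (1 : ℝ) ≤ 10)
    rw [Real.rpow_one] at h1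
    exact le_trans (by unfold jap; linarith) h1
  -- Provisional bounds that may depend on `t`. They only supply some majorant on `[0, t]`, good
  -- enough to justify the energy identity; the constants disappear from the conclusion, so there is
  -- no circularity.
  obtain ⟨B, hB⟩ := hu.exists_gradNormSq_le hν hgrad t
  obtain ⟨C, hC⟩ := (isCompact_Icc (a := 0) (b := t)).exists_bound_of_continuousOn
    (hu.continuousOn_integral_F.mono fun s hs => hs.1)
  have hflux : ∀ s ∈ Ioc 0 t, ∀ k,
      normSq k * ‖fourierHat (fun x => f (u s x)) k‖ ^ 2 ≤ fluxConst ν (ν / 2 * B + C) := by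
    intro s hs k
    refine normSq_mul_fourierHat_f_le_of_energy hν
      ((hu.contDiff s hs.1).of_le (by norm_num)) (add_le_add ?_ ?_) k
    · have := hB s ⟨hs.1.le, hs.2⟩
      gcongr
    · exact (le_abs_self _).trans (hC s ⟨hs.1.le, hs.2⟩)
  have hD : 0 ≤ fluxConst ν (ν / 2 * B + C) := by
    refine fluxConst_nonneg hν (add_nonneg (mul_nonneg (by positivity) ?_) ?_)
    · exact (gradNormSq_nonneg _).trans (hB 0 ⟨le_rfl, ht⟩)
    · exact (norm_nonneg _).trans (hC 0 ⟨le_rfl, ht⟩)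
  have hA := wsum_iterMaj hν hD ha0 (by norm_num) hw 4
  norm_num at hA
  exact hu.energy_le_of_majorant hν hA (iterMaj_nonneg hν ha0 4)
    (fun s hs k => hu.norm_fourierHat_le_iterMaj hν (hw.summable ha0 (by norm_num)) hD hflux 4 hs k)
    ⟨ht, le_rfl⟩

/-- Majorants of the Fourier coefficients of the solution that are uniform in time. -/
theorem norm_fourierHat_le (hν : 0 < ν) (h0 : MemSobolev 10 u₀) (n : ℕ) {t : ℝ} (ht : 0 ≤ t)
    (k : Mode) : ‖fourierHat (u t) k‖
      ≤ iterMaj ν (fluxConst ν (energy ν u₀)) (fun k => ‖fourierHat u₀ k‖) n k :=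
  hu.norm_fourierHat_le_iterMaj hν (h0.wsum.summable (fun k => norm_nonneg _) (by norm_num))
    (fluxConst_nonneg hν (energy_nonneg hν u₀)) (T := t)
    (fun s hs k => normSq_mul_fourierHat_f_le_of_energy hν
      ((hu.contDiff s hs.1).of_le (by norm_num)) (hu.energy_le hν h0 hs.1.le) k) n ⟨ht, le_rfl⟩ k

end IsSolution

/-! ### The embedding of `H¹` into `L⁴` by convolutions. -/

section Embedding

lemma tsum_conv {A B : Mode → ℝ} (hA0 : ∀ k, 0 ≤ A k) (hB0 : ∀ k, 0 ≤ B k) (hA : Summable A)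
    (hB : Summable B) : ∑' k, conv A B k = (∑' k, A k) * ∑' k, B k := by
  have h := hA.mul_of_nonneg hB hA0 hB0
  have h2 := summable_conv_pairs hA0 hB0 hA hB
  have e1 : ∑' k, conv A B k = ∑' p : Mode × Mode, A p.2 * B (p.1 - p.2) := h2.tsum_prod.symm
  rw [e1, hA.tsum_mul_tsum hB h]
  exact pairEquiv.tsum_eq (fun x : Mode × Mode => A x.1 * B x.2)

lemma tsum_sq_le {z X Y : Mode → ℝ} (hz0 : ∀ k, 0 ≤ z k) (hX0 : ∀ k, 0 ≤ X k)
    (hY0 : ∀ k, 0 ≤ Y k) (hX : Summable X) (hY : Summable Y) (h : ∀ k, z k ^ 2 = X k * Y k) :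
    (∑' k, z k) ^ 2 ≤ (∑' k, X k) * ∑' k, Y k := by
  have hXs : 0 ≤ ∑' k, X k := tsum_nonneg hX0
  have hYs : 0 ≤ ∑' k, Y k := tsum_nonneg hY0
  have h1 : ∑' k, z k ≤ Real.sqrt ((∑' k, X k) * ∑' k, Y k) := by
    refine tsum_le_of_sum_le' (Real.sqrt_nonneg _) fun K => Real.le_sqrt_of_sq_le ?_
    refine (Finset.sum_sq_le_sum_mul_sum_of_sq_le_mul K (fun k _ => hX0 k) (fun k _ => hY0 k)
      fun k _ => (h k).le).trans ?_
    exact mul_le_mul (hX.sum_le_tsum K fun k _ => hX0 k) (hY.sum_le_tsum K fun k _ => hY0 k)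
      (Finset.sum_nonneg fun k _ => hY0 k) hXs
  calc (∑' k, z k) ^ 2 ≤ Real.sqrt ((∑' k, X k) * ∑' k, Y k) ^ 2 :=
        pow_le_pow_left₀ (tsum_nonneg hz0) h1 2
    _ = _ := Real.sq_sqrt (mul_nonneg hXs hYs)

/-- `∑ (1 + |k|²)⁻²` -/
def japSum : ℝ := ∑' k : Mode, jap k ^ (-2 : ℝ)

/-- Cauchy–Schwarz after inserting the weights `jap l` and `jap (k - l)`. The remaining sum of
`1/(jap l · jap (k - l))` is at most `japSum` by the inequality between geometric and arithmetic
means. Summed over `k`, this bounds the `L²` norm of `g²`. -/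
lemma conv_sq_le {A : Mode → ℝ} (hA0 : ∀ k, 0 ≤ A k) (hA : Summable fun k => jap k * A k ^ 2)
    (k : Mode) : conv A A k ^ 2
      ≤ conv (fun l => jap l * A l ^ 2) (fun l => jap l * A l ^ 2) k * japSum := by
  have hP0 : ∀ k, 0 ≤ jap k * A k ^ 2 := fun k => mul_nonneg (jap_pos k).le (sq_nonneg _)
  have hJ := summable_jap_rpow (σ := 2) (by norm_num)
  have hJ' : Summable fun l => jap (k - l) ^ (-2 : ℝ) :=
    (Equiv.subLeft k).summable_iff (f := fun l => jap l ^ (-2 : ℝ)) |>.mpr hJ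
  have e2 : ∀ l, jap l ^ (-2 : ℝ) = (jap l)⁻¹ ^ 2 := fun l => by
    rw [Real.rpow_neg (jap_pos l).le, inv_pow]; norm_cast
  have hYle : ∀ l, (jap l)⁻¹ * (jap (k - l))⁻¹
      ≤ 1 / 2 * (jap l ^ (-2 : ℝ) + jap (k - l) ^ (-2 : ℝ)) := fun l => by
    rw [e2, e2]; nlinarith [sq_nonneg ((jap l)⁻¹ - (jap (k - l))⁻¹)]
  have hY0 : ∀ l, 0 ≤ (jap l)⁻¹ * (jap (k - l))⁻¹ := fun l =>
    mul_nonneg (inv_nonneg.mpr (jap_pos l).le) (inv_nonneg.mpr (jap_pos _).le)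
  have hY : Summable fun l => (jap l)⁻¹ * (jap (k - l))⁻¹ :=
    Summable.of_nonneg_of_le hY0 hYle ((hJ.add hJ').mul_left _)
  have hYs : ∑' l, (jap l)⁻¹ * (jap (k - l))⁻¹ ≤ japSum := by
    refine (hY.tsum_le_tsum hYle ((hJ.add hJ').mul_left _)).trans (le_of_eq ?_)
    have e3 : ∑' l, jap (k - l) ^ (-2 : ℝ) = japSum :=
      (Equiv.subLeft k).tsum_eq fun l => jap l ^ (-2 : ℝ)
    rw [tsum_mul_left, hJ.tsum_add hJ', e3]
    unfold japSum; ring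
  refine (tsum_sq_le (fun l => mul_nonneg (hA0 l) (hA0 _)) (fun l => mul_nonneg (hP0 l) (hP0 (k - l)))
    hY0 (summable_conv_term hP0 hP0 hA hA k) hY fun l => ?_).trans ?_
  · have h1 := (jap_pos l).ne'
    have h2 := (jap_pos (k - l)).ne'
    field_simp
  · exact mul_le_mul_of_nonneg_left hYs (conv_nonneg hP0 hP0 k)

lemma japSum_nonneg : 0 ≤ japSum := tsum_nonneg fun k => (jap_rpow_pos _ k).le

/-- The Sobolev embedding of `H¹` into `L⁴`. -/
theorem integral_pow_four_le {g : Torus → ℝ} (hg : Continuous g)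
    (hs : Summable fun k => ‖fourierHat g k‖)
    (hj : Summable fun k => jap k * ‖fourierHat g k‖ ^ 2) :
    ∫ x, g x ^ 4 ≤ cT * japSum * (cT * ∑' k, jap k * ‖fourierHat g k‖ ^ 2) ^ 2 := by
  have hA0 : ∀ k, 0 ≤ ‖fourierHat g k‖ := fun k => norm_nonneg _
  have hP0 : ∀ k, 0 ≤ jap k * ‖fourierHat g k‖ ^ 2 := fun k =>
    mul_nonneg (jap_pos k).le (sq_nonneg _)
  have e1 : ∫ x, g x ^ 4 = ∫ x, (g x * g x) ^ 2 := by congr 1; ext x; ring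
  have hc := (summable_conv hP0 hP0 hj hj).mul_left (cT ^ 2 * japSum)
  have hle : ∀ k, ‖fourierHat (fun x => g x * g x) k‖ ^ 2 ≤ cT ^ 2 * japSum *
      conv (fun l => jap l * ‖fourierHat g l‖ ^ 2) (fun l => jap l * ‖fourierHat g l‖ ^ 2) k := by
    intro k
    have h1 := norm_fourierHat_mul_le hg hg hs hs (fun k => le_rfl) (fun k => le_rfl) k
    have h2 := conv_sq_le hA0 hj k
    calc _ ≤ (cT * conv (fun l => ‖fourierHat g l‖) (fun l => ‖fourierHat g l‖) k) ^ 2 := by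
          gcongr
      _ = cT ^ 2 * conv (fun l => ‖fourierHat g l‖) (fun l => ‖fourierHat g l‖) k ^ 2 := by ring
      _ ≤ cT ^ 2 * _ := mul_le_mul_of_nonneg_left h2 (sq_nonneg _)
      _ = _ := by ring
  rw [e1, integral_sq_eq (g := fun x => g x * g x) (hg.mul hg)]
  have hs2 := Summable.of_nonneg_of_le (fun k => sq_nonneg _) hle hc
  calc _ ≤ cT * ∑' k, cT ^ 2 * japSum * conv (fun l => jap l * ‖fourierHat g l‖ ^ 2)
            (fun l => jap l * ‖fourierHat g l‖ ^ 2) k :=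
        mul_le_mul_of_nonneg_left (hs2.tsum_le_tsum hle hc) cT_pos.le
    _ = _ := by rw [tsum_mul_left, tsum_conv hP0 hP0 hj hj]; ring

end Embedding

/-! ### Trigonometric polynomials and the scheme in Fourier variables. -/

/-- Trigonometric polynomials with the modes `|k|_∞ ≤ N`. -/
structure IsTrig (N : ℕ) (g : Torus → ℝ) : Prop where
  continuous : Continuous g
  eq_zero : ∀ k, k ∉ modes N → fourierHat g k = 0

lemma contDiff_character_cover (k : Mode) {n : ℕ∞} :
    ContDiff ℝ n fun y : Plane => character k (cover y) := by
  unfold character cover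
  simp only [fourier_coe_apply]
  have h : ∀ i, ContDiff ℝ n fun y : Plane => ((y i : ℝ) : ℂ) := fun i =>
    Complex.ofRealCLM.contDiff.comp (by fun_prop)
  refine contDiff_prod fun i _ => ?_
  exact ((contDiff_const.mul (h i)).div_const _).cexp

namespace IsTrig
variable {N : ℕ} {g h : Torus → ℝ}

lemma truncMultiplier {σ : Mode → ℝ} (hσ : ∀ k, σ (-k) = σ k) :
    IsTrig N (truncMultiplier N σ g) :=
  ⟨continuous_truncMultiplier, fun k hk => by rw [fourierHat_truncMultiplier hσ, if_neg hk]⟩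

lemma add (hg : IsTrig N g) (hh : IsTrig N h) : IsTrig N fun x => g x + h x :=
  ⟨hg.continuous.add hh.continuous, fun k hk => by
    rw [fourierHat_add (integrable_of_continuous hg.continuous)
      (integrable_of_continuous hh.continuous), hg.eq_zero k hk, hh.eq_zero k hk, add_zero]⟩

lemma sub (hg : IsTrig N g) (hh : IsTrig N h) : IsTrig N fun x => g x - h x :=
  ⟨hg.continuous.sub hh.continuous, fun k hk => by
    rw [fourierHat_sub (integrable_of_continuous hg.continuous)
      (integrable_of_continuous hh.continuous), hg.eq_zero k hk, hh.eq_zero k hk, sub_zero]⟩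

lemma const_mul (c : ℝ) (hg : IsTrig N g) : IsTrig N fun x => c * g x :=
  ⟨continuous_const.mul hg.continuous, fun k hk => by
    rw [fourierHat_const_mul, hg.eq_zero k hk, mul_zero]⟩

variable (hg : IsTrig N g)
include hg

lemma tsum_eq (c : Mode → ℝ) : ∑' k, c k * ‖fourierHat g k‖ ^ 2
    = ∑ k ∈ modes N, c k * ‖fourierHat g k‖ ^ 2 :=
  tsum_eq_sum fun k hk => by simp [hg.eq_zero k hk]

lemma summable (c : Mode → ℝ) : Summable fun k => c k * ‖fourierHat g k‖ ^ 2 :=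
  summable_of_ne_finset_zero (s := modes N) fun k hk => by simp [hg.eq_zero k hk]

lemma summable_norm : Summable fun k => ‖fourierHat g k‖ :=
  summable_of_ne_finset_zero (s := modes N) fun k hk => by simp [hg.eq_zero k hk]

lemma contDiff {n : ℕ∞} : ContDiff ℝ n (lift g) := by
  have h1 : lift g = fun y => (synthC (fourierHat g) (cover y)).re := by
    ext y
    rw [lift_eq, Function.comp_apply, ← Complex.ofReal_re (g (cover y)),
      coe_eq_synthC hg.continuous hg.summable_norm]
  have h2 : ∀ x, synthC (fourierHat g) x
      = cT * ∑ k ∈ modes N, fourierHat g k * character k x := fun x => by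
    unfold synthC
    rw [tsum_eq_sum (s := modes N) fun k hk => by simp [hg.eq_zero k hk]]
  rw [h1]
  simp only [h2]
  refine Complex.reCLM.contDiff.comp (contDiff_const.mul (ContDiff.sum fun k _ =>
    contDiff_const.mul (contDiff_character_cover k)))

lemma integral_mul_eq (hh : Continuous h) : ∫ x, h x * g x
    = cT * ∑ k ∈ modes N, (conj (fourierHat h k) * fourierHat g k).re := by
  have h1 := Complex.hasSum_re
    (parseval_inner (memLp_of_continuous hh 2) (memLp_of_continuous hg.continuous 2))
  rw [Complex.ofReal_re] at h1
  have h2 : ∑' k, (conj (fourierHat h k) * fourierHat g k).re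
      = ∑ k ∈ modes N, (conj (fourierHat h k) * fourierHat g k).re :=
    tsum_eq_sum fun k hk => by simp [hg.eq_zero k hk]
  rw [← h2, h1.tsum_eq, ← mul_assoc, cT_mul, one_mul]

lemma integral_pow_four_le : ∫ x, g x ^ 4
    ≤ cT * japSum * (cT * ∑' k, jap k * ‖fourierHat g k‖ ^ 2) ^ 2 :=
  CahnHilliard.integral_pow_four_le hg.continuous hg.summable_norm (hg.summable _)

/-- Without the zero mode the weight `1 + |k|²` is at most `2|k|²`, so the gradient alone suffices.
It is applied to increments of the scheme, whose mean vanishes. -/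
lemma integral_pow_four_le_grad (h0 : fourierHat g 0 = 0) :
    ∫ x, g x ^ 4 ≤ 4 * (cT * japSum) * gradNormSq g ^ 2 := by
  refine hg.integral_pow_four_le.trans ?_
  have h1 : cT * ∑' k, jap k * ‖fourierHat g k‖ ^ 2 ≤ 2 * gradNormSq g := by
    have e : 2 * ∑' k, normSq k * ‖fourierHat g k‖ ^ 2
        = ∑' k, 2 * (normSq k * ‖fourierHat g k‖ ^ 2) := tsum_mul_left.symm
    rw [gradNormSq_eq, mul_left_comm 2 cT, e]
    refine mul_le_mul_of_nonneg_left ((hg.summable _).tsum_le_tsum (fun k => ?_)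
      ((hg.summable _).mul_left 2)) cT_pos.le
    by_cases hk : k = 0
    · simp [hk, h0]
    · rw [← mul_assoc]
      exact mul_le_mul_of_nonneg_right (jap_le_two_mul hk) (sq_nonneg _)
  have h2 : 0 ≤ cT * ∑' k, jap k * ‖fourierHat g k‖ ^ 2 :=
    mul_nonneg cT_pos.le (tsum_nonneg fun k => mul_nonneg (jap_pos k).le (sq_nonneg _))
  have h3 := mul_nonneg cT_pos.le japSum_nonneg
  calc _ ≤ cT * japSum * (2 * gradNormSq g) ^ 2 := by gcongr
    _ = _ := by ring

end IsTrig

lemma normSq_symm_bilaplace (k : Mode) : bilaplaceSymbol (-k) = bilaplaceSymbol k := by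
  simp [bilaplaceSymbol, normSq_neg]

lemma linSymbol_neg (ν τ : ℝ) (k : Mode) : linSymbol ν τ (-k) = linSymbol ν τ k := by
  simp [linSymbol, normSq_neg]

lemma nonlinSymbol_neg (ν τ : ℝ) (k : Mode) : nonlinSymbol ν τ (-k) = nonlinSymbol ν τ k := by
  simp [nonlinSymbol, normSq_neg]

/-- The damping factor `1 - exp (-ν |k|⁴ τ)` divided by `1 + S τ |k|⁴`. -/
def damping (ν S τ : ℝ) (k : Mode) : ℝ :=
  (1 - Real.exp (-ν * normSq k ^ 2 * τ)) / (1 + S * τ * normSq k ^ 2)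

namespace IsScheme
variable {ν S τ : ℝ} {N : ℕ} {u₀ : Torus → ℝ} {U : ℕ → Torus → ℝ}
  (hU : IsScheme ν S τ N u₀ U)
include hU

lemma isTrig (hτ : 0 < τ) (n : ℕ) : IsTrig N (U n) := by
  induction n with
  | zero => rw [hU.init]; exact IsTrig.truncMultiplier fun _ => rfl
  | succ n ih =>
    -- The step is implicit, but `U (n + 1)` enters the right side only through a truncated
    -- multiplier, which is a trigonometric polynomial whatever its argument.
    have e : U (n + 1) = fun x => U n x + τ * ((truncMultiplier N (linSymbol ν τ) (U n) x
        + truncMultiplier N (nonlinSymbol ν τ) (fun z => f (U n z)) x)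
        - S * truncMultiplier N bilaplaceSymbol (fun z => U (n + 1) z - U n z) x) := by
      ext x
      rw [← hU.step n x]
      field_simp
      ring
    rw [e]
    exact ih.add (.const_mul _ (((IsTrig.truncMultiplier (linSymbol_neg ν τ)).add
      (IsTrig.truncMultiplier (nonlinSymbol_neg ν τ))).sub
      ((IsTrig.truncMultiplier normSq_symm_bilaplace).const_mul S)))

lemma fourierHat_zero (k : Mode) :
    fourierHat (U 0) k = if k ∈ modes N then fourierHat u₀ k else 0 := by
  rw [hU.init, proj, fourierHat_truncMultiplier fun _ => rfl]
  simp

/-- The scheme in Fourier variables. -/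
lemma fourierHat_step (hν : 0 < ν) (hτ : 0 < τ) (hS : 0 ≤ S) (n : ℕ) {k : Mode} (hk : k ∈ modes N) :
    fourierHat (U (n + 1)) k = fourierHat (U n) k - damping ν S τ k *
      (fourierHat (U n) k + fourierHat (fun x => f (U n x)) k / (ν * normSq k : ℝ)) := by
  have t0 := (hU.isTrig hτ n).continuous
  have t1 := (hU.isTrig hτ (n + 1)).continuous
  have h1 := congrArg (fun g => fourierHat g k) (funext (hU.step n))
  simp only [div_eq_inv_mul] at h1
  have c1 : Continuous fun x => τ⁻¹ * (U (n + 1) x - U n x) := by fun_prop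
  have cT1 : Continuous fun x =>
      S * truncMultiplier N bilaplaceSymbol (fun z => U (n + 1) z - U n z) x :=
    continuous_const.mul continuous_truncMultiplier
  rw [fourierHat_add (integrable_of_continuous c1) (integrable_of_continuous cT1),
    fourierHat_const_mul, fourierHat_const_mul,
    fourierHat_add (integrable_of_continuous continuous_truncMultiplier)
      (integrable_of_continuous continuous_truncMultiplier),
    fourierHat_truncMultiplier normSq_symm_bilaplace, fourierHat_truncMultiplier (linSymbol_neg ν τ),
    fourierHat_truncMultiplier (nonlinSymbol_neg ν τ), if_pos hk, if_pos hk, if_pos hk,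
    fourierHat_sub (integrable_of_continuous t1) (integrable_of_continuous t0)] at h1
  unfold bilaplaceSymbol linSymbol nonlinSymbol at h1
  unfold damping
  have hτ' : (τ : ℂ) ≠ 0 := by exact_mod_cast hτ.ne'
  have hν' : (ν : ℂ) ≠ 0 := by exact_mod_cast hν.ne'
  have hd : ((1 : ℂ) + S * τ * (normSq k : ℂ) ^ 2) ≠ 0 := by
    have : (0 : ℝ) < 1 + S * τ * normSq k ^ 2 := by positivity
    exact_mod_cast this.ne'
  by_cases h0 : k = 0
  · subst h0
    simp only [normSq_zero] at h1 ⊢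
    simp at h1 ⊢
    rcases h1 with h | h
    · exact absurd h hτ.ne'
    · rw [sub_eq_zero] at h; exact h
  · have hl : (normSq k : ℂ) ≠ 0 := by exact_mod_cast (normSq_pos h0).ne'
    set e := Real.exp (-ν * normSq k ^ 2 * τ)
    push_cast at h1 ⊢
    set d : ℂ := 1 + S * τ * (normSq k : ℂ) ^ 2 with hd_def
    set X := fourierHat (U n) k + fourierHat (fun x => f (U n x)) k / (ν * (normSq k : ℂ)) with hX
    have h2 : (fourierHat (U (n + 1)) k - fourierHat (U n) k) * d = -((1 - e) * X) := by
      rw [hd_def, hX]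
      field_simp at h1 ⊢
      linear_combination h1
    have h3 : (1 - e) * X / d = -(fourierHat (U (n + 1)) k - fourierHat (U n) k) := by
      rw [div_eq_iff hd]; linear_combination h2
    rw [div_mul_eq_mul_div, h3]; ring

end IsScheme

section Damping
variable {ν S τ : ℝ}

lemma one_sub_exp_le (x : ℝ) : 1 - Real.exp (-x) ≤ x := by
  linarith [Real.add_one_le_exp (-x)]

lemma one_sub_exp_bounds (hν : 0 < ν) (hτ : 0 < τ) (k : Mode) :
    0 ≤ 1 - Real.exp (-ν * normSq k ^ 2 * τ) ∧ 1 - Real.exp (-ν * normSq k ^ 2 * τ) ≤ 1 ∧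
      1 - Real.exp (-ν * normSq k ^ 2 * τ) ≤ ν * normSq k ^ 2 * τ := by
  have h0 : 0 ≤ ν * normSq k ^ 2 * τ := by positivity
  have e : -ν * normSq k ^ 2 * τ = -(ν * normSq k ^ 2 * τ) := by ring
  rw [e]
  refine ⟨?_, ?_, one_sub_exp_le _⟩
  · have : Real.exp (-(ν * normSq k ^ 2 * τ)) ≤ 1 := Real.exp_le_one_iff.mpr (by linarith)
    linarith
  · linarith [Real.exp_pos (-(ν * normSq k ^ 2 * τ))]

lemma damping_nonneg (hν : 0 < ν) (hτ : 0 < τ) (hS : 0 ≤ S) (k : Mode) : 0 ≤ damping ν S τ k :=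
  div_nonneg (one_sub_exp_bounds hν hτ k).1 (by positivity)

lemma damping_le (hν : 0 < ν) (hτ : 0 < τ) (hS : 0 ≤ S) (k : Mode) :
    damping ν S τ k ≤ 1 - Real.exp (-ν * normSq k ^ 2 * τ) :=
  div_le_self (one_sub_exp_bounds hν hτ k).1 (by
    have : 0 ≤ S * τ * normSq k ^ 2 := by positivity
    linarith)

lemma damping_le_one (hν : 0 < ν) (hτ : 0 < τ) (hS : 0 ≤ S) (k : Mode) :
    damping ν S τ k ≤ 1 := (damping_le hν hτ hS k).trans (one_sub_exp_bounds hν hτ k).2.1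

/-- With `x = ντ|k|⁴`, use `1 - e^{-x} ≤ x` for the part with `S` and `1 - e^{-x} ≤ 1` for the part
with `ν`. This is the source of the dissipation `(S + ν)‖∇d‖²`. -/
lemma damping_mul_le (hν : 0 < ν) (hτ : 0 < τ) (hS : 0 ≤ S) (k : Mode) :
    damping ν S τ k * (S + ν) ≤ ν := by
  obtain ⟨-, h1, h2⟩ := one_sub_exp_bounds hν hτ k
  have hd : 0 < 1 + S * τ * normSq k ^ 2 := by positivity
  unfold damping
  rw [div_mul_eq_mul_div, div_le_iff₀ hd]
  nlinarith [mul_le_mul_of_nonneg_right h2 hS, mul_le_mul_of_nonneg_right h1 hν.le]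

end Damping

/-! ### Energy stability of the scheme. -/

/-- The constant of the embedding of `H¹` into `L⁴`. -/
def embConst : ℝ := cT * japSum

lemma embConst_nonneg : 0 ≤ embConst := mul_nonneg cT_pos.le japSum_nonneg

/-- A bound of the energy of the truncated initial data, relative to `(1 + ν + ‖u₀‖²)²`. -/
def energyConst : ℝ := 1 + 2 * embConst + (2 * Real.pi) ^ 2

/-- Chosen so that `∫ (ad)² ≤ quarticConst · Q · ‖∇d‖²`, as the product of the `L⁴` bounds of the
state `a` and of the increment `d`. -/
def quarticConst : ℝ := 2 * Real.sqrt ((8 * energyConst + 2 * (2 * Real.pi) ^ 2) * embConst)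

/-- Chosen so that `(S‖∇d‖²)² ≤ incrementConst · Q³ · ‖∇d‖²`, which makes increments small when `S`
is large. -/
def incrementConst : ℝ := 4 * energyConst + 8 * energyConst * quarticConst

/-- The stabilisation needed, relative to `1 + ν + ‖u₀‖²`. -/
def stabConst : ℝ := 1 + 4 * quarticConst + 8 * embConst * incrementConst

lemma energyConst_pos : 0 < energyConst := by
  have := embConst_nonneg
  unfold energyConst; positivity

lemma quarticConst_nonneg : 0 ≤ quarticConst := by unfold quarticConst; positivity

lemma incrementConst_nonneg : 0 ≤ incrementConst := by
  have := energyConst_pos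
  have := quarticConst_nonneg
  unfold incrementConst; positivity

lemma one_le_stabConst : 1 ≤ stabConst := by
  have := embConst_nonneg
  have := quarticConst_nonneg
  have := incrementConst_nonneg
  have : 0 ≤ 4 * quarticConst + 8 * embConst * incrementConst := by positivity
  unfold stabConst; linarith

/-- With `d = b - a`, Taylor's formula is exact at order four; the right side exceeds the left by
`d²(a - d)²/2 + d⁴/4 + d²/2`. -/
lemma F_sub_le (a b : ℝ) :
    F b - F a ≤ f a * (b - a) + 2 * (a * (b - a)) ^ 2 + (b - a) ^ 4 := by
  unfold F f
  set d := b - a with hd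
  have hb : b = a + d := by rw [hd]; ring
  rw [hb]
  nlinarith [sq_nonneg (d * (a - d)), sq_nonneg d, sq_nonneg (d * d)]

section EnergyStep
variable {ν S Q : ℝ} {N : ℕ} {a b : Torus → ℝ}

lemma gradNormSq_sub_gradNormSq (ha : IsTrig N a) (hb : IsTrig N b) :
    gradNormSq b - gradNormSq a = 2 * (cT * ∑ k ∈ modes N,
      normSq k * (conj (fourierHat a k) * fourierHat (fun x => b x - a x) k).re)
      + gradNormSq fun x => b x - a x := by
  have h : ∀ k, fourierHat b k = fourierHat a k + fourierHat (fun x => b x - a x) k := fun k => by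
    rw [fourierHat_sub (integrable_of_continuous hb.continuous)
      (integrable_of_continuous ha.continuous)]; ring
  rw [gradNormSq_eq, gradNormSq_eq, gradNormSq_eq, hb.tsum_eq, ha.tsum_eq, (hb.sub ha).tsum_eq,
    ← mul_sub, ← Finset.sum_sub_distrib, mul_left_comm, ← mul_add]
  congr 1
  rw [Finset.mul_sum, ← Finset.sum_add_distrib]
  refine Finset.sum_congr rfl fun k _ => ?_
  rw [h k, ← Complex.normSq_eq_norm_sq, ← Complex.normSq_eq_norm_sq, ← Complex.normSq_eq_norm_sq]
  simp only [Complex.normSq_apply, Complex.add_re, Complex.add_im, Complex.mul_re, Complex.conj_re,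
    Complex.conj_im]
  ring

lemma sq_sum_grad_le (ha : IsTrig N a) {d : Torus → ℝ} (hd : IsTrig N d) :
    (cT * ∑ k ∈ modes N, normSq k * (conj (fourierHat a k) * fourierHat d k).re) ^ 2
      ≤ gradNormSq a * gradNormSq d := by
  rw [gradNormSq_eq, gradNormSq_eq, hd.tsum_eq, ha.tsum_eq, mul_pow, mul_mul_mul_comm, ← sq]
  refine mul_le_mul_of_nonneg_left ?_ (sq_nonneg _)
  refine Finset.sum_sq_le_sum_mul_sum_of_sq_le_mul _
    (fun k _ => mul_nonneg (normSq_nonneg k) (sq_nonneg _))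
    (fun k _ => mul_nonneg (normSq_nonneg k) (sq_nonneg _)) fun k _ => ?_
  have h1 : (conj (fourierHat a k) * fourierHat d k).re ^ 2
      ≤ (‖fourierHat a k‖ * ‖fourierHat d k‖) ^ 2 := by
    rw [← sq_abs]
    refine pow_le_pow_left₀ (abs_nonneg _) ((Complex.abs_re_le_norm _).trans ?_) 2
    rw [norm_mul, Complex.norm_conj]
  calc _ = normSq k ^ 2 * (conj (fourierHat a k) * fourierHat d k).re ^ 2 := by ring
    _ ≤ normSq k ^ 2 * (‖fourierHat a k‖ * ‖fourierHat d k‖) ^ 2 :=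
        mul_le_mul_of_nonneg_left h1 (sq_nonneg _)
    _ = _ := by ring

lemma integral_pow_four_le_of_energy (hν : 0 < ν) (ha : Continuous a) :
    ∫ x, a x ^ 4 ≤ 8 * energy ν a + 2 * (2 * Real.pi) ^ 2 := by
  have h1 : ∫ x, a x ^ 4 ≤ ∫ x, (8 * F (a x) + 2) := by
    refine integral_mono (integrable_of_continuous (by fun_prop))
      (integrable_of_continuous (by fun_prop)) fun x => ?_
    simp only [F]
    nlinarith [sq_nonneg (a x ^ 2 - 2)]
  rw [integral_add (integrable_of_continuous (by fun_prop)) (integrable_const _),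
    integral_const_mul, integral_const, volume_torus, smul_eq_mul] at h1
  have h2 := mul_nonneg (half_pos hν).le (gradNormSq_nonneg a)
  unfold energy
  linarith

set_option maxHeartbeats 800000 in
/-- A step of a sufficiently stabilised scheme does not increase the energy. -/
theorem energy_step_le (hν : 0 < ν) (ha : IsTrig N a) (hb : IsTrig N b)
    (h0 : fourierHat (fun x => b x - a x) 0 = 0)
    (hmode : ∀ k ∈ modes N, (S + ν) * (normSq k * ‖fourierHat (fun x => b x - a x) k‖ ^ 2)
      ≤ -(conj (ν * normSq k * fourierHat a k + fourierHat (fun x => f (a x)) k)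
        * fourierHat (fun x => b x - a x) k).re)
    (hQ : 1 ≤ Q) (hνQ : ν ≤ Q) (hE : energy ν a ≤ energyConst * Q ^ 2) (hS : stabConst * Q ≤ S) :
    energy ν b ≤ energy ν a := by
  have hd := hb.sub ha
  have hac := ha.continuous
  have hbc := hb.continuous
  set d : Torus → ℝ := fun x => b x - a x with hd_def
  have hdc : Continuous d := hd.continuous
  set G := gradNormSq d with hG_def
  have hG : 0 ≤ G := gradNormSq_nonneg d
  have hQ0 : 0 < Q := one_pos.trans_le hQ
  have K0 := embConst_nonneg
  have CE := energyConst_pos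
  have R0 := quarticConst_nonneg
  have X0 := incrementConst_nonneg
  have hS0 : 0 < S := (mul_pos (one_pos.trans_le one_le_stabConst) hQ0).trans_le hS
  -- the energy difference
  set Y := cT * ∑ k ∈ modes N, normSq k * (conj (fourierHat a k) * fourierHat d k).re with hY
  set Z := ∫ x, f (a x) * d x with hZ
  have hX : (S + ν) * G ≤ -(ν * Y + Z) := by
    rw [hY, hZ, hd.integral_mul_eq (h := fun x => f (a x)) (by fun_prop), hG_def, gradNormSq_eq,
      hd.tsum_eq, mul_left_comm, mul_left_comm ν, ← mul_add, ← mul_neg]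
    refine mul_le_mul_of_nonneg_left ?_ cT_pos.le
    rw [Finset.mul_sum, Finset.mul_sum, ← Finset.sum_add_distrib, ← Finset.sum_neg_distrib]
    refine Finset.sum_le_sum fun k hk => (hmode k hk).trans (le_of_eq ?_)
    simp only [Complex.mul_re, Complex.conj_re, Complex.conj_im, Complex.add_re, Complex.add_im,
      Complex.ofReal_re, Complex.ofReal_im, Complex.mul_im]
    ring
  have hF : (∫ x, F (b x)) - ∫ x, F (a x)
      ≤ Z + 2 * (∫ x, (a x * d x) ^ 2) + ∫ x, d x ^ 4 := by
    rw [← integral_sub (integrable_of_continuous (by fun_prop))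
      (integrable_of_continuous (by fun_prop)), hZ, ← integral_const_mul,
      ← integral_add (integrable_of_continuous (by fun_prop))
      (integrable_of_continuous (by fun_prop)), ← integral_add (integrable_of_continuous (by fun_prop))
      (integrable_of_continuous (by fun_prop))]
    exact integral_mono (integrable_of_continuous (by fun_prop))
      (integrable_of_continuous (by fun_prop)) fun x => F_sub_le (a x) (b x)
  have hgrad := gradNormSq_sub_gradNormSq ha hb
  -- The first variation `νY + Z` is at most `-(S + ν)G`, which also absorbs the second-order
  -- gradient term `νG/2`.
  have hdiff : energy ν b - energy ν a
      ≤ -(S * G) + 2 * (∫ x, (a x * d x) ^ 2) + ∫ x, d x ^ 4 := by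
    have e : energy ν b - energy ν a
        = ν / 2 * (gradNormSq b - gradNormSq a) + ((∫ x, F (b x)) - ∫ x, F (a x)) := by
      unfold energy; ring
    rw [e, hgrad]
    have : ν / 2 * (2 * Y + G) = ν * Y + ν / 2 * G := by ring
    have h1 : 0 ≤ ν / 2 * G := by positivity
    linarith
  -- the quartic terms
  have hd4 : ∫ x, d x ^ 4 ≤ 4 * embConst * G ^ 2 := hd.integral_pow_four_le_grad h0
  have ha4 : ∫ x, a x ^ 4 ≤ (8 * energyConst + 2 * (2 * Real.pi) ^ 2) * Q ^ 2 := by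
    have h1 := integral_pow_four_le_of_energy hν hac
    have h2 : (1 : ℝ) ≤ Q ^ 2 := one_le_pow₀ hQ
    nlinarith [mul_le_mul_of_nonneg_left h2 (by positivity : 0 ≤ 2 * (2 * Real.pi) ^ 2)]
  have hd40 : 0 ≤ ∫ x, d x ^ 4 := integral_nonneg fun x => by positivity
  have hP0 : 0 ≤ ∫ x, (a x * d x) ^ 2 := integral_nonneg fun x => by positivity
  have hP : ∫ x, (a x * d x) ^ 2 ≤ quarticConst * Q * G := by
    have h1 := integral_cauchy_schwarz (a := fun x => a x ^ 2) (b := fun x => d x ^ 2)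
      (by fun_prop) (by fun_prop)
    simp only [← pow_mul, ← mul_pow] at h1
    norm_num at h1
    refine le_of_sq_le_sq (h1.trans ?_) (by positivity)
    calc (∫ x, a x ^ 4) * ∫ x, d x ^ 4
        ≤ ((8 * energyConst + 2 * (2 * Real.pi) ^ 2) * Q ^ 2) * (4 * embConst * G ^ 2) :=
          mul_le_mul ha4 hd4 hd40 (by positivity)
      _ = (quarticConst * Q * G) ^ 2 := by
          unfold quarticConst
          have : Real.sqrt ((8 * energyConst + 2 * (2 * Real.pi) ^ 2) * embConst) ^ 2
            = (8 * energyConst + 2 * (2 * Real.pi) ^ 2) * embConst :=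
            Real.sq_sqrt (by positivity)
          linear_combination (-(4 * Q ^ 2 * G ^ 2)) * this
  -- smallness of the increment
  have hfl : Z ^ 2 ≤ 4 * (energyConst * Q ^ 2) * (quarticConst * Q * G) := by
    have h1 := integral_cauchy_schwarz (a := fun x => a x ^ 2 - 1) (b := fun x => a x * d x)
      (by fun_prop) (by fun_prop)
    have e1 : Z = ∫ x, (a x ^ 2 - 1) * (a x * d x) := by
      rw [hZ]; congr 1; ext x; unfold f; ring
    have e2 : ∫ x, (a x ^ 2 - 1) ^ 2 ≤ 4 * (energyConst * Q ^ 2) := by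
      have : ∫ x, (a x ^ 2 - 1) ^ 2 = 4 * ∫ x, F (a x) := by
        rw [← integral_const_mul]; congr 1; ext x; unfold F; ring
      rw [this]
      have h2 := mul_nonneg (half_pos hν).le (gradNormSq_nonneg a)
      unfold energy at hE
      linarith
    rw [e1]
    exact h1.trans (mul_le_mul e2 hP hP0 (by positivity))
  have hYl : (ν * Y) ^ 2 ≤ 2 * energyConst * Q ^ 3 * G := by
    have h1 := sq_sum_grad_le ha hd
    have h2 : ν * gradNormSq a ≤ 2 * (energyConst * Q ^ 2) := by
      have : 0 ≤ ∫ x, F (a x) := integral_nonneg fun x => F_nonneg _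
      unfold energy at hE
      linarith
    calc (ν * Y) ^ 2 = ν ^ 2 * Y ^ 2 := by ring
      _ ≤ ν ^ 2 * (gradNormSq a * G) := mul_le_mul_of_nonneg_left h1 (sq_nonneg _)
      _ = ν * (ν * gradNormSq a) * G := by ring
      _ ≤ Q * (2 * (energyConst * Q ^ 2)) * G := by
          have := mul_nonneg hν.le (gradNormSq_nonneg a)
          gcongr
      _ = _ := by ring
  -- The dissipation is bounded by the first variation, and the latter by `√G`. Dividing by `G`
  -- gives `G ≤ incrementConst · Q³/S²`.
  have hSG : (S * G) ^ 2 ≤ incrementConst * Q ^ 3 * G := by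
    have h1 : S * G ≤ -(ν * Y + Z) := by
      have := mul_nonneg hν.le hG
      linarith
    have h2 : 0 ≤ S * G := by positivity
    have h3 : (S * G) ^ 2 ≤ (-(ν * Y + Z)) ^ 2 := pow_le_pow_left₀ h2 h1 2
    have h4 : (-(ν * Y + Z)) ^ 2 ≤ 2 * (ν * Y) ^ 2 + 2 * Z ^ 2 := by
      nlinarith [sq_nonneg (ν * Y - Z)]
    have h5 : incrementConst * Q ^ 3 * G = 2 * (2 * energyConst * Q ^ 3 * G)
        + 2 * (4 * (energyConst * Q ^ 2) * (quarticConst * Q * G)) := by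
      unfold incrementConst; ring
    linarith
  have hSe : Q + 4 * (quarticConst * Q) + 8 * embConst * incrementConst * Q ≤ S := by
    unfold stabConst at hS; linarith
  have hQS : Q ≤ S := by
    have := mul_le_mul_of_nonneg_right one_le_stabConst hQ0.le
    linarith
  -- Smallness of `G` turns the quadratic bound `4 embConst G²` of `∫ d⁴` into a linear one; each
  -- quartic term then takes half of the dissipation `S G`.
  have hsmall : 4 * embConst * G ≤ S / 2 := by
    rcases hG.eq_or_lt with h | h
    · rw [← h]; linarith
    · have h1 : S ^ 2 * G ≤ incrementConst * Q ^ 3 := by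
        refine le_of_mul_le_mul_right ?_ h
        calc S ^ 2 * G * G = (S * G) ^ 2 := by ring
          _ ≤ _ := hSG
      have h2 : 8 * embConst * incrementConst * Q ≤ S := by
        have := mul_nonneg R0 hQ0.le
        linarith
      have h3 : S ^ 2 * (8 * embConst * G) ≤ S ^ 2 * S := by
        calc S ^ 2 * (8 * embConst * G) = 8 * embConst * (S ^ 2 * G) := by ring
          _ ≤ 8 * embConst * (incrementConst * Q ^ 3) := by gcongr
          _ = Q ^ 2 * (8 * embConst * incrementConst * Q) := by ring
          _ ≤ S ^ 2 * S := by gcongr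
      have := le_of_mul_le_mul_left h3 (by positivity)
      linarith
  have hlin : 2 * (quarticConst * Q) ≤ S / 2 := by
    have h5 : 0 ≤ 8 * embConst * incrementConst * Q := by positivity
    linarith
  have f1 : ∫ x, d x ^ 4 ≤ S / 2 * G := by
    calc _ ≤ 4 * embConst * G ^ 2 := hd4
      _ = (4 * embConst * G) * G := by ring
      _ ≤ _ := mul_le_mul_of_nonneg_right hsmall hG
  have f2 : 2 * ∫ x, (a x * d x) ^ 2 ≤ S / 2 * G := by
    calc _ ≤ 2 * (quarticConst * Q * G) := by linarith
      _ = 2 * (quarticConst * Q) * G := by ring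
      _ ≤ _ := mul_le_mul_of_nonneg_right hlin hG
  linarith

end EnergyStep

/-- The size `1 + ν + ‖u₀‖²` of the data, with the norm of `H²`. -/
def dataSize (ν : ℝ) (u₀ : Torus → ℝ) : ℝ := 1 + ν + sobolevNormSq 2 u₀

lemma sobolevNormSq_nonneg (s : ℝ) (g : Torus → ℝ) : 0 ≤ sobolevNormSq s g :=
  mul_nonneg cT_pos.le (tsum_nonneg fun k =>
    mul_nonneg (add_nonneg zero_le_one (Real.rpow_nonneg (normSq_nonneg k) _)) (sq_nonneg _))

lemma zero_mem_modes {N : ℕ} : (0 : Mode) ∈ modes N := by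
  simp [modes]

namespace IsScheme
variable {ν S τ : ℝ} {N : ℕ} {u₀ : Torus → ℝ} {U : ℕ → Torus → ℝ}
  (hU : IsScheme ν S τ N u₀ U)
include hU

lemma fourierHat_mean (hν : 0 < ν) (hτ : 0 < τ) (hS : 0 ≤ S) (n : ℕ) :
    fourierHat (U n) 0 = fourierHat u₀ 0 := by
  induction n with
  | zero => rw [hU.fourierHat_zero, if_pos zero_mem_modes]
  | succ n ih =>
    rw [hU.fourierHat_step hν hτ hS n zero_mem_modes, ih]
    simp [damping]

/-- The increment of a mode is `-κz`, where `z` is the coefficient of the chemical potential and `κ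
= p/(ν|k|²)`. So the right side is `κ|z|²`, and the claim reduces to `κ(S + ν)|k|² ≤ 1`, that is to
`damping_mul_le`. -/
lemma dissipation (hν : 0 < ν) (hτ : 0 < τ) (hS : 0 ≤ S) (n : ℕ) {k : Mode} (hk : k ∈ modes N) :
    (S + ν) * (normSq k * ‖fourierHat (fun x => U (n + 1) x - U n x) k‖ ^ 2)
      ≤ -(conj (ν * normSq k * fourierHat (U n) k + fourierHat (fun x => f (U n x)) k)
        * fourierHat (fun x => U (n + 1) x - U n x) k).re := by
  rw [fourierHat_sub (integrable_of_continuous (hU.isTrig hτ (n + 1)).continuous)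
    (integrable_of_continuous (hU.isTrig hτ n).continuous)]
  by_cases h0 : k = 0
  · subst h0
    rw [hU.fourierHat_mean hν hτ hS, hU.fourierHat_mean hν hτ hS]
    simp
  · have hl := normSq_pos h0
    set z := ν * normSq k * fourierHat (U n) k + fourierHat (fun x => f (U n x)) k with hz
    set κ := damping ν S τ k / (ν * normSq k) with hκ
    have hκ0 : 0 ≤ κ := div_nonneg (damping_nonneg hν hτ hS k) (by positivity)
    have e : fourierHat (U (n + 1)) k - fourierHat (U n) k = -(κ : ℂ) * z := by
      rw [hU.fourierHat_step hν hτ hS n hk, hz, hκ]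
      have h1 : (normSq k : ℂ) ≠ 0 := by exact_mod_cast hl.ne'
      have h2 : (ν : ℂ) ≠ 0 := by exact_mod_cast hν.ne'
      push_cast
      field_simp
      ring
    have hκ1 : κ * ((S + ν) * normSq k) ≤ 1 := by
      rw [hκ, div_mul_eq_mul_div, div_le_one (by positivity)]
      calc damping ν S τ k * ((S + ν) * normSq k)
          = damping ν S τ k * (S + ν) * normSq k := by ring
        _ ≤ _ := mul_le_mul_of_nonneg_right (damping_mul_le hν hτ hS k) hl.le
    have e2 : (conj z * (-(κ : ℂ) * z)).re = -(κ * ‖z‖ ^ 2) := by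
      rw [← Complex.normSq_eq_norm_sq]
      simp only [Complex.normSq_apply, Complex.mul_re, Complex.mul_im, Complex.neg_re,
        Complex.neg_im, Complex.conj_re, Complex.conj_im, Complex.ofReal_re, Complex.ofReal_im]
      ring
    rw [e, e2, norm_mul, norm_neg, Complex.norm_real, Real.norm_of_nonneg hκ0, neg_neg]
    calc _ = (κ * ((S + ν) * normSq k)) * (κ * ‖z‖ ^ 2) := by ring
      _ ≤ 1 * (κ * ‖z‖ ^ 2) := mul_le_mul_of_nonneg_right hκ1 (by positivity)
      _ = _ := one_mul _

lemma energy_zero_le (hν : 0 < ν) (hτ : 0 < τ)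
    (h2 : Summable fun k : Mode => (1 + normSq k ^ (2 : ℝ)) * ‖fourierHat u₀ k‖ ^ 2) :
    energy ν (U 0) ≤ energyConst * dataSize ν u₀ ^ 2 := by
  have hT := hU.isTrig hτ 0
  have hc := hT.continuous
  set H := sobolevNormSq 2 u₀ with hH
  have hH0 : 0 ≤ H := sobolevNormSq_nonneg 2 u₀
  have hj : cT * ∑' k, jap k * ‖fourierHat (U 0) k‖ ^ 2 ≤ 2 * H := by
    have e : 2 * ∑' k : Mode, (1 + normSq k ^ (2 : ℝ)) * ‖fourierHat u₀ k‖ ^ 2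
        = ∑' k : Mode, 2 * ((1 + normSq k ^ (2 : ℝ)) * ‖fourierHat u₀ k‖ ^ 2) := tsum_mul_left.symm
    have e3 : H = cT * ∑' k : Mode, (1 + normSq k ^ (2 : ℝ)) * ‖fourierHat u₀ k‖ ^ 2 := rfl
    rw [e3, mul_left_comm 2 cT, e]
    refine mul_le_mul_of_nonneg_left ((hT.summable _).tsum_le_tsum (fun k => ?_) (h2.mul_left 2))
      cT_pos.le
    have h4 : ‖fourierHat (U 0) k‖ ≤ ‖fourierHat u₀ k‖ := by
      rw [hU.fourierHat_zero]; split_ifs <;> simp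
    have h5 : jap k ≤ 2 * (1 + normSq k ^ (2 : ℝ)) := by
      rw [Real.rpow_two]; unfold jap; nlinarith [sq_nonneg (normSq k - 1)]
    calc jap k * ‖fourierHat (U 0) k‖ ^ 2
        ≤ (2 * (1 + normSq k ^ (2 : ℝ))) * ‖fourierHat u₀ k‖ ^ 2 := by
          have := (jap_pos k).le
          gcongr
          linarith
      _ = _ := by ring
  have hj0 : 0 ≤ cT * ∑' k, jap k * ‖fourierHat (U 0) k‖ ^ 2 :=
    mul_nonneg cT_pos.le (tsum_nonneg fun k => mul_nonneg (jap_pos k).le (sq_nonneg _))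
  have hg : gradNormSq (U 0) ≤ 2 * H := by
    refine le_trans ?_ hj
    rw [gradNormSq_eq]
    refine mul_le_mul_of_nonneg_left ((hT.summable _).tsum_le_tsum (fun k => ?_) (hT.summable _))
      cT_pos.le
    refine mul_le_mul_of_nonneg_right ?_ (sq_nonneg _)
    unfold jap; linarith
  have h4 : ∫ x, U 0 x ^ 4 ≤ embConst * (2 * H) ^ 2 := by
    refine hT.integral_pow_four_le.trans ?_
    have := embConst_nonneg
    unfold embConst at *
    gcongr
  have hF : ∫ x, F (U 0 x) ≤ 1 / 2 * (∫ x, U 0 x ^ 4) + 1 / 2 * (2 * Real.pi) ^ 2 := by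
    have h1 : ∫ x, F (U 0 x) ≤ ∫ x, (1 / 2 * U 0 x ^ 4 + 1 / 2) := by
      refine integral_mono (integrable_of_continuous (by fun_prop))
        (integrable_of_continuous (by fun_prop)) fun x => ?_
      simp only [F]
      nlinarith [sq_nonneg (U 0 x ^ 2), sq_nonneg (U 0 x ^ 2 + 1)]
    rw [integral_add (integrable_of_continuous (by fun_prop)) (integrable_const _),
      integral_const_mul, integral_const, volume_torus, smul_eq_mul] at h1
    linarith
  set Q := dataSize ν u₀ with hQ
  have hQe : Q = 1 + ν + H := rfl
  have q1 : ν * H ≤ Q ^ 2 := by rw [hQe]; nlinarith [mul_nonneg hν.le hH0]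
  have q2 : H ^ 2 ≤ Q ^ 2 := by rw [hQe]; nlinarith [mul_nonneg hν.le hH0]
  have q3 : 1 ≤ Q ^ 2 := by rw [hQe]; nlinarith [mul_nonneg hν.le hH0]
  have g1 : ν / 2 * gradNormSq (U 0) ≤ ν * H := by nlinarith
  have g2 : embConst * H ^ 2 ≤ embConst * Q ^ 2 := mul_le_mul_of_nonneg_left q2 embConst_nonneg
  have g3 : (2 * Real.pi) ^ 2 * 1 ≤ (2 * Real.pi) ^ 2 * Q ^ 2 :=
    mul_le_mul_of_nonneg_left q3 (by positivity)
  have g4 : 0 ≤ (2 * Real.pi) ^ 2 := by positivity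
  unfold energy energyConst
  nlinarith

/-- The energy of the iterates is bounded by the data. -/
theorem energy_le (hν : 0 < ν) (hτ : 0 < τ)
    (h2 : Summable fun k : Mode => (1 + normSq k ^ (2 : ℝ)) * ‖fourierHat u₀ k‖ ^ 2)
    (hS : stabConst * dataSize ν u₀ ≤ S) (n : ℕ) :
    energy ν (U n) ≤ energyConst * dataSize ν u₀ ^ 2 := by
  have hH0 := sobolevNormSq_nonneg 2 u₀
  have hQ : 1 ≤ dataSize ν u₀ := by unfold dataSize; linarith
  have hS0 : 0 ≤ S := le_trans (mul_nonneg (zero_le_one.trans one_le_stabConst) (by linarith)) hS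
  induction n with
  | zero => exact hU.energy_zero_le hν hτ h2
  | succ n ih =>
    refine le_trans (energy_step_le hν (hU.isTrig hτ n) (hU.isTrig hτ (n + 1)) ?_
      (fun k hk => hU.dissipation hν hτ hS0 n hk) hQ (by unfold dataSize; linarith) ih hS) ih
    rw [fourierHat_sub (integrable_of_continuous (hU.isTrig hτ (n + 1)).continuous)
      (integrable_of_continuous (hU.isTrig hτ n).continuous), hU.fourierHat_mean hν hτ hS0,
      hU.fourierHat_mean hν hτ hS0, sub_self]

/-- Majorants of the Fourier coefficients of the iterates that are uniform in all parameters of the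
discretisation. -/
theorem norm_fourierHat_le (hν : 0 < ν) (hτ : 0 < τ)
    (h2 : Summable fun k : Mode => (1 + normSq k ^ (2 : ℝ)) * ‖fourierHat u₀ k‖ ^ 2)
    (hS : stabConst * dataSize ν u₀ ≤ S) (n : ℕ) (k : Mode) :
    ‖fourierHat (U n) k‖ ≤ iterMaj ν (fluxConst ν (energyConst * dataSize ν u₀ ^ 2))
      (fun k => ‖fourierHat u₀ k‖) 0 k := by
  have hH0 := sobolevNormSq_nonneg 2 u₀
  have hQ : 1 ≤ dataSize ν u₀ := by unfold dataSize; linarith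
  have hS0 : 0 ≤ S := le_trans (mul_nonneg (zero_le_one.trans one_le_stabConst) (by linarith)) hS
  set D := fluxConst ν (energyConst * dataSize ν u₀ ^ 2) with hD
  have hM0 : 0 ≤ iterMaj ν D (fun k => ‖fourierHat u₀ k‖) 0 k :=
    iterMaj_nonneg hν (fun k => norm_nonneg _) 0 k
  by_cases hk : k ∈ modes N
  · by_cases h0 : k = 0
    · rw [h0, hU.fourierHat_mean hν hτ hS0]
      simp [iterMaj]
    · have hl := normSq_pos h0
      set B := Real.sqrt (D / normSq k) / (ν * normSq k) with hB
      have hB0 : 0 ≤ B := div_nonneg (Real.sqrt_nonneg _) (by positivity)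
      have hMe : iterMaj ν D (fun k => ‖fourierHat u₀ k‖) 0 k = ‖fourierHat u₀ k‖ + B := rfl
      rw [hMe]
      induction n with
      | zero =>
        rw [hU.fourierHat_zero, if_pos hk]; linarith
      | succ n ih =>
        have p0 := damping_nonneg hν hτ hS0 k
        have p1 := damping_le_one hν hτ hS0 k
        have hφ : ‖fourierHat (fun x => f (U n x)) k / (ν * normSq k : ℝ)‖ ≤ B := by
          rw [norm_div, Complex.norm_real, Real.norm_of_nonneg (by positivity), hB]
          refine div_le_div_of_nonneg_right (Real.le_sqrt_of_sq_le ?_) (by positivity)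
          rw [le_div_iff₀ hl, mul_comm]
          exact normSq_mul_fourierHat_f_le_of_energy hν ((hU.isTrig hτ n).contDiff (n := 1))
            (hU.energy_le hν hτ h2 hS n) k
        -- With `p` in `[0, 1]` the new coefficient is a convex combination of the old one and of
        -- `-φ/(ν|k|²)`, so a bound of the form data plus `B` reproduces itself for any `τ` and `N`.
        have e : fourierHat (U (n + 1)) k = ((1 - damping ν S τ k : ℝ) : ℂ) * fourierHat (U n) k
            - (damping ν S τ k : ℂ) * (fourierHat (fun x => f (U n x)) k / (ν * normSq k : ℝ)) := by
          rw [hU.fourierHat_step hν hτ hS0 n hk]; push_cast; ring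
        rw [e]
        refine (norm_sub_le _ _).trans ?_
        rw [norm_mul, norm_mul, Complex.norm_real, Complex.norm_real, Real.norm_of_nonneg p0,
          Real.norm_of_nonneg (by linarith)]
        have := norm_nonneg (fourierHat u₀ k)
        nlinarith [mul_le_mul_of_nonneg_left ih (by linarith : 0 ≤ 1 - damping ν S τ k),
          mul_le_mul_of_nonneg_left hφ p0, mul_nonneg p0 this]
  · rw [(hU.isTrig hτ n).eq_zero k hk, norm_zero]; exact hM0

end IsScheme

/-! ### Consistency: variation of the solution and of `f(u)` over a time step. -/

/-- A majorant of the Fourier coefficients of the time derivative of `f(u)`. -/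
def fluxRateMaj (ν : ℝ) (A : Mode → ℝ) (k : Mode) : ℝ :=
  cT * conv (rateMaj ν A) (fun l => 3 * (cT * conv A A l)) k + rateMaj ν A k

section FluxRate
variable {ν : ℝ} {A : Mode → ℝ}

lemma conv_const_mul (c : ℝ) (A B : Mode → ℝ) (k : Mode) :
    conv (fun l => c * A l) B k = c * conv A B k := by
  unfold conv
  rw [← tsum_mul_left]
  exact tsum_congr fun l => by ring

lemma fluxRateMaj_nonneg (hν : 0 < ν) (hA0 : ∀ k, 0 ≤ A k) (k : Mode) :
    0 ≤ fluxRateMaj ν A k := by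
  have hB0 := rateMaj_nonneg hν hA0
  exact add_nonneg (mul_nonneg cT_pos.le (conv_nonneg hB0 (fun l =>
    mul_nonneg (by norm_num) (mul_nonneg cT_pos.le (conv_nonneg hA0 hA0 l))) k)) (hB0 k)

lemma summable_fluxRateMaj (hν : 0 < ν) (hA0 : ∀ k, 0 ≤ A k) (hA : WSum 2 A) :
    Summable (fluxRateMaj ν A) := by
  have hB0 := rateMaj_nonneg hν hA0
  have hAs := hA.summable hA0 (by norm_num)
  have hB : Summable (rateMaj ν A) :=
    (WSum.rateMaj (ν := ν) le_rfl hA0 (by simpa using hA)).summable hB0 le_rfl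
  exact ((summable_conv hB0 (fun l => mul_nonneg (by norm_num)
    (mul_nonneg cT_pos.le (conv_nonneg hA0 hA0 l))) hB
    (((summable_conv hA0 hA0 hAs hAs).mul_left cT).mul_left 3)).mul_left cT).add hB

/-- A Lipschitz bound of the Fourier coefficients of `f(g)`. -/
lemma norm_fourierHat_f_sub_le {g h : Torus → ℝ} (hg : Continuous g) (hh : Continuous h)
    (hν : 0 < ν) (hA0 : ∀ k, 0 ≤ A k) (hA : WSum 2 A) (hgA : ∀ k, ‖fourierHat g k‖ ≤ A k)
    (hhA : ∀ k, ‖fourierHat h k‖ ≤ A k) {c : ℝ}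
    (hd : ∀ k, ‖fourierHat g k - fourierHat h k‖ ≤ c * rateMaj ν A k) (k : Mode) :
    ‖fourierHat (fun x => f (g x)) k - fourierHat (fun x => f (h x)) k‖
      ≤ c * fluxRateMaj ν A k := by
  have hB0 := rateMaj_nonneg hν hA0
  have hAs := hA.summable hA0 (by norm_num)
  have hB : Summable (rateMaj ν A) :=
    (WSum.rateMaj (ν := ν) le_rfl hA0 (by simpa using hA)).summable hB0 le_rfl
  have hconv := (summable_conv hA0 hA0 hAs hAs).mul_left cT
  have hq : ∀ k, ‖fourierHat (fun x => (g x * g x + g x * h x) + h x * h x) k‖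
      ≤ 3 * (cT * conv A A k) := by
    intro k
    have h1 := norm_fourierHat_mul_le hg hg hAs hAs hgA hgA k
    have h2 := norm_fourierHat_mul_le hg hh hAs hAs hgA hhA k
    have h3 := norm_fourierHat_mul_le hh hh hAs hAs hhA hhA k
    rw [fourierHat_add (g := fun x => g x * g x + g x * h x)
      (integrable_of_continuous (by fun_prop)) (integrable_of_continuous (by fun_prop)),
      fourierHat_add (integrable_of_continuous (by fun_prop))
      (integrable_of_continuous (by fun_prop))]
    refine (norm_add_le _ _).trans ((add_le_add (norm_add_le _ _) le_rfl).trans ?_)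
    linarith
  have hd' : ∀ k, ‖fourierHat (fun x => g x - h x) k‖ ≤ c * rateMaj ν A k := fun k => by
    rw [fourierHat_sub (integrable_of_continuous hg) (integrable_of_continuous hh)]; exact hd k
  have e : (fun x => f (g x) - f (h x))
      = fun x => (g x - h x) * ((g x * g x + g x * h x) + h x * h x) - (g x - h x) := by
    ext x; unfold f; ring
  rw [← fourierHat_sub (integrable_of_continuous (by fun_prop))
    (integrable_of_continuous (by fun_prop)), e,
    fourierHat_sub (g := fun x => (g x - h x) * ((g x * g x + g x * h x) + h x * h x))
      (integrable_of_continuous (by fun_prop)) (integrable_of_continuous (by fun_prop))]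
  have h5 := norm_fourierHat_mul_le (hg.sub hh)
    (show Continuous fun x => (g x * g x + g x * h x) + h x * h x by fun_prop)
    (hB.mul_left c) (hconv.mul_left 3) hd' hq k
  rw [conv_const_mul] at h5
  refine (norm_sub_le _ _).trans ((add_le_add h5 (hd' k)).trans (le_of_eq ?_))
  unfold fluxRateMaj
  ring

end FluxRate

lemma IsSolution.norm_fourierHat_sub_le {ν : ℝ} {u₀ : Torus → ℝ} {u : ℝ → Torus → ℝ}
    (hu : IsSolution ν u₀ u) (hν : 0 < ν) {A : Mode → ℝ} (hA : Summable A)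
    (huA : ∀ t, 0 ≤ t → ∀ k, ‖fourierHat (u t) k‖ ≤ A k) {a b : ℝ} (ha : 0 ≤ a) (hab : a ≤ b)
    (k : Mode) : ‖fourierHat (u b) k - fourierHat (u a) k‖ ≤ (b - a) * rateMaj ν A k := by
  have hsub : Icc a b ⊆ Ici 0 := fun t ht => ha.trans ht.1
  have c1 := (hu.continuousOn_fourierHat k).mono hsub
  have c2 := (hu.continuousOn_fourierHat_f k).mono hsub
  rw [← intervalIntegral.integral_eq_sub_of_hasDerivAt_of_le hab c1
    (fun t ht => hu.hasDerivAt_fourierHat k (ha.trans_lt ht.1)) ?_]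
  · have h1 := intervalIntegral.norm_integral_le_of_norm_le_const (a := a) (b := b)
      (C := rateMaj ν A k) (f := fun t => -(normSq k : ℂ) * (ν * (normSq k : ℝ) *
        fourierHat (u t) k + fourierHat (fun x => f (u t x)) k)) fun t ht => by
        rw [uIoc_of_le hab] at ht
        have ht0 : 0 ≤ t := ha.trans ht.1.le
        exact norm_rate_le hν (huA t ht0 k)
          (norm_fourierHat_f_le (hu.continuous_slice ht0) hA (huA t ht0) k)
    rw [abs_of_nonneg (sub_nonneg.mpr hab), mul_comm (rateMaj ν A k)] at h1
    exact h1
  · refine ContinuousOn.intervalIntegrable ?_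
    rw [uIcc_of_le hab]
    fun_prop

/-! ### The error recursion and the discrete Gronwall inequality. -/

/-- One step of the error recursion for a single mode. -/
lemma norm_error_sq_le {E m p κ τ S lam ν B c : ℝ} {e v v' φ ψ e' : ℂ} (hτ : 0 < τ)
    (hm0 : 0 ≤ m) (hm1 : m ≤ 1) (hmS : 1 - m ≤ S * τ * lam ^ 2) (hE0 : 0 ≤ E) (hE1 : E ≤ 1)
    (hp : p = E * m) (hκ0 : 0 ≤ κ) (hκ : p * κ ^ 2 ≤ τ / ν)
    (hv : ‖v' - v‖ ≤ τ * B)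
    (hex : ‖v' - (1 - E : ℝ) * v + (E * κ : ℝ) * φ‖ ≤ E * κ * (τ * c))
    (he' : e' = (1 - p : ℝ) * (v + e) - (p * κ : ℝ) * ψ - v') :
    ‖e'‖ ^ 2 ≤ (1 + τ) * (‖e‖ ^ 2 + τ / ν * (‖ψ - φ‖ + τ * c) ^ 2
      + τ * (τ * (S * lam ^ 2 * B)) ^ 2) := by
  have hp0 : 0 ≤ p := by rw [hp]; positivity
  have hp1 : p ≤ 1 := by rw [hp]; exact mul_le_one₀ hE1 hm0 hm1
  set y := κ * (‖ψ - φ‖ + τ * c) with hy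
  set z := τ * (τ * (S * lam ^ 2 * B)) with hz
  have hbound : ‖e'‖ ≤ ((1 - p) * ‖e‖ + p * y) + z := by
    -- Since `p = E m`, the exact step splits as `v' = (1 - m)v' + m v'`: the part with `1 - m` is
    -- the stabilisation error, and the part with `m` is compared with Duhamel's formula with frozen
    -- `φ`.
    have e1 : e' = ((1 - p : ℝ) * e - (p * κ : ℝ) * (ψ - φ)) - ((1 - m : ℝ) * (v' - v)
        + (m : ℝ) * (v' - (1 - E : ℝ) * v + (E * κ : ℝ) * φ)) := by
      rw [he', hp]; push_cast; ring
    have n1 : ‖(1 - p : ℝ) * e‖ = (1 - p) * ‖e‖ := by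
      rw [norm_mul, Complex.norm_real, Real.norm_of_nonneg (by linarith)]
    have n2 : ‖((p * κ : ℝ) : ℂ) * (ψ - φ)‖ = p * κ * ‖ψ - φ‖ := by
      rw [norm_mul, Complex.norm_real, Real.norm_of_nonneg (by positivity)]
    have n3 : ‖((1 - m : ℝ) : ℂ) * (v' - v)‖ ≤ z := by
      rw [norm_mul, Complex.norm_real, Real.norm_of_nonneg (by linarith)]
      calc (1 - m) * ‖v' - v‖ ≤ (S * τ * lam ^ 2) * (τ * B) :=
            mul_le_mul hmS hv (norm_nonneg _) ((by linarith : 0 ≤ 1 - m).trans hmS)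
        _ = z := by rw [hz]; ring
    have n4 : ‖(m : ℂ) * (v' - (1 - E : ℝ) * v + (E * κ : ℝ) * φ)‖ ≤ p * κ * (τ * c) := by
      rw [norm_mul, Complex.norm_real, Real.norm_of_nonneg hm0]
      calc _ ≤ m * (E * κ * (τ * c)) := mul_le_mul_of_nonneg_left hex hm0
        _ = _ := by rw [hp]; ring
    rw [e1]
    refine (norm_sub_le _ _).trans ?_
    have n5 := norm_sub_le (((1 - p : ℝ) : ℂ) * e) (((p * κ : ℝ) : ℂ) * (ψ - φ))
    have n6 := norm_add_le (((1 - m : ℝ) : ℂ) * (v' - v))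
      ((m : ℂ) * (v' - (1 - E : ℝ) * v + (E * κ : ℝ) * φ))
    rw [n1, n2] at n5
    rw [hy]
    linarith
  set w := (1 - p) * ‖e‖ + p * y with hw
  -- Convexity of the square with weights `1 - p` and `p`. Keeping one factor `p` next to `κ²` is
  -- essential: `pκ²` is at most `τ/ν`, uniformly in the mode.
  have h1 : w ^ 2 ≤ ‖e‖ ^ 2 + τ / ν * (‖ψ - φ‖ + τ * c) ^ 2 := by
    have h2 : w ^ 2 ≤ (1 - p) * ‖e‖ ^ 2 + p * y ^ 2 := by
      have := mul_nonneg (mul_nonneg hp0 (by linarith : 0 ≤ 1 - p)) (sq_nonneg (‖e‖ - y))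
      rw [hw]; linarith
    have h3 : p * y ^ 2 ≤ τ / ν * (‖ψ - φ‖ + τ * c) ^ 2 := by
      calc p * y ^ 2 = p * κ ^ 2 * (‖ψ - φ‖ + τ * c) ^ 2 := by rw [hy]; ring
        _ ≤ _ := mul_le_mul_of_nonneg_right hκ (sq_nonneg _)
    have h4 := mul_nonneg hp0 (sq_nonneg ‖e‖)
    linarith
  -- With `z = τq`, the cross term satisfies `2τwq ≤ τw² + τq²`.
  have h5 : (w + z) ^ 2 ≤ (1 + τ) * w ^ 2 + (1 + τ) * (τ * (τ * (S * lam ^ 2 * B)) ^ 2) := by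
    have e2 : z = τ * (τ * (S * lam ^ 2 * B)) := hz
    set q := τ * (S * lam ^ 2 * B)
    rw [e2]
    have := mul_nonneg hτ.le (sq_nonneg (w - q))
    linarith
  calc ‖e'‖ ^ 2 ≤ (w + z) ^ 2 := pow_le_pow_left₀ (norm_nonneg _) hbound 2
    _ ≤ _ := h5
    _ ≤ (1 + τ) * (‖e‖ ^ 2 + τ / ν * (‖ψ - φ‖ + τ * c) ^ 2)
        + (1 + τ) * (τ * (τ * (S * lam ^ 2 * B)) ^ 2) := by
      have : (1 + τ) * w ^ 2 ≤ (1 + τ) * (‖e‖ ^ 2 + τ / ν * (‖ψ - φ‖ + τ * c) ^ 2) :=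
        mul_le_mul_of_nonneg_left h1 (by linarith)
      linarith
    _ = _ := by ring

/-- A discrete Gronwall inequality. -/
lemma discrete_gronwall {a : ℕ → ℝ} {τ C K : ℝ} (hτ : 0 < τ) (hC : 0 ≤ C) (hK : 0 ≤ K)
    (h0 : a 0 = 0) (h : ∀ n, a (n + 1) ≤ (1 + τ) * ((1 + C * τ) * a n + τ * K)) (n : ℕ) :
    a n ≤ K * Real.exp ((2 + C) * (n * τ)) := by
  -- The inductive bound carries the elapsed time `nτ` as a factor, absorbed at the end by `nτ ≤ exp
  -- (nτ)`. No smallness of `τ` enters.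
  have h1 : a n ≤ K * ((n * τ) * Real.exp ((1 + C) * (n * τ))) := by
    induction n with
    | zero => simp [h0]
    | succ n ih =>
      have e1 : 1 + τ ≤ Real.exp τ := by linarith [Real.add_one_le_exp τ]
      have e2 : 1 + C * τ ≤ Real.exp (C * τ) := by linarith [Real.add_one_le_exp (C * τ)]
      have e3 : (1 + τ) * (1 + C * τ) ≤ Real.exp ((1 + C) * τ) := by
        rw [show (1 + C) * τ = τ + C * τ by ring, Real.exp_add]
        exact mul_le_mul e1 e2 (by positivity) (Real.exp_pos _).le
      set X := (n * τ) * Real.exp ((1 + C) * (n * τ)) with hX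
      have hX0 : 0 ≤ X := by positivity
      have e4 : 1 + τ ≤ Real.exp ((1 + C) * τ) * Real.exp ((1 + C) * (n * τ)) := by
        have a1 : 1 + τ ≤ (1 + τ) * (1 + C * τ) :=
          le_mul_of_one_le_right (by linarith) (by linarith [mul_nonneg hC hτ.le])
        have a2 : 1 ≤ Real.exp ((1 + C) * (n * τ)) := Real.one_le_exp (by positivity)
        exact (a1.trans e3).trans (le_mul_of_one_le_right (Real.exp_pos _).le a2)
      calc a (n + 1) ≤ (1 + τ) * ((1 + C * τ) * a n + τ * K) := h n
        _ ≤ (1 + τ) * ((1 + C * τ) * (K * X) + τ * K) := by gcongr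
        _ = K * (((1 + τ) * (1 + C * τ)) * X + (1 + τ) * τ) := by ring
        _ ≤ K * (Real.exp ((1 + C) * τ) * X
            + Real.exp ((1 + C) * τ) * Real.exp ((1 + C) * (n * τ)) * τ) := by gcongr
        _ = K * (((n + 1 : ℕ) * τ) * (Real.exp ((1 + C) * τ) * Real.exp ((1 + C) * (n * τ)))) := by
            rw [hX]; push_cast; ring
        _ = _ := by rw [← Real.exp_add]; congr 3; push_cast; ring
  refine h1.trans (mul_le_mul_of_nonneg_left ?_ hK)
  have e5 : (n : ℝ) * τ ≤ Real.exp (n * τ) := by linarith [Real.add_one_le_exp ((n : ℝ) * τ)]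
  calc _ ≤ Real.exp (n * τ) * Real.exp ((1 + C) * (n * τ)) := by gcongr
    _ = _ := by rw [← Real.exp_add]; congr 1; ring

lemma natCast_rpow_le_jap {N : ℕ} {s : ℝ} (hs : 0 ≤ s) {k : Mode} (hk : k ∉ modes N) :
    (N : ℝ) ^ (2 * s) ≤ jap k ^ s := by
  have h1 : (N : ℝ) ^ 2 ≤ jap k := by
    simp only [modes, Fintype.mem_piFinset, Finset.mem_Icc, not_forall] at hk
    obtain ⟨i, hi⟩ := hk
    have h2 : (N : ℤ) ^ 2 ≤ k i ^ 2 := by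
      rcases not_and_or.mp hi with h | h
      · nlinarith
      · nlinarith
    have h3 : (N : ℝ) ^ 2 ≤ (k i : ℝ) ^ 2 := by exact_mod_cast h2
    have h4 : (k i : ℝ) ^ 2 ≤ normSq k := Finset.single_le_sum (f := fun i => (k i : ℝ) ^ 2)
      (fun _ _ => sq_nonneg _) (Finset.mem_univ i)
    unfold jap; linarith
  rw [Real.rpow_mul (Nat.cast_nonneg N), Real.rpow_two]
  exact Real.rpow_le_rpow (by positivity) h1 hs

lemma abs_f_sub_le {R a b : ℝ} (ha : |a| ≤ R) (hb : |b| ≤ R) :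
    (f a - f b) ^ 2 ≤ (3 * R ^ 2 + 1) ^ 2 * (a - b) ^ 2 := by
  have e : f a - f b = (a ^ 2 + a * b + b ^ 2 - 1) * (a - b) := by unfold f; ring
  rw [e, mul_pow]
  refine mul_le_mul_of_nonneg_right ?_ (sq_nonneg _)
  have h1 : a ^ 2 ≤ R ^ 2 := sq_le_sq' (abs_le.mp ha).1 (abs_le.mp ha).2
  have h2 : b ^ 2 ≤ R ^ 2 := sq_le_sq' (abs_le.mp hb).1 (abs_le.mp hb).2
  refine sq_le_sq' ?_ ?_ <;> nlinarith [sq_nonneg (a - b), sq_nonneg (a + b)]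

lemma MemSobolev.mono {s t : ℝ} {g : Torus → ℝ} (hg : MemSobolev t g) (hs : 0 ≤ s) (hst : s ≤ t) :
    MemSobolev s g := by
  refine ⟨hg.1, Summable.of_nonneg_of_le (fun k => mul_nonneg (add_nonneg zero_le_one
    (Real.rpow_nonneg (normSq_nonneg k) _)) (sq_nonneg _)) (fun k => ?_) (hg.2.mul_left 2)⟩
  rw [← mul_assoc]
  refine mul_le_mul_of_nonneg_right ?_ (sq_nonneg _)
  have h0 := normSq_nonneg k
  have h1 := Real.rpow_nonneg h0 t
  rcases le_total (normSq k) 1 with h | h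
  · linarith [Real.rpow_le_one h0 h hs]
  · linarith [Real.rpow_le_rpow_of_exponent_le h hst]

lemma summable_norm_fourierHat_sub_sq {g h : Torus → ℝ} (hg : Continuous g) (hh : Continuous h) :
    Summable fun k => ‖fourierHat g k - fourierHat h k‖ ^ 2 := by
  have := (parseval (memLp_of_continuous (hg.sub hh) 2)).summable
  exact this.congr fun k => by
    rw [← fourierHat_sub (integrable_of_continuous hg) (integrable_of_continuous hh)]; rfl

lemma integral_sub_sq_eq {g h : Torus → ℝ} (hg : Continuous g) (hh : Continuous h) :
    ∫ x, (g x - h x) ^ 2 = cT * ∑' k, ‖fourierHat g k - fourierHat h k‖ ^ 2 := by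
  rw [integral_sq_eq (g := fun x => g x - h x) (hg.sub hh)]
  simp only [fourierHat_sub (integrable_of_continuous hg) (integrable_of_continuous hh)]

lemma sum_norm_fourierHat_f_sub_sq_le {g h : Torus → ℝ} (hg : Continuous g) (hh : Continuous h)
    {R : ℝ} (hgR : ∀ x, |g x| ≤ R) (hhR : ∀ x, |h x| ≤ R) (I : Finset Mode) :
    ∑ k ∈ I, ‖fourierHat (fun x => f (g x)) k - fourierHat (fun x => f (h x)) k‖ ^ 2
      ≤ (3 * R ^ 2 + 1) ^ 2 * ∑' k, ‖fourierHat g k - fourierHat h k‖ ^ 2 := by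
  have cg : Continuous fun x => f (g x) := by fun_prop
  have ch : Continuous fun x => f (h x) := by fun_prop
  refine ((summable_norm_fourierHat_sub_sq cg ch).sum_le_tsum I fun k _ => sq_nonneg _).trans ?_
  refine le_of_mul_le_mul_left ?_ cT_pos
  rw [← integral_sub_sq_eq cg ch, mul_left_comm, ← integral_sub_sq_eq hg hh, ← integral_const_mul]
  exact integral_mono (integrable_of_continuous (by fun_prop))
    (integrable_of_continuous (by fun_prop)) fun x => abs_f_sub_le (hgR x) (hhR x)

/-- Outside the truncation only `h` contributes, and there `N^{2s} ≤ jap^s`. The tail feeds back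
into the recursion because `f` couples all modes. -/
lemma IsTrig.tsum_norm_sub_sq_le {N : ℕ} {g h : Torus → ℝ} (hg : IsTrig N g) (hh : Continuous h)
    (hN : 0 < N) {s : ℝ} (hs : 0 ≤ s) {A : Mode → ℝ} (hhA : ∀ k, ‖fourierHat h k‖ ≤ A k)
    (hA : Summable fun k => jap k ^ s * A k ^ 2) :
    ∑' k, ‖fourierHat g k - fourierHat h k‖ ^ 2
      ≤ ∑ k ∈ modes N, ‖fourierHat g k - fourierHat h k‖ ^ 2
        + ((N : ℝ) ^ (-s)) ^ 2 * ∑' k, jap k ^ s * A k ^ 2 := by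
  classical
  set e : Mode → ℝ := fun k => ‖fourierHat g k - fourierHat h k‖ ^ 2 with he
  have hN0 : (0 : ℝ) < N := by exact_mod_cast hN
  have hsum : Summable fun k => if k ∈ modes N then e k else 0 :=
    summable_of_ne_finset_zero (s := modes N) fun k hk => if_neg hk
  have h1 : ∑' k, (if k ∈ modes N then e k else 0) = ∑ k ∈ modes N, e k := by
    rw [tsum_eq_sum (s := modes N) fun k hk => if_neg hk]
    exact Finset.sum_congr rfl fun k hk => if_pos hk
  rw [← h1, ← tsum_mul_left, ← hsum.tsum_add (hA.mul_left _)]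
  refine (summable_norm_fourierHat_sub_sq hg.continuous hh).tsum_le_tsum (fun k => ?_)
    (hsum.add (hA.mul_left _))
  have h2 : 0 ≤ ((N : ℝ) ^ (-s)) ^ 2 * (jap k ^ s * A k ^ 2) :=
    mul_nonneg (sq_nonneg _) (mul_nonneg (jap_rpow_pos _ k).le (sq_nonneg _))
  by_cases hk : k ∈ modes N
  · rw [if_pos hk]; linarith
  · rw [if_neg hk, hg.eq_zero k hk, zero_sub, norm_neg, zero_add]
    have h3 := natCast_rpow_le_jap hs hk
    have h4 : ((N : ℝ) ^ (-s)) ^ 2 * (N : ℝ) ^ (2 * s) = 1 := by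
      rw [← Real.rpow_natCast, ← Real.rpow_mul hN0.le, ← Real.rpow_add hN0]
      norm_num
      rw [show -(s * 2) + 2 * s = 0 by ring, Real.rpow_zero]
    calc ‖fourierHat h k‖ ^ 2 ≤ A k ^ 2 := pow_le_pow_left₀ (norm_nonneg _) (hhA k) 2
      _ = ((N : ℝ) ^ (-s)) ^ 2 * ((N : ℝ) ^ (2 * s) * A k ^ 2) := by rw [← mul_assoc, h4, one_mul]
      _ ≤ _ := by gcongr

section ErrorRecursion
variable {ν S τ : ℝ} {N : ℕ} {u₀ : Torus → ℝ} {u : ℝ → Torus → ℝ} {U : ℕ → Torus → ℝ} {A : Mode → ℝ}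

lemma norm_error_succ_sq_le (hu : IsSolution ν u₀ u) (hU : IsScheme ν S τ N u₀ U) (hν : 0 < ν)
    (hτ : 0 < τ) (hS : 0 ≤ S) (hA0 : ∀ k, 0 ≤ A k) (hA : WSum 2 A)
    (huA : ∀ t, 0 ≤ t → ∀ k, ‖fourierHat (u t) k‖ ≤ A k) (n : ℕ) {k : Mode} (hk : k ∈ modes N) :
    ‖fourierHat (U (n + 1)) k - fourierHat (u ((n + 1 : ℕ) * τ)) k‖ ^ 2
      ≤ (1 + τ) * (‖fourierHat (U n) k - fourierHat (u (n * τ)) k‖ ^ 2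
        + τ / ν * (‖fourierHat (fun x => f (U n x)) k - fourierHat (fun x => f (u (n * τ) x)) k‖
          + τ * fluxRateMaj ν A k) ^ 2
        + τ * (τ * (S * normSq k ^ 2 * rateMaj ν A k)) ^ 2) := by
  have hAs := hA.summable hA0 (by norm_num)
  have ht0 : 0 ≤ (n : ℝ) * τ := by positivity
  have htt : ((n + 1 : ℕ) : ℝ) * τ - n * τ = τ := by push_cast; ring
  have hle : (n : ℝ) * τ ≤ (n + 1 : ℕ) * τ := by linarith
  obtain ⟨hE0, hE1, hE2⟩ := one_sub_exp_bounds hν hτ k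
  have hl := normSq_nonneg k
  have hd : 0 < 1 + S * τ * normSq k ^ 2 := by positivity
  have hST : 0 ≤ S * τ * normSq k ^ 2 := by positivity
  have hv := hu.norm_fourierHat_sub_le hν hAs huA ht0 hle k
  have hex := hu.norm_duhamel hν ht0 hle k (φ₀ := fourierHat (fun x => f (u (n * τ) x)) k)
    (P := τ * fluxRateMaj ν A k) fun t ht => by
      have ht1 : 0 ≤ t := ht0.trans ht.1.le
      refine norm_fourierHat_f_sub_le (hu.continuous_slice ht1) (hu.continuous_slice ht0) hν hA0 hA
        (huA t ht1) (huA _ ht0) (fun l => ?_) k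
      refine (hu.norm_fourierHat_sub_le hν hAs huA ht0 ht.1.le l).trans ?_
      exact mul_le_mul_of_nonneg_right (by linarith [ht.2]) (rateMaj_nonneg hν hA0 l)
  rw [htt] at hv hex
  set E := 1 - Real.exp (-ν * normSq k ^ 2 * τ) with hE
  have hE' : Real.exp (-ν * normSq k ^ 2 * τ) = 1 - E := by rw [hE]; ring
  rw [hE', div_eq_mul_inv] at hex
  refine norm_error_sq_le (E := E) (m := (1 + S * τ * normSq k ^ 2)⁻¹) (κ := (ν * normSq k)⁻¹)
    (p := damping ν S τ k) (v := fourierHat (u (n * τ)) k)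
    (v' := fourierHat (u ((n + 1 : ℕ) * τ)) k)
    hτ (inv_nonneg.mpr hd.le) (inv_le_one_of_one_le₀ (by linarith)) ?_ hE0 hE1
    (by rw [damping, div_eq_mul_inv]) (by positivity) ?_ hv hex ?_
  · have h1 : 1 - (1 + S * τ * normSq k ^ 2)⁻¹
        = S * τ * normSq k ^ 2 * (1 + S * τ * normSq k ^ 2)⁻¹ := by field_simp; ring
    rw [h1]
    exact mul_le_of_le_one_right hST (inv_le_one_of_one_le₀ (by linarith))
  · by_cases h0 : k = 0
    · subst h0; simp; positivity
    · have hl' := normSq_pos h0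
      calc damping ν S τ k * ((ν * normSq k)⁻¹) ^ 2
          ≤ (ν * normSq k ^ 2 * τ) * ((ν * normSq k)⁻¹) ^ 2 :=
            mul_le_mul_of_nonneg_right ((damping_le hν hτ hS k).trans hE2) (sq_nonneg _)
        _ = τ / ν := by field_simp
  · rw [hU.fourierHat_step hν hτ hS n hk]
    push_cast
    ring

/-- Parseval and the pointwise Lipschitz bound of `f` control the nonlinear differences by the full
`L²` error, that is by the low modes and the tail. The other terms are summed by majorants, with
`S²τ³` in front of the stabilisation error. -/
lemma sum_error_succ_sq_le (hu : IsSolution ν u₀ u) (hU : IsScheme ν S τ N u₀ U) (hν : 0 < ν)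
    (hτ : 0 < τ) (hS : 0 ≤ S) (hN : 0 < N) {s : ℝ} (hs : 0 ≤ s) (hA0 : ∀ k, 0 ≤ A k)
    (hA : WSum 4 A) (hAs : Summable fun k => jap k ^ s * A k ^ 2)
    (huA : ∀ t, 0 ≤ t → ∀ k, ‖fourierHat (u t) k‖ ≤ A k) {R : ℝ}
    (hUR : ∀ n x, |U n x| ≤ R) (huR : ∀ t, 0 ≤ t → ∀ x, |u t x| ≤ R) (n : ℕ) :
    ∑ k ∈ modes N, ‖fourierHat (U (n + 1)) k - fourierHat (u ((n + 1 : ℕ) * τ)) k‖ ^ 2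
      ≤ (1 + τ) * ((1 + 2 * (3 * R ^ 2 + 1) ^ 2 / ν * τ)
          * ∑ k ∈ modes N, ‖fourierHat (U n) k - fourierHat (u (n * τ)) k‖ ^ 2
        + τ * (2 * (3 * R ^ 2 + 1) ^ 2 / ν * (((N : ℝ) ^ (-s)) ^ 2 * ∑' k, jap k ^ s * A k ^ 2)
          + τ ^ 2 * (2 / ν * ∑' k, fluxRateMaj ν A k ^ 2
            + S ^ 2 * ∑' k, (jap k ^ (2 : ℝ) * rateMaj ν A k) ^ 2))) := by
  have hA2 : WSum 2 A := hA.mono hA0 (by norm_num)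
  have ht0 : 0 ≤ (n : ℝ) * τ := by positivity
  have hB0 := rateMaj_nonneg hν hA0
  have hB : WSum 2 (rateMaj ν A) := WSum.rateMaj (by norm_num) hA0 (by norm_num; exact hA)
  have hc := summable_sq_of_summable (fluxRateMaj_nonneg hν hA0) (summable_fluxRateMaj hν hA0 hA2)
  have hB2 := summable_sq_of_summable
    (fun k => mul_nonneg (jap_rpow_pos _ k).le (hB0 k)) hB
  have h1 := Finset.sum_le_sum fun k (hk : k ∈ modes N) =>
    norm_error_succ_sq_le hu hU hν hτ hS hA0 hA2 huA n hk
  refine h1.trans ?_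
  rw [← Finset.mul_sum]
  refine mul_le_mul_of_nonneg_left ?_ (by linarith)
  set a := ∑ k ∈ modes N, ‖fourierHat (U n) k - fourierHat (u (n * τ)) k‖ ^ 2 with ha
  set ψ : Mode → ℝ := fun k =>
    ‖fourierHat (fun x => f (U n x)) k - fourierHat (fun x => f (u (n * τ) x)) k‖ with hψ
  have h2 := sum_norm_fourierHat_f_sub_sq_le (hU.isTrig hτ n).continuous (hu.continuous_slice ht0)
    (hUR n) (huR _ ht0) (modes N)
  have h3 := (hU.isTrig hτ n).tsum_norm_sub_sq_le (hu.continuous_slice ht0) hN hs (huA _ ht0) hAs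
  have h4 := hc.sum_le_tsum (modes N) fun k _ => sq_nonneg _
  have h5 := hB2.sum_le_tsum (modes N) fun k _ => sq_nonneg _
  set L := 3 * R ^ 2 + 1
  set W := ((N : ℝ) ^ (-s)) ^ 2 * ∑' k, jap k ^ s * A k ^ 2
  have h6 : ∀ k, ‖fourierHat (U n) k - fourierHat (u (n * τ)) k‖ ^ 2
        + τ / ν * (ψ k + τ * fluxRateMaj ν A k) ^ 2
        + τ * (τ * (S * normSq k ^ 2 * rateMaj ν A k)) ^ 2
      ≤ ‖fourierHat (U n) k - fourierHat (u (n * τ)) k‖ ^ 2 + (2 * τ / ν * ψ k ^ 2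
        + (2 * τ ^ 3 / ν * fluxRateMaj ν A k ^ 2
        + τ ^ 3 * S ^ 2 * (jap k ^ (2 : ℝ) * rateMaj ν A k) ^ 2)) := by
    intro k
    have e1 : τ / ν * (ψ k + τ * fluxRateMaj ν A k) ^ 2
        ≤ 2 * τ / ν * ψ k ^ 2 + 2 * τ ^ 3 / ν * fluxRateMaj ν A k ^ 2 := by
      calc τ / ν * (ψ k + τ * fluxRateMaj ν A k) ^ 2
          ≤ τ / ν * (2 * (ψ k ^ 2 + (τ * fluxRateMaj ν A k) ^ 2)) :=
            mul_le_mul_of_nonneg_left add_sq_le (by positivity)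
        _ = _ := by ring
    have e2 : (normSq k ^ 2 * rateMaj ν A k) ^ 2 ≤ (jap k ^ (2 : ℝ) * rateMaj ν A k) ^ 2 := by
      have hl := normSq_nonneg k
      have hj : normSq k ≤ jap k := by unfold jap; linarith
      have := hB0 k
      rw [Real.rpow_two]
      gcongr
    have e3 : τ * (τ * (S * normSq k ^ 2 * rateMaj ν A k)) ^ 2
        ≤ τ ^ 3 * S ^ 2 * (jap k ^ (2 : ℝ) * rateMaj ν A k) ^ 2 := by
      calc _ = τ ^ 3 * S ^ 2 * (normSq k ^ 2 * rateMaj ν A k) ^ 2 := by ring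
        _ ≤ _ := mul_le_mul_of_nonneg_left e2 (by positivity)
    linarith
  refine (Finset.sum_le_sum fun k _ => h6 k).trans ?_
  rw [Finset.sum_add_distrib, Finset.sum_add_distrib, Finset.sum_add_distrib, ← Finset.mul_sum,
    ← Finset.mul_sum, ← Finset.mul_sum]
  have h7 : 2 * τ / ν * ∑ k ∈ modes N, ψ k ^ 2 ≤ 2 * τ / ν * (L ^ 2 * (a + W)) :=
    mul_le_mul_of_nonneg_left (h2.trans (mul_le_mul_of_nonneg_left h3 (sq_nonneg _)))
      (by positivity)
  have h8 := mul_le_mul_of_nonneg_left h4 (show 0 ≤ 2 * τ ^ 3 / ν by positivity)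
  have h9 := mul_le_mul_of_nonneg_left h5 (show 0 ≤ τ ^ 3 * S ^ 2 by positivity)
  refine (add_le_add le_rfl (add_le_add h7 (add_le_add h8 h9))).trans (le_of_eq ?_)
  ring

/-- The error of the scheme in `L²`. -/
lemma integral_error_sq_le (hu : IsSolution ν u₀ u) (hU : IsScheme ν S τ N u₀ U) (hν : 0 < ν)
    (hτ : 0 < τ) (hS : 0 ≤ S) (hN : 0 < N) {s : ℝ} (hs : 0 ≤ s) (hA0 : ∀ k, 0 ≤ A k)
    (hA : WSum 4 A) (hAs : Summable fun k => jap k ^ s * A k ^ 2)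
    (huA : ∀ t, 0 ≤ t → ∀ k, ‖fourierHat (u t) k‖ ≤ A k) {R : ℝ}
    (hUR : ∀ n x, |U n x| ≤ R) (huR : ∀ t, 0 ≤ t → ∀ x, |u t x| ≤ R) (n : ℕ) :
    ∫ x, (U n x - u (n * τ) x) ^ 2
      ≤ cT * ((2 * (3 * R ^ 2 + 1) ^ 2 / ν + 1) * ∑' k, jap k ^ s * A k ^ 2
          + 2 / ν * ∑' k, fluxRateMaj ν A k ^ 2
          + ∑' k, (jap k ^ (2 : ℝ) * rateMaj ν A k) ^ 2)
        * ((1 + S) * ((N : ℝ) ^ (-s) + τ)) ^ 2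
        * Real.exp ((2 + 2 * (3 * R ^ 2 + 1) ^ 2 / ν) * (n * τ)) := by
  have ht0 : 0 ≤ (n : ℝ) * τ := by positivity
  rw [integral_sub_sq_eq (hU.isTrig hτ n).continuous (hu.continuous_slice ht0), mul_assoc, mul_assoc]
  refine mul_le_mul_of_nonneg_left ?_ cT_pos.le
  refine ((hU.isTrig hτ n).tsum_norm_sub_sq_le (hu.continuous_slice ht0) hN hs (huA _ ht0)
    hAs).trans ?_
  have hrec := sum_error_succ_sq_le hu hU hν hτ hS hN hs hA0 hA hAs huA hUR huR
  set C := 2 * (3 * R ^ 2 + 1) ^ 2 / ν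
  have hC : 0 ≤ C := by positivity
  have hW : 0 ≤ ∑' k, jap k ^ s * A k ^ 2 :=
    tsum_nonneg fun k => mul_nonneg (jap_rpow_pos _ k).le (sq_nonneg _)
  have hc : 0 ≤ ∑' k, fluxRateMaj ν A k ^ 2 := tsum_nonneg fun k => sq_nonneg _
  have hB : 0 ≤ ∑' k, (jap k ^ (2 : ℝ) * rateMaj ν A k) ^ 2 := tsum_nonneg fun k => sq_nonneg _
  set W := ∑' k, jap k ^ s * A k ^ 2
  set c := ∑' k, fluxRateMaj ν A k ^ 2
  set B := ∑' k, (jap k ^ (2 : ℝ) * rateMaj ν A k) ^ 2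
  have hq0 : 0 ≤ (N : ℝ) ^ (-s) := Real.rpow_nonneg (Nat.cast_nonneg N) _
  set q := (N : ℝ) ^ (-s)
  have hG := discrete_gronwall hτ hC (by positivity) (a := fun n => ∑ k ∈ modes N,
    ‖fourierHat (U n) k - fourierHat (u (n * τ)) k‖ ^ 2) (by
      refine Finset.sum_eq_zero fun k hk => ?_
      rw [hU.fourierHat_zero, if_pos hk, Nat.cast_zero, zero_mul, hu.fourierHat_init]
      simp) hrec n
  have hexp : 1 ≤ Real.exp ((2 + C) * (n * τ)) := Real.one_le_exp (by positivity)
  have h1 : q ^ 2 * W ≤ q ^ 2 * W * Real.exp ((2 + C) * (n * τ)) :=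
    le_mul_of_one_le_right (by positivity) hexp
  refine (add_le_add hG h1).trans ?_
  rw [← add_mul, ← mul_assoc (_ + _ + _)]
  refine mul_le_mul_of_nonneg_right ?_ (Real.exp_pos _).le
  -- Three sources of error, namely truncation, freezing of `f(u)` and stabilisation, are all
  -- measured by the common quantity `(1 + S)(q + τ)`.
  have e1 : q ^ 2 ≤ ((1 + S) * (q + τ)) ^ 2 :=
    pow_le_pow_left₀ hq0 ((by linarith : q ≤ q + τ).trans
      (le_mul_of_one_le_left (by linarith) (by linarith))) 2
  have e2 : τ ^ 2 ≤ ((1 + S) * (q + τ)) ^ 2 :=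
    pow_le_pow_left₀ hτ.le ((by linarith : τ ≤ q + τ).trans
      (le_mul_of_one_le_left (by linarith) (by linarith))) 2
  have e3 : (S * τ) ^ 2 ≤ ((1 + S) * (q + τ)) ^ 2 :=
    pow_le_pow_left₀ (by positivity) (mul_le_mul (by linarith) (by linarith) hτ.le (by linarith)) 2
  have f1 := mul_le_mul_of_nonneg_left e1 (show 0 ≤ (C + 1) * W by positivity)
  have f2 := mul_le_mul_of_nonneg_left e2 (show 0 ≤ 2 / ν * c by positivity)
  have f3 := mul_le_mul_of_nonneg_left e3 hB
  linarith

end ErrorRecursion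

/-! ### The stabilisation threshold and the final estimate. -/

/-- The additive constant in `1 + ν + ‖u₀‖²` is paid for by `ν + ν⁻¹ ≥ 2`, where `ν⁻¹/2` comes from
`ν⁻¹ log N` and `log N ≥ log 2 > 1/2`. -/
lemma stabConst_mul_dataSize_le {ν β S : ℝ} {u₀ : Torus → ℝ} {N : ℕ} (hν : 0 < ν) (hN : 2 ≤ N)
    (hβ : 2 * stabConst ≤ β)
    (hS : β * (sobolevNormSq 2 u₀ + ν⁻¹ * |Real.log ν| + ν⁻¹ * Real.log N + ν) ≤ S) :
    stabConst * dataSize ν u₀ ≤ S := by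
  have hH := sobolevNormSq_nonneg 2 u₀
  have hν' : 0 < ν⁻¹ := inv_pos.mpr hν
  have h1 : 1 / 2 ≤ Real.log N := by
    have : Real.log 2 ≤ Real.log N := Real.log_le_log (by norm_num) (by exact_mod_cast hN)
    linarith [Real.log_two_gt_d9]
  have h2 : 0 ≤ ν⁻¹ * |Real.log ν| := by positivity
  have h3 : ν⁻¹ * (1 / 2) ≤ ν⁻¹ * Real.log N := mul_le_mul_of_nonneg_left h1 hν'.le
  have h4 : 2 ≤ ν + ν⁻¹ := by
    have h5 : ν * ν⁻¹ = 1 := mul_inv_cancel₀ hν.ne'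
    nlinarith [sq_nonneg (ν - ν⁻¹)]
  have h6 : dataSize ν u₀ ≤
      2 * (sobolevNormSq 2 u₀ + ν⁻¹ * |Real.log ν| + ν⁻¹ * Real.log N + ν) := by
    unfold dataSize; linarith
  have h7 := one_le_stabConst
  refine le_trans ?_ hS
  calc stabConst * dataSize ν u₀
      ≤ stabConst * (2 * (sobolevNormSq 2 u₀ + ν⁻¹ * |Real.log ν| + ν⁻¹ * Real.log N + ν)) :=
        mul_le_mul_of_nonneg_left h6 (by linarith)
    _ = (2 * stabConst) * (sobolevNormSq 2 u₀ + ν⁻¹ * |Real.log ν| + ν⁻¹ * Real.log N + ν) := by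
        ring
    _ ≤ _ := mul_le_mul_of_nonneg_right hβ (by unfold dataSize at h6; linarith)

lemma eLpNorm_two_le {g : Torus → ℝ} (hg : Continuous g) {K : ℝ} (hK : 0 ≤ K)
    (h : ∫ x, g x ^ 2 ≤ K ^ 2) : eLpNorm g 2 volume ≤ ENNReal.ofReal K := by
  rw [(memLp_of_continuous hg 2).eLpNorm_eq_integral_rpow_norm (by norm_num) (by norm_num)]
  refine ENNReal.ofReal_le_ofReal ?_
  have e : ∫ x, ‖g x‖ ^ (2 : ℝ≥0∞).toReal = ∫ x, g x ^ 2 := by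
    congr 1; ext x; simp
  rw [e]
  have h2 : ((2 : ℝ≥0∞).toReal)⁻¹ = 1 / 2 := by norm_num
  rw [h2, ← Real.sqrt_eq_rpow]
  exact Real.sqrt_le_iff.mpr ⟨hK, h⟩

end CahnHilliard

end

open CahnHilliard in
theorem theorem1p6 :
    ∃ β₀ : ℝ → ℝ, (∀ e : ℝ, 0 < β₀ e) ∧
      ∀ (ν : ℝ), 0 < ν → ∀ (u₀ : CahnHilliard.Torus → ℝ),
        ∃ C₁ : ℝ, 0 < C₁ ∧
          ∀ (s : ℝ), 10 ≤ s → CahnHilliard.MemSobolev s u₀ →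
            ∃ C₂ : ℝ, 0 < C₂ ∧
              ∀ (M : ℝ), 0 < M →
              ∀ (τ : ℝ), 0 < τ → τ ≤ M →
              ∀ (N : ℕ), 2 ≤ N →
              ∀ (β S : ℝ), β₀ (CahnHilliard.energy ν u₀) ≤ β →
                β * (CahnHilliard.sobolevNormSq 2 u₀ + ν⁻¹ * |Real.log ν|
                  + ν⁻¹ * Real.log N + ν) ≤ S →
              ∀ (u : ℝ → CahnHilliard.Torus → ℝ), CahnHilliard.IsSolution ν u₀ u →
              ∀ (U : ℕ → CahnHilliard.Torus → ℝ), CahnHilliard.IsScheme ν S τ N u₀ U →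
              ∀ (m : ℕ), 1 ≤ m →
                MeasureTheory.eLpNorm (fun x => U m x - u (m * τ) x) 2 MeasureTheory.volume ≤
                  ENNReal.ofReal ((1 + S) * C₂ * Real.exp (C₁ * (m * τ)) *
                    ((N : ℝ) ^ (-s) + τ + τ * (N : ℝ) ^ (-s + 4))) := by
  -- The threshold can be taken constant: the energy of the truncated data is already bounded in
  -- terms of `Q`.
  refine ⟨fun _ => 2 * stabConst, fun _ => by linarith [one_le_stabConst], fun ν hν u₀ => ?_⟩
  -- `C₁` is chosen before `s`. For data outside `H¹⁰` no admissible `s` exists and any value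
  -- serves.
  by_cases h10 : MemSobolev 10 u₀
  swap
  · exact ⟨1, one_pos, fun s hs h => absurd (h.mono (by norm_num) hs) h10⟩
  have hW4 := h10.wsum
  set a : Mode → ℝ := fun k => ‖fourierHat u₀ k‖ with ha
  have ha0 : ∀ k, 0 ≤ a k := fun k => norm_nonneg _
  have has : Summable a := hW4.summable ha0 (by norm_num)
  have hD : 0 ≤ fluxConst ν (energy ν u₀) := fluxConst_nonneg hν (energy_nonneg hν u₀)
  have hD' : 0 ≤ fluxConst ν (energyConst * dataSize ν u₀ ^ 2) :=
    fluxConst_nonneg hν (mul_nonneg energyConst_pos.le (sq_nonneg _))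
  set D := fluxConst ν (energy ν u₀)
  set D' := fluxConst ν (energyConst * dataSize ν u₀ ^ 2) with hD'_def
  have hr : 0 ≤ cT * ∑' k, iterMaj ν D a 0 k :=
    mul_nonneg cT_pos.le (tsum_nonneg (iterMaj_nonneg hν ha0 0))
  have hr' : 0 ≤ cT * ∑' k, iterMaj ν D' a 0 k :=
    mul_nonneg cT_pos.le (tsum_nonneg (iterMaj_nonneg hν ha0 0))
  -- A common pointwise bound of solution and iterates, from the majorants of index `0`. These do
  -- not involve `s`, so neither does `C₁`.
  set R := cT * ∑' k, iterMaj ν D a 0 k + cT * ∑' k, iterMaj ν D' a 0 k with hR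
  -- Half of the Gronwall exponent, since the recursion is for the square of the error.
  refine ⟨(2 + 2 * (3 * R ^ 2 + 1) ^ 2 / ν) / 2, by positivity, fun s hs hus => ?_⟩
  -- Enough iterations to exhaust the regularity of the data; the additional one in `A` restores the
  -- `H^s` weight.
  set n₀ := ⌈s⌉₊
  have hsn : s ≤ n₀ := Nat.le_ceil s
  set A := iterMaj ν D a (n₀ + 1) with hA_def
  have hA0 : ∀ k, 0 ≤ A k := iterMaj_nonneg hν ha0 _
  have hAs : Summable fun k => jap k ^ s * A k ^ 2 :=
    summable_jap_iterMaj hν hD ha0 (by linarith) (hus.summable_jap (by linarith)) (by linarith)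
  have hA4 : WSum 4 A := by
    have := wsum_iterMaj hν hD ha0 (by norm_num) hW4 (n₀ + 1)
    rwa [min_eq_right (by push_cast; linarith)] at this
  set K := cT * ((2 * (3 * R ^ 2 + 1) ^ 2 / ν + 1) * ∑' k, jap k ^ s * A k ^ 2
          + 2 / ν * ∑' k, fluxRateMaj ν A k ^ 2
          + ∑' k, (jap k ^ (2 : ℝ) * rateMaj ν A k) ^ 2) with hK_def
  have hK : 0 ≤ K := by
    have hW : 0 ≤ ∑' k, jap k ^ s * A k ^ 2 :=
      tsum_nonneg fun k => mul_nonneg (jap_rpow_pos _ k).le (sq_nonneg _)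
    have hc : 0 ≤ ∑' k, fluxRateMaj ν A k ^ 2 := tsum_nonneg fun k => sq_nonneg _
    have hB : 0 ≤ ∑' k, (jap k ^ (2 : ℝ) * rateMaj ν A k) ^ 2 := tsum_nonneg fun k => sq_nonneg _
    have := cT_pos
    positivity
  refine ⟨Real.sqrt K + 1, by positivity, ?_⟩
  intro M _ τ hτ _ N hN β S hβ hS u hu U hU m _
  have hSd := stabConst_mul_dataSize_le hν hN hβ hS
  have hS0 : 0 ≤ S := by
    have h1 := sobolevNormSq_nonneg 2 u₀
    have h2 : 0 ≤ dataSize ν u₀ := by unfold dataSize; linarith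
    exact (mul_nonneg (zero_le_one.trans one_le_stabConst) h2).trans hSd
  have hUR : ∀ n x, |U n x| ≤ R := fun n x =>
    (abs_le_of_majorant (hU.isTrig hτ n).continuous (summable_iterMaj_zero hν hD' has)
      (hU.norm_fourierHat_le hν hτ (h10.mono (by norm_num) (by norm_num)).2 hSd n) x).trans
      (by linarith)
  have huR : ∀ t, 0 ≤ t → ∀ x, |u t x| ≤ R := fun t ht x =>
    (abs_le_of_majorant (hu.continuous_slice ht) (summable_iterMaj_zero hν hD has)
      (hu.norm_fourierHat_le hν h10 0 ht) x).trans (by linarith)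
  have huA : ∀ t, 0 ≤ t → ∀ k, ‖fourierHat (u t) k‖ ≤ A k := fun t ht =>
    hu.norm_fourierHat_le hν h10 (n₀ + 1) ht
  have key := integral_error_sq_le hu hU hν hτ hS0 (by omega) (by linarith : 0 ≤ s) hA0 hA4 hAs huA
    hUR huR m
  have ht0 : 0 ≤ (m : ℝ) * τ := by positivity
  have hq0 : 0 ≤ (N : ℝ) ^ (-s) := Real.rpow_nonneg (Nat.cast_nonneg N) _
  have hq1 : 0 ≤ (N : ℝ) ^ (-s + 4) := Real.rpow_nonneg (Nat.cast_nonneg N) _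
  refine eLpNorm_two_le ((hU.isTrig hτ m).continuous.sub (hu.continuous_slice ht0))
    (by positivity) (key.trans ?_)
  rw [← hK_def]
  set C := 2 * (3 * R ^ 2 + 1) ^ 2 / ν
  have hexp : Real.exp ((2 + C) * (m * τ)) = Real.exp ((2 + C) / 2 * (m * τ)) ^ 2 := by
    rw [← Real.exp_nat_mul]; congr 1; push_cast; ring
  rw [hexp]
  -- The proof gives the bound with `N^{-s} + τ`; the nonnegative term `τ N^{-s+4}` is simply added.
  calc K * ((1 + S) * ((N : ℝ) ^ (-s) + τ)) ^ 2 * Real.exp ((2 + C) / 2 * (m * τ)) ^ 2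
      = ((1 + S) * Real.sqrt K * Real.exp ((2 + C) / 2 * (m * τ)) * ((N : ℝ) ^ (-s) + τ)) ^ 2 := by
        nth_rw 1 [← Real.sq_sqrt hK]; ring
    _ ≤ _ := by
        refine pow_le_pow_left₀ (by positivity) ?_ 2
        have h1 := mul_nonneg hτ.le hq1
        refine mul_le_mul ?_ (by linarith) (by linarith) (by positivity)
        gcongr
        linarith
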